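/- **Setting.** Let $(K,d)$ be a complete metric space (with its Borel $\sigma$-algebra), let $E$ and $N$ be at most countable sets with a distinguished element of $N$, written $1$, let $(K_j)_{j\in N}$ be a partition of $K$ into non-empty Borel sets, and let $\mathcal M=(K_{i(e)},w_e,p_e)_{e\in E}$ be a Markov system: $i:E\to N$ is surjective, $t:E\to N$, $w_e:K_{i(e)}\to K_{t(e)}$ and $p_e:K_{i(e)}\to[0,1]$ are Borel measurable, no $p_e$ vanishes identically on $K_{i(e)}$, and $\sum_{e:\,i(e)=j}p_e=1$ on $K_j$ for every $j\in N$. Extend $p_e$ by $0$ and $w_e$ as an arbitrary Borel map to $K$. Let $Uf=\sum_e p_e\,f\circ w_e$, let $U^*$ be the adjoint operator on measures, and let $P(\mathcal M)$ be the set of Borel probability measures $\mu$ on $K$ with $U^*\mu=\mu$. A finite sequence $(e_1,\dots,e_k)$ in $E$ is a *path* if $i(e_{l+1})=t(e_l)$ for all $l$. *Code space.* Let $\bar E=E\cup\{\infty\}$ be the one-point compactification of the discrete space $E$, with $w_\infty=\mathrm{id}$, $p_\infty=0$, $i(\infty)=t(\infty)=1$. Let $\bar\Sigma=\bar E^{\mathbb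 Z}$ and $\bar\Sigma^+=\bar E^{\{1,2,\dots\}}$ with the product topologies and Borel $\sigma$-algebras, let $S$ be the left shift on $\bar\Sigma$, $P_S(\bar\Sigma)$ the set of $S$-invariant Borel probability measures, ${}_m[e_m,\dots,e_n]\subset\bar\Sigma$ and ${}_1[e_1,\dots,e_n]^+\subset\bar\Sigma^+$ the cylinder sets, and $\mathcal F$ the $\sigma$-algebra generated by the coordinates $\sigma_m$, $m\le 0$. For $x\in K$ let $P_x$ be the Borel probability measure on $\bar\Sigma^+$ with $P_x({}_1[e_1,\dots,e_n]^+)=p_{e_1}(x)\,p_{e_2}(w_{e_1}x)\cdots p_{e_n}(w_{e_{n-1}}\circ\dots\circ w_{e_1}x)$. For $\mu\in P(\mathcal M)$ let $\Phi(\mu)$ be the Borel probability measure on $\bar\Sigma$ with $$\Phi(\mu)({}_m[e_m,\dots,e_n])=\int p_{e_m}(x)\,p_{e_{m+1}}(w_{e_m}x)\cdots p_{e_n}(w_{e_{n-1}}\circ\dots\circ w_{e_m}x)\,d\mu(x)\qquad(m\le 0,\ n\ge m).$$ Let $\Sigma_G$ be the set of all $\sigma\in E^{\mathbb Z}$ with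 $i(\sigma_{n+1})=t(\sigma_n)$ for all $n$, with the metric $d'(\sigma,\sigma')=2^{-k}$, $k$ being the largest integer such that $\sigma_i=\sigma_i'$ for all $|i|<k$ (and $d'(\sigma,\sigma)=0$). Let $T_j=\{\sigma\in\Sigma_G: t(\sigma_0)=j\}$. *Coding map.* Fix $x_j\in K_j$ for every $j\in N$. Let $D$ be the set of all $\sigma\in\Sigma_G$ for which $\lim_{m\to-\infty}w_{\sigma_0}\circ\dots\circ w_{\sigma_m}(x_{i(\sigma_m)})$ exists; let $F(\sigma)$ be this limit for $\sigma\in D$, and $F(\sigma)=x_{t(\sigma_0)}$ for $\sigma\in\bar\Sigma\setminus D$. For a measure $\Lambda$ on $\bar\Sigma$ let $F(\Lambda)$ be its image under $F$. *States.* Let $E(\mathcal M)$ (*equilibrium states*) be the set of all $\Lambda\in P_S(\bar\Sigma)$ with $\Lambda(D)=1$ and $E_\Lambda(1_{{}_1[e]}\mid\mathcal F)=p_e\circ F$ $\Lambda$-a.e. for all $e\in E$. Let $\tilde E(\mathcal M)$ (*asymptotic states*) be the set of all $\Lambda\in P_S(\bar\Sigma)$ with $\Lambda(D)=1$ and $E_\Lambda(1_{{}_1[e]}\mid\mathcal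 F)=(\bar p_e\circ F)\,1_{T_{i(e)}}$ $\Lambda$-a.e. for all $e\in E$, where $\bar p_e$ is the continuous extension of $p_e|_{K_{i(e)}}$ to $\overline{K_{i(e)}}$, extended by $0$ to $K$. *Conditions.* $\mathcal M$ is *contractive* with rate $a$ if $\sum_{e:\,i(e)=j}p_e(x)\,d(w_ex,w_ey)\le a\,d(x,y)$ for all $j\in N$ and $x,y\in K_j$. It is *uniformly continuous* if $w_e|_{K_{i(e)}}$ and $p_e|_{K_{i(e)}}$ are uniformly continuous for every $e\in E$. It *has a dominating Markov chain* if $\sum_{e:\,i(e)=j}\sup_{K_j}p_e<\infty$ for every $j\in N$. Put $$b=\sup_{j\in N}\sup_{x\in K_j}\sum_{e:\,i(e)=j}p_e(x)\,d\bigl(w_e(x_{i(e)}),x_{t(e)}\bigr).$$ The *recurrence condition holds at* $x_0\in K$ if the measures $\alpha_n(\{j\})=\frac1n\sum_{k=1}^n (U^{*})^k\delta_{x_0}(K_j)$, $n\ge1$, on $N$ are uniformly tight: for every $\epsilon>0$ there is a finite $C\subset N$ with $\alpha_n(N\setminus C)<\epsilon$ for all $n\ge 1$. **Theorem.** Suppose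 that $\mathcal M$ is contractive with rate $a$, $0<a<1$, and uniformly continuous, and that $b<\infty$. Then the following holds. (i) If $\mathcal M$ has a dominating Markov chain and the recurrence condition holds at $x_0\in K$, then there exists $M\in\tilde E(\mathcal M)$ such that for every $j\in N$ with $M(T_j)>0$ and every $n\in\mathbb N$ there are $k\ge n$ and a path $(e_1,\dots,e_k)$ with $t(e_k)=j$ and $P_{x_0}({}_1[e_1,\dots,e_k]^+)>0$. (ii) $E(\mathcal M)\subset\Phi(P(\mathcal M))\subset\tilde E(\mathcal M)$, and $F(\Phi(\mu))=\mu$ for all $\mu\in P(\mathcal M)$. (iii) There are Borel sets $Q_1\subset Q_2\subset\dots\subset\Sigma_G$ such that $$\sum_{k\ge n}\Phi(\mu)(\bar\Sigma\setminus Q_k)\le\frac{1}{1-\sqrt a}\,a^{n/2}\qquad\text{for all }\mu\in P(\mathcal M),\ n\ge1,$$ and such that for every $k\ge1$ $$d(F(\sigma),F(\sigma'))\le\frac{8b}{(1-\sqrt a)(1-a)}\,d'(\sigma,\sigma')^{\log\sqrt a/\log(1/2)}\qquad\text{for all }\sigma,\sigma'\in Q_k\text{ with }d'(\sigma,\sigma')\le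 2^{-(k+1)}.$$ -/

import Mathlib

open Set Filter Topology MeasureTheory
open scoped ENNReal

noncomputable section

/-! ### The code space -/

/-- The alphabet `E ∪ {∞}`: the one-point compactification of the discrete space `E`. -/
def Letter (E : Type*) : Type _ := OnePoint E

namespace Letter

/-- An edge, regarded as a letter. -/
def edge {E : Type*} (e : E) : Letter E := (OnePoint.some e : OnePoint E)

/-- The added letter `∞`. -/
def infty {E : Type*} : Letter E := (OnePoint.infty : OnePoint E)

/-- Extension of a map from `E` to the alphabet by a prescribed value at `∞`. -/
def extend {E Y : Type*} (y : Y) (f : E → Y) (s : Letter E) : Y :=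
  OnePoint.elim (X := E) s y f

theorem extend_edge {E Y : Type*} (y : Y) (f : E → Y) (e : E) :
    extend y f (edge e) = f e := rfl

theorem extend_infty {E Y : Type*} (y : Y) (f : E → Y) :
    extend y f (infty : Letter E) = y := rfl

instance {E : Type*} : TopologicalSpace (Letter E) :=
  letI : TopologicalSpace E := ⊥
  inferInstanceAs (TopologicalSpace (OnePoint E))

/-- Every set of letters is measurable; for countable `E` this is the Borel `σ`-algebra. -/
instance {E : Type*} : MeasurableSpace (Letter E) := ⊤

instance {E : Type*} : DiscreteMeasurableSpace (Letter E) := ⟨fun _ => trivial⟩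

instance {E : Type*} : CompactSpace (Letter E) :=
  letI : TopologicalSpace E := ⊥
  inferInstanceAs (CompactSpace (OnePoint E))

instance {E : Type*} : T2Space (Letter E) :=
  letI : TopologicalSpace E := ⊥
  haveI : DiscreteTopology E := ⟨rfl⟩
  inferInstanceAs (T2Space (OnePoint E))

instance {E : Type*} [Countable E] : Countable (Letter E) :=
  inferInstanceAs (Countable (Option E))

instance {E : Type*} [Countable E] : BorelSpace (Letter E) where
  measurable_eq := by
    symm
    refine top_le_iff.1 fun s _ => ?_
    rw [← biUnion_of_singleton s]
    refine MeasurableSet.biUnion s.to_countable fun x _ => ?_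
    let _ : MeasurableSpace (Letter E) := borel (Letter E)
    have : BorelSpace (Letter E) := ⟨rfl⟩
    exact isClosed_singleton.measurableSet

theorem isTopologicalBasis_letter (E : Type*) :
    TopologicalSpace.IsTopologicalBasis
      (range (fun e : E => ({edge e} : Set (Letter E))) ∪
        range (fun C : Finset E => ((edge '' (C : Set E))ᶜ : Set (Letter E)))) := by
  let _ : TopologicalSpace E := ⊥
  have : DiscreteTopology E := ⟨rfl⟩
  refine TopologicalSpace.isTopologicalBasis_of_isOpen_of_nhds ?_ ?_
  · rintro u (⟨e, rfl⟩ | ⟨C, rfl⟩)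
    · have h : IsOpen ((OnePoint.some : E → OnePoint E) '' {e}) :=
        OnePoint.isOpen_image_coe.2 (isOpen_discrete _)
      rw [image_singleton] at h
      exact h
    · exact (C.finite_toSet.image _).isClosed.isOpen_compl
  · intro a u ha hu
    induction a using OnePoint.rec (X := E) with
    | infty =>
      have h := (OnePoint.isOpen_iff_of_mem (X := E) ha).1 hu
      have hf : ((OnePoint.some ⁻¹' u : Set E)ᶜ).Finite := h.2.finite_of_discrete
      refine ⟨_, Or.inr ⟨hf.toFinset, rfl⟩, ?_, ?_⟩
      · rintro ⟨e, -, he⟩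
        exact OnePoint.coe_ne_infty e he
      · intro s hs
        induction s using OnePoint.rec (X := E) with
        | infty => exact ha
        | coe e =>
          by_contra hne
          exact hs ⟨e, by rw [hf.coe_toFinset]; exact hne, rfl⟩
    | coe e => exact ⟨_, Or.inl ⟨e, rfl⟩, rfl, singleton_subset_iff.2 ha⟩

instance {E : Type*} [Countable E] : SecondCountableTopology (Letter E) :=
  (isTopologicalBasis_letter E).secondCountableTopology
    ((countable_range _).union (countable_range _))

end Letter

/-- Two-sided sequences of letters. For countable `E` the product `σ`-algebra which this type
carries is the Borel `σ`-algebra of the product topology (instance `Pi.borelSpace`). -/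
abbrev BiCode (E : Type*) : Type _ := ℤ → Letter E

/-- One-sided sequences of letters; the coordinate with index `n` is the letter `σ_{n+1}`. -/
abbrev PosCode (E : Type*) : Type _ := ℕ → Letter E

/-- The left shift. -/
def shift {E : Type*} (σ : BiCode E) : BiCode E := fun i => σ (i + 1)

/-- The cylinder `_m[l]` in the two-sided code space, for a finite word `l`. -/
def cyl {E : Type*} (m : ℤ) (l : List (Letter E)) : Set (BiCode E) :=
  {σ | ∀ (k : ℕ) (hk : k < l.length), σ (m + k) = l[k]}

/-- The cylinder `_1[l]^+` in the one-sided code space, for a finite word `l`. -/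
def posCyl {E : Type*} (l : List (Letter E)) : Set (PosCode E) :=
  {σ | ∀ (k : ℕ) (hk : k < l.length), σ k = l[k]}

/-- The `σ`-algebra `𝓕` of the past, generated by the coordinates `σ_i`, `i ≤ 0`. -/
abbrev past (E : Type*) : MeasurableSpace (BiCode E) :=
  ⨆ i : {i : ℤ // i ≤ 0}, MeasurableSpace.comap (fun σ : BiCode E => σ i) inferInstance

/-- The shift-invariant Borel probability measures on the code space. -/
def shiftInvariant (E : Type*) : Set (Measure (BiCode E)) :=
  {Λ | IsProbabilityMeasure Λ ∧ Λ.map shift = Λ}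

open Classical in
/-- The metric `d'`: it is `2^{-k}` for the largest `k` such that `σ_i = σ'_i` for all `|i| < k`,
and `0` if there is no largest such `k`, that is, if `σ = σ'`. -/
def codeDist {E : Type*} (σ σ' : BiCode E) : ℝ :=
  if σ = σ' then 0
  else (1 / 2 : ℝ) ^ sSup {k : ℕ | ∀ i : ℤ, |i| < (k : ℤ) → σ i = σ' i}

/-! ### Markov systems -/

/-- A Markov system on `X` with edges `E` and vertices `V`. The maps and the probability functions
are given on all of `X`: the latter vanish outside of their vertex sets, the former are arbitrary
Borel maps there. -/
structure MarkovSystem (X E V : Type*) [MeasurableSpace X] where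
  /-- the distinguished vertex, to which the letter `∞` is attached -/
  base : V
  /-- the vertex sets -/
  vset : V → Set X
  vset_nonempty : ∀ j, (vset j).Nonempty
  vset_measurable : ∀ j, MeasurableSet (vset j)
  vset_disjoint : Pairwise fun j k => Disjoint (vset j) (vset k)
  vset_cover : ⋃ j, vset j = Set.univ
  /-- the initial vertex of an edge -/
  src : E → V
  /-- the terminal vertex of an edge -/
  tgt : E → V
  src_surjective : Function.Surjective src
  /-- the maps -/
  w : E → X → X
  w_measurable : ∀ e, Measurable (w e)
  w_mapsTo : ∀ e, MapsTo (w e) (vset (src e)) (vset (tgt e))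
  /-- the probability functions -/
  p : E → X → ℝ
  p_measurable : ∀ e, Measurable (p e)
  p_mem_Icc : ∀ e y, p e y ∈ Icc (0 : ℝ) 1
  p_eq_zero : ∀ e, ∀ y ∉ vset (src e), p e y = 0
  p_exists_pos : ∀ e, ∃ y ∈ vset (src e), 0 < p e y
  p_sum : ∀ j, ∀ y ∈ vset j, HasSum (fun e : {e : E // src e = j} => p e y) 1

namespace MarkovSystem

section Operators

variable {X E V : Type*} [MeasurableSpace X] (M : MarkovSystem X E V)

/-- The Markov operator `U f = ∑_e p_e · (f ∘ w_e)` on non-negative functions. -/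
def markovOp (f : X → ℝ≥0∞) (y : X) : ℝ≥0∞ :=
  ∑' e : E, ENNReal.ofReal (M.p e y) * f (M.w e y)

/-- The adjoint operator `U^*` on measures; see `lintegral_adjointOp`. -/
def adjointOp (ν : Measure X) : Measure X :=
  Measure.sum fun e : E => (ν.withDensity fun y => ENNReal.ofReal (M.p e y)).map (M.w e)

/-- The duality `U^*ν(f) = ∫ U f dν`. -/
theorem lintegral_adjointOp [Countable E] (ν : Measure X) {f : X → ℝ≥0∞} (hf : Measurable f) :
    ∫⁻ y, f y ∂(M.adjointOp ν) = ∫⁻ y, M.markovOp f y ∂ν := by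
  unfold adjointOp markovOp
  rw [lintegral_sum_measure, lintegral_tsum]
  · refine tsum_congr fun e => ?_
    rw [lintegral_map hf (M.w_measurable e),
      lintegral_withDensity_eq_lintegral_mul _ (M.p_measurable e).ennreal_ofReal
        (g := fun y => f (M.w e y)) (hf.comp (M.w_measurable e))]
    rfl
  · intro e
    exact ((M.p_measurable e).ennreal_ofReal.mul (hf.comp (M.w_measurable e))).aemeasurable

/-- The invariant Borel probability measures `P(𝓜)`. -/
def invariantMeasures : Set (Measure X) :=
  {μ | IsProbabilityMeasure μ ∧ M.adjointOp μ = μ}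

/-- The point masses `α_n^y({j}) = (1/n) ∑_{k=1}^n U^{*k}δ_y(K_j)`. -/
def occupation (y : X) (n : ℕ) (j : V) : ℝ≥0∞ :=
  (n : ℝ≥0∞)⁻¹ * ∑ k ∈ Finset.Icc 1 n, (M.adjointOp^[k] (Measure.dirac y)) (M.vset j)

/-- The recurrence condition at `y`: the measures `α_n^y`, `n ≥ 1`, on the set of vertices are
uniformly tight. -/
def TightAt (y : X) : Prop :=
  ∀ ε : ℝ≥0∞, 0 < ε → ∃ C : Finset V, ∀ n : ℕ, 1 ≤ n →
    ∑' j : {j : V // j ∉ C}, M.occupation y n j < ε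

/-- Existence of a dominating Markov chain: `∑_{i(e) = j} sup_{K_j} p_e < ∞` for every `j`. -/
def HasDominatingChain : Prop :=
  ∀ j : V, ∑' e : {e : E // M.src e = j}, ⨆ y ∈ M.vset j, ENNReal.ofReal (M.p e y) < ∞

/-- The maps of the system, with `w_∞ = id`. -/
def wExt (s : Letter E) : X → X := Letter.extend id M.w s

/-- The probability functions of the system, with `p_∞ = 0`. -/
def pExt (s : Letter E) : X → ℝ := Letter.extend 0 M.p s

/-- Initial vertices, with the distinguished vertex for `∞`. -/
def srcExt (s : Letter E) : V := Letter.extend M.base M.src s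

/-- Terminal vertices, with the distinguished vertex for `∞`. -/
def tgtExt (s : Letter E) : V := Letter.extend M.base M.tgt s

/-- The product `p_{e_1}(y) p_{e_2}(w_{e_1} y) ⋯ p_{e_n}(w_{e_{n-1}} ∘ ⋯ ∘ w_{e_1} y)`. -/
def wordProb : List (Letter E) → X → ℝ≥0∞
  | [], _ => 1
  | s :: l, y => ENNReal.ofReal (M.pExt s y) * wordProb l (M.wExt s y)

/-- A finite sequence of edges is a path if each edge starts where the preceding one ends. -/
def IsPath (l : List E) : Prop := l.IsChain fun e e' => M.src e' = M.tgt e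

/-- The characterisation of the process started at `y`: a probability measure on the one-sided code
space with the prescribed values on the cylinders `_1[e_1,…,e_n]^+`. -/
def IsPathMeasure (y : X) (P : Measure (PosCode E)) : Prop :=
  IsProbabilityMeasure P ∧ ∀ l : List (Letter E), P (posCyl l) = M.wordProb l y

open Classical in
/-- The probability measure `P_y` on the one-sided code space. -/
def pathMeasure (y : X) : Measure (PosCode E) :=
  if h : ∃ P, M.IsPathMeasure y P then h.choose else 0

/-- The characterisation of `Φ(μ)`: a probability measure on the code space with
`Φ(μ)(_m[e_m,…,e_n]) = ∫ P_y^m(_m[e_m,…,e_n]) dμ(y)` for all cylinders with `m ≤ 0`. -/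
def IsCodeMeasure (μ : Measure X) (Λ : Measure (BiCode E)) : Prop :=
  IsProbabilityMeasure Λ ∧
    ∀ m : ℤ, m ≤ 0 → ∀ l : List (Letter E), Λ (cyl m l) = ∫⁻ y, M.wordProb l y ∂μ

open Classical in
/-- The measure `Φ(μ)` on the code space. -/
def Phi (μ : Measure X) : Measure (BiCode E) :=
  if h : ∃ Λ, M.IsCodeMeasure μ Λ then h.choose else 0

/-- The path space `Σ_G`. -/
def pathSpace : Set (BiCode E) :=
  {σ | (∀ n : ℤ, σ n ∈ Set.range (Letter.edge : E → Letter E)) ∧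
    ∀ n : ℤ, M.srcExt (σ (n + 1)) = M.tgtExt (σ n)}

/-- The set `T_j` of all `σ ∈ Σ_G` with `t(σ_0) = j`. -/
def arrival (j : V) : Set (BiCode E) := {σ ∈ M.pathSpace | M.tgtExt (σ 0) = j}

/-- The composition `w_{σ_0} ∘ w_{σ_{-1}} ∘ ⋯ ∘ w_{σ_{-n}}`. -/
def backComp (σ : BiCode E) : ℕ → X → X
  | 0 => M.wExt (σ 0)
  | n + 1 => backComp σ n ∘ M.wExt (σ (-((n : ℤ) + 1)))

/-- The point `X_{-n}(σ) = w_{σ_0} ∘ ⋯ ∘ w_{σ_{-n}}(x_{i(σ_{-n})})`. -/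
def approx (x : V → X) (σ : BiCode E) (n : ℕ) : X :=
  M.backComp σ n (x (M.srcExt (σ (-(n : ℤ)))))

end Operators

section Metric

variable {X E V : Type*} [MetricSpace X] [MeasurableSpace X] (M : MarkovSystem X E V)

/-- Contractivity (on average) with rate `a`. -/
def IsContractive (a : ℝ) : Prop :=
  ∀ j : V, ∀ y ∈ M.vset j, ∀ z ∈ M.vset j,
    ∑' e : {e : E // M.src e = j}, ENNReal.ofReal (M.p e y) * edist (M.w e y) (M.w e z)
      ≤ ENNReal.ofReal a * edist y z

/-- Uniform continuity of all maps and probability functions on their vertex sets. -/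
def IsUniformlyContinuous : Prop :=
  ∀ e : E, UniformContinuousOn (M.w e) (M.vset (M.src e)) ∧
    UniformContinuousOn (M.p e) (M.vset (M.src e))

/-- The constant `b`, for the chosen points `x_j ∈ K_j`. -/
def bConst (x : V → X) : ℝ≥0∞ :=
  ⨆ j : V, ⨆ y ∈ M.vset j, ∑' e : {e : E // M.src e = j},
    ENNReal.ofReal (M.p e y) * edist (M.w e (x (M.src e))) (x (M.tgt e))

/-- The set `D` of all `σ ∈ Σ_G` for which `X_m(σ)` converges as `m → -∞`. -/
def codingDomain (x : V → X) : Set (BiCode E) :=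
  {σ | σ ∈ M.pathSpace ∧ ∃ y, Tendsto (M.approx x σ) atTop (𝓝 y)}

open Classical in
/-- The coding map `F`. -/
def codingMap (x : V → X) (σ : BiCode E) : X :=
  if h : σ ∈ M.codingDomain x then h.2.choose else x (M.tgtExt (σ 0))

open Classical in
/-- The continuous extension `p̄_e` of `p_e` from `K_{i(e)}` to its closure, extended by zero. -/
def pBar (e : E) (y : X) : ℝ :=
  if y ∈ closure (M.vset (M.src e)) then extendFrom (M.vset (M.src e)) (M.p e) y else 0

/-- The equilibrium states `E(𝓜)`. -/
def equilibriumStates (x : V → X) : Set (Measure (BiCode E)) :=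
  {Λ | Λ ∈ shiftInvariant E ∧ Λ (M.codingDomain x) = 1 ∧
    ∀ e : E, Λ[(cyl 1 [Letter.edge e]).indicator (fun _ => (1 : ℝ)) | past E]
      =ᵐ[Λ] fun σ => M.p e (M.codingMap x σ)}

/-- The asymptotic states `Ẽ(𝓜)`. -/
def asymptoticStates (x : V → X) : Set (Measure (BiCode E)) :=
  {Λ | Λ ∈ shiftInvariant E ∧ Λ (M.codingDomain x) = 1 ∧
    ∀ e : E, Λ[(cyl 1 [Letter.edge e]).indicator (fun _ => (1 : ℝ)) | past E]
      =ᵐ[Λ] (M.arrival (M.src e)).indicator fun σ => M.pBar e (M.codingMap x σ)}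

end Metric

end MarkovSystem

end

/-!
The whole argument runs through one class of measures on the code space. For an initial
distribution `ν` let `wordLaw ν l` be the probability that the chain started from `ν` follows the
word of edges `l`. A *limit state* (`MarkovSystem.IsLimitState`) is a probability measure `Λ` whose
cylinder probabilities are limits of `wordLaw (ν i) l` along a filter, for every position of the
cylinder, and which charges sequences of edges only. The measures `Φ(μ)` are the limit states of
the constant family `ν i = μ`. For the asymptotic state obtained from the recurrence condition,
`ν n` is the average of the distributions of the chain started at `x₀` at the times `1, …, n + 1`,
and the limit is taken along a non-principal ultrafilter.

Let `deviation y` be the distance of `y` to the chosen point of its vertex set. One step of the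
chain changes the mean deviation to at most `a` times the old one plus `b`, so every bound `c` with
`a c + b ≤ c`, such as `b / (1 - a)`, is preserved, and a truncation argument shows that it holds
for all invariant measures (`IsContractive.lintegral_deviation_le_of_invariant`). Average
contraction along words then gives, for every limit state whose initial distributions have mean
deviation at most `c`, that the mean distance between the approximations `X_{-m}` and `X_{-n-m}` of
the coding map is at most `(a ^ (m + 1) + a ^ (n + m + 1)) c`. Consequently:

* the approximations converge almost surely (`IsLimitState.ae_mem_codingDomain`);
* because `p_e` is uniformly continuous, the probability of the next edge `e` on an event of the
  past is the integral of the limit of `p_e` along the approximations, which is `p̄_e ∘ F` on the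
  sequences arriving in the initial vertex of `e`. Hence limit states are asymptotic states
  (`IsLimitState.mem_asymptoticStates`);
* the chain started from `μ` shadows the approximations, whence `F(Φ(μ)) = μ`
  (`map_codingMap_Phi`);
* by Markov's inequality with the threshold `R √a ^ (m + 1)`, outside of a set of measure at most
  `√a ^ k` all approximations with index `m ≥ k` are within this threshold of the coding map. Two
  sequences with the same coordinates at the indices of absolute value at most `m` have the same
  `m`-th approximation, so the coding map is Hölder continuous on these sets
  (`dist_codingMap_le`, `measure_compl_regularSet_le`).

Existence of limit states (`exists_isLimitState`) needs the limits of word probabilities to be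
consistent under extension of words to both sides. Summation over a new first edge shifts the chain
by one step, which does not matter in the limit, and tightness of the first edge prevents a loss of
mass; here the recurrence condition and the dominating Markov chain enter. The limits over words of
a given length therefore add up to one, and this forces consistency to the right. A two-sided
measure is built from consistent word probabilities by coding pairs of letters as single ones and
applying the Ionescu-Tulcea theorem (`exists_measure_biWord`).

Under an equilibrium state `Λ` the point `F(σ)` almost surely lies in the vertex set of the next
edge, and not just in its closure, since the next edge is chosen with the probability `p_e(F(σ))`,
which vanishes outside of the vertex set. So `F(Sσ) = w_{σ_1}(F(σ))` almost surely, the image of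
`Λ` is invariant, and iterating the conditional probabilities over words identifies `Λ` with
`Φ(F(Λ))` (`eq_Phi_of_mem_equilibriumStates`).
-/

noncomputable section

/-! ### Sums over words -/

section Words

variable {α : Type*}

theorem tsum_word_add (m n : ℕ) (f : List α → ℝ≥0∞) :
    ∑' u : Fin (m + n) → α, f (List.ofFn u)
      = ∑' (u : Fin m → α) (v : Fin n → α), f (List.ofFn u ++ List.ofFn v) := by
  rw [← (Fin.appendEquiv m n).tsum_eq (fun u : Fin (m + n) → α => f (List.ofFn u)),
    ENNReal.tsum_prod']
  refine tsum_congr fun u => tsum_congr fun v => ?_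
  rw [← List.ofFn_fin_append]
  rfl

theorem tsum_word_one (f : List α → ℝ≥0∞) :
    ∑' u : Fin 1 → α, f (List.ofFn u) = ∑' a, f [a] := by
  rw [← (Equiv.funUnique (Fin 1) α).symm.tsum_eq (fun u : Fin 1 → α => f (List.ofFn u))]
  refine tsum_congr fun a => ?_
  simp [List.ofFn_succ]

theorem tsum_word_zero (f : List α → ℝ≥0∞) : ∑' u : Fin 0 → α, f (List.ofFn u) = f [] := by
  simp [tsum_fintype]

theorem tsum_word_cons (n : ℕ) (f : List α → ℝ≥0∞) :
    ∑' u : Fin (n + 1) → α, f (List.ofFn u) = ∑' (a : α) (u : Fin n → α), f (a :: List.ofFn u) := by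
  have h := tsum_word_one (fun l : List α => ∑' u : Fin n → α, f (l ++ List.ofFn u))
  have h2 := tsum_word_add 1 n f
  rw [add_comm 1 n] at h2
  rw [h2, h]
  rfl

theorem tsum_word_snoc (n : ℕ) (f : List α → ℝ≥0∞) :
    ∑' u : Fin (n + 1) → α, f (List.ofFn u)
      = ∑' (u : Fin n → α) (a : α), f (List.ofFn u ++ [a]) := by
  rw [tsum_word_add]
  refine tsum_congr fun u => ?_
  exact tsum_word_one fun l => f (List.ofFn u ++ l)

end Words

/-! ### The chain generated by a Markov system -/

namespace MarkovSystem

section Chain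

variable {X E V : Type*} [MeasurableSpace X] (M : MarkovSystem X E V)

/-- The map `w_{e_n} ∘ ⋯ ∘ w_{e_1}` of a word `e_1 ⋯ e_n`. -/
def wordMap : List E → X → X
  | [], y => y
  | e :: l, y => wordMap l (M.w e y)

/-- The probability that the chain started at `y` follows a given word of edges. -/
def pathProb : List E → X → ℝ≥0∞
  | [], _ => 1
  | e :: l, y => ENNReal.ofReal (M.p e y) * pathProb l (M.w e y)

/-- The probability that the chain with initial distribution `ν` follows a given word of edges. -/
def wordLaw (ν : Measure X) (l : List E) : ℝ≥0∞ := ∫⁻ y, M.pathProb l y ∂ν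

theorem wordProb_map_edge (l : List E) (y : X) :
    M.wordProb (l.map Letter.edge) y = M.pathProb l y := by
  induction l generalizing y with
  | nil => rfl
  | cons e l ih =>
    rw [List.map_cons, wordProb, ih]
    rfl

theorem wordMap_append (l l' : List E) (y : X) :
    M.wordMap (l ++ l') y = M.wordMap l' (M.wordMap l y) := by
  induction l generalizing y with
  | nil => rfl
  | cons e l ih => exact ih _

theorem pathProb_append (l l' : List E) (y : X) :
    M.pathProb (l ++ l') y = M.pathProb l y * M.pathProb l' (M.wordMap l y) := by
  induction l generalizing y with
  | nil => simp [pathProb, wordMap]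
  | cons e l ih => rw [List.cons_append, pathProb, ih, pathProb, wordMap, mul_assoc]

theorem measurable_wordMap (l : List E) : Measurable (M.wordMap l) := by
  induction l with
  | nil => exact measurable_id
  | cons e l ih => exact ih.comp (M.w_measurable e)

theorem measurable_pathProb (l : List E) : Measurable (M.pathProb l) := by
  induction l with
  | nil => exact measurable_const
  | cons e l ih => exact (M.p_measurable e).ennreal_ofReal.mul (ih.comp (M.w_measurable e))

theorem exists_mem_vset (y : X) : ∃ j, y ∈ M.vset j := by
  have h : y ∈ ⋃ j, M.vset j := M.vset_cover ▸ mem_univ y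
  exact mem_iUnion.1 h

variable {M} in
theorem eq_of_mem_vset {y : X} {j k : V} (hj : y ∈ M.vset j) (hk : y ∈ M.vset k) : j = k := by
  by_contra h
  exact disjoint_left.1 (M.vset_disjoint h) hj hk

variable {M} in
theorem mem_vset_src_of_ne_zero {e : E} {y : X} (h : ENNReal.ofReal (M.p e y) ≠ 0) :
    y ∈ M.vset (M.src e) := by
  by_contra hy
  exact h (by rw [M.p_eq_zero e y hy, ENNReal.ofReal_zero])

theorem tsum_src {y : X} {j : V} (hj : y ∈ M.vset j) (h : E → ℝ≥0∞) :
    ∑' e : {e : E // M.src e = j}, ENNReal.ofReal (M.p e y) * h e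
      = ∑' e : E, ENNReal.ofReal (M.p e y) * h e := by
  refine tsum_subtype_eq_of_support_subset (s := {e | M.src e = j})
    (f := fun e : E => ENNReal.ofReal (M.p e y) * h e) fun e he => ?_
  exact eq_of_mem_vset (mem_vset_src_of_ne_zero (left_ne_zero_of_mul he)) hj

theorem tsum_ofReal_p (y : X) : ∑' e, ENNReal.ofReal (M.p e y) = 1 := by
  obtain ⟨j, hj⟩ := M.exists_mem_vset y
  have h1 := M.tsum_src hj fun _ => 1
  simp only [mul_one] at h1
  have h2 := M.p_sum j y hj
  rw [← h1, ← ENNReal.ofReal_tsum_of_nonneg (fun e => (M.p_mem_Icc _ _).1) h2.summable, h2.tsum_eq,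
    ENNReal.ofReal_one]

theorem tsum_pathProb (n : ℕ) (y : X) :
    ∑' u : Fin n → E, M.pathProb (List.ofFn u) y = 1 := by
  induction n generalizing y with
  | zero => rw [tsum_word_zero (fun l => M.pathProb l y)]; rfl
  | succ n ih =>
    rw [tsum_word_cons n (fun l => M.pathProb l y)]
    simp only [pathProb, ENNReal.tsum_mul_left, ih, mul_one, M.tsum_ofReal_p]

theorem pathProb_le_one (l : List E) (y : X) : M.pathProb l y ≤ 1 := by
  induction l generalizing y with
  | nil => exact le_rfl
  | cons e l ih => exact mul_le_one' (ENNReal.ofReal_le_one.2 (M.p_mem_Icc e y).2) (ih _)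

theorem wordLaw_nil (ν : Measure X) [IsProbabilityMeasure ν] : M.wordLaw ν [] = 1 := by
  simp [wordLaw, pathProb]

theorem wordLaw_le_one (ν : Measure X) [IsProbabilityMeasure ν] (l : List E) :
    M.wordLaw ν l ≤ 1 := by
  calc M.wordLaw ν l ≤ ∫⁻ _, 1 ∂ν := lintegral_mono fun y => M.pathProb_le_one l y
    _ = 1 := by simp

theorem wordLaw_append_le (ν : Measure X) (l l' : List E) :
    M.wordLaw ν (l ++ l') ≤ M.wordLaw ν l := by
  refine lintegral_mono fun y => ?_
  rw [pathProb_append]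
  exact mul_le_of_le_one_right' (M.pathProb_le_one _ _)

/-- The image of the chosen point of the initial vertex set under the map of a word (for the empty
word, the chosen point of the distinguished vertex set). -/
def wordPoint (x : V → X) : List E → X
  | [] => x M.base
  | e :: l => M.wordMap (e :: l) (x (M.src e))

variable {M} in
theorem exists_vset_wordMap {l : List E} {y z : X} {j : V} (hy : y ∈ M.vset j) (hz : z ∈ M.vset j)
    (h : M.pathProb l y ≠ 0) :
    ∃ k, M.wordMap l y ∈ M.vset k ∧ M.wordMap l z ∈ M.vset k := by
  induction l generalizing y z j with
  | nil => exact ⟨j, hy, hz⟩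
  | cons e l ih =>
    have hj := eq_of_mem_vset (mem_vset_src_of_ne_zero (left_ne_zero_of_mul h)) hy
    exact ih (M.w_mapsTo e (hj ▸ hy)) (M.w_mapsTo e (hj ▸ hz)) (right_ne_zero_of_mul h)

variable {M} in
theorem wordPoint_eq (x : V → X) {l : List E} (hl : l ≠ []) {y : X} {j : V} (hy : y ∈ M.vset j)
    (h : M.pathProb l y ≠ 0) : M.wordPoint x l = M.wordMap l (x j) := by
  cases l with
  | nil => exact absurd rfl hl
  | cons e l =>
    rw [wordPoint, eq_of_mem_vset (mem_vset_src_of_ne_zero (left_ne_zero_of_mul h)) hy]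

variable {M} in
theorem adjointOp_iterate_of_mem {μ : Measure X} (hμ : μ ∈ M.invariantMeasures) (n : ℕ) :
    M.adjointOp^[n] μ = μ := by
  induction n with
  | zero => rfl
  | succ n ih => rw [Function.iterate_succ_apply, hμ.2, ih]

variable [Countable E]

theorem isProbabilityMeasure_adjointOp (ν : Measure X) [IsProbabilityMeasure ν] :
    IsProbabilityMeasure (M.adjointOp ν) := by
  constructor
  rw [← lintegral_one, M.lintegral_adjointOp ν measurable_const]
  simp [markovOp, M.tsum_ofReal_p]

theorem isProbabilityMeasure_adjointOp_iterate (ν : Measure X) [IsProbabilityMeasure ν] (n : ℕ) :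
    IsProbabilityMeasure (M.adjointOp^[n] ν) := by
  induction n with
  | zero => exact ‹_›
  | succ n ih =>
    rw [Function.iterate_succ_apply']
    exact M.isProbabilityMeasure_adjointOp _

/-- The distribution of the chain after `n` steps, as a sum over the words of length `n`. -/
theorem lintegral_adjointOp_iterate (ν : Measure X) (n : ℕ) {f : X → ℝ≥0∞} (hf : Measurable f) :
    ∫⁻ y, f y ∂(M.adjointOp^[n] ν)
      = ∫⁻ y, ∑' u : Fin n → E, M.pathProb (List.ofFn u) y * f (M.wordMap (List.ofFn u) y) ∂ν := by
  induction n generalizing ν with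
  | zero =>
    refine lintegral_congr fun y => ?_
    rw [tsum_word_zero (fun l => M.pathProb l y * f (M.wordMap l y))]
    simp [pathProb, wordMap]
  | succ n ih =>
    rw [Function.iterate_succ_apply, ih, M.lintegral_adjointOp]
    · refine lintegral_congr fun y => ?_
      rw [tsum_word_cons n (fun l => M.pathProb l y * f (M.wordMap l y))]
      refine tsum_congr fun e => ?_
      rw [← ENNReal.tsum_mul_left]
      simp only [pathProb, wordMap, mul_assoc]
    · exact Measurable.tsum fun u =>
        (M.measurable_pathProb _).mul (hf.comp (M.measurable_wordMap _))

theorem tsum_wordLaw_cons (ν : Measure X) (l : List E) :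
    ∑' e, M.wordLaw ν (e :: l) = M.wordLaw (M.adjointOp ν) l := by
  simp only [wordLaw]
  rw [M.lintegral_adjointOp ν (M.measurable_pathProb l),
    ← lintegral_tsum fun e => (M.measurable_pathProb (e :: l)).aemeasurable]
  rfl

theorem tsum_wordLaw_snoc (ν : Measure X) (l : List E) :
    ∑' e, M.wordLaw ν (l ++ [e]) = M.wordLaw ν l := by
  simp only [wordLaw]
  rw [← lintegral_tsum fun e => (M.measurable_pathProb (l ++ [e])).aemeasurable]
  refine lintegral_congr fun y => ?_
  simp only [pathProb_append, ENNReal.tsum_mul_left, pathProb, mul_one, M.tsum_ofReal_p]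

theorem tsum_wordLaw_append (ν : Measure X) (n : ℕ) (l : List E) :
    ∑' u : Fin n → E, M.wordLaw ν (List.ofFn u ++ l) = M.wordLaw (M.adjointOp^[n] ν) l := by
  simp only [wordLaw]
  rw [M.lintegral_adjointOp_iterate ν n (M.measurable_pathProb l),
    ← lintegral_tsum fun u => (M.measurable_pathProb (List.ofFn u ++ l)).aemeasurable]
  simp only [pathProb_append]

end Chain

/-! ### Average contraction along the chain -/

section Contraction

variable {X E V : Type*} [MetricSpace X] [MeasurableSpace X] (M : MarkovSystem X E V) (x : V → X)

/-- The distance of a point to the chosen point of the vertex set which contains it. -/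
def deviation (y : X) : ℝ≥0∞ := ∑' j, (M.vset j).indicator (fun y => edist y (x j)) y

theorem deviation_eq {y : X} {j : V} (hj : y ∈ M.vset j) : M.deviation x y = edist y (x j) := by
  rw [deviation, tsum_eq_single j, indicator_of_mem hj]
  intro k hk
  exact indicator_of_notMem (fun h => hk (eq_of_mem_vset h hj)) _

theorem deviation_lt_top (y : X) : M.deviation x y < ∞ := by
  obtain ⟨j, hj⟩ := M.exists_mem_vset y
  rw [M.deviation_eq x hj]
  exact edist_lt_top _ _

theorem measurable_deviation [OpensMeasurableSpace X] [Countable V] :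
    Measurable (M.deviation x) :=
  Measurable.tsum fun j => measurable_edist_left.indicator (M.vset_measurable j)

variable {M x} {a : ℝ}

theorem IsContractive.tsum_le (hc : M.IsContractive a) {j : V} {y z : X} (hy : y ∈ M.vset j)
    (hz : z ∈ M.vset j) :
    ∑' e, ENNReal.ofReal (M.p e y) * edist (M.w e y) (M.w e z) ≤ ENNReal.ofReal a * edist y z := by
  rw [← M.tsum_src hy]
  exact hc j y hy z hz

theorem IsContractive.tsum_word_le (hc : M.IsContractive a) (n : ℕ) {j : V} {y z : X}
    (hy : y ∈ M.vset j) (hz : z ∈ M.vset j) :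
    ∑' u : Fin n → E, M.pathProb (List.ofFn u) y *
        edist (M.wordMap (List.ofFn u) y) (M.wordMap (List.ofFn u) z)
      ≤ ENNReal.ofReal a ^ n * edist y z := by
  induction n generalizing y z j with
  | zero =>
    rw [tsum_word_zero (fun l => M.pathProb l y * edist (M.wordMap l y) (M.wordMap l z))]
    simp [pathProb, wordMap]
  | succ n ih =>
    rw [tsum_word_cons n (fun l => M.pathProb l y * edist (M.wordMap l y) (M.wordMap l z))]
    simp only [pathProb, wordMap, mul_assoc, ENNReal.tsum_mul_left]
    calc _ ≤ ∑' e, ENNReal.ofReal (M.p e y) *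
          (ENNReal.ofReal a ^ n * edist (M.w e y) (M.w e z)) := by
          refine ENNReal.tsum_le_tsum fun e => ?_
          by_cases h : ENNReal.ofReal (M.p e y) = 0
          · simp [h]
          · have hj := eq_of_mem_vset (mem_vset_src_of_ne_zero h) hy
            gcongr
            exact ih (M.w_mapsTo e (hj ▸ hy)) (M.w_mapsTo e (hj ▸ hz))
      _ = ENNReal.ofReal a ^ n * ∑' e, ENNReal.ofReal (M.p e y) * edist (M.w e y) (M.w e z) := by
          rw [← ENNReal.tsum_mul_left]
          exact tsum_congr fun e => by ring
      _ ≤ ENNReal.ofReal a ^ n * (ENNReal.ofReal a * edist y z) := by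
          gcongr
          exact hc.tsum_le hy hz
      _ = _ := by ring

/-- After `n` steps the distance between the chain and the image of the chosen point is, on
average, at most `a ^ n` times the initial deviation. -/
theorem IsContractive.tsum_wordPoint_le (hc : M.IsContractive a) (hx : ∀ j, x j ∈ M.vset j) {n : ℕ}
    (hn : n ≠ 0) (y : X) :
    ∑' u : Fin n → E, M.pathProb (List.ofFn u) y *
        edist (M.wordMap (List.ofFn u) y) (M.wordPoint x (List.ofFn u))
      ≤ ENNReal.ofReal a ^ n * M.deviation x y := by
  obtain ⟨j, hj⟩ := M.exists_mem_vset y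
  rw [M.deviation_eq x hj]
  refine le_trans (ENNReal.tsum_le_tsum fun u => ?_) (hc.tsum_word_le n hj (hx j))
  by_cases h : M.pathProb (List.ofFn u) y = 0
  · simp [h]
  · rw [wordPoint_eq x (by simpa using hn) hj h]

theorem IsContractive.markovOp_deviation_le (hc : M.IsContractive a) (hx : ∀ j, x j ∈ M.vset j)
    (y : X) :
    M.markovOp (M.deviation x) y ≤ ENNReal.ofReal a * M.deviation x y + M.bConst x := by
  obtain ⟨j, hj⟩ := M.exists_mem_vset y
  rw [M.deviation_eq x hj, markovOp]
  calc _ ≤ ∑' e, (ENNReal.ofReal (M.p e y) * edist (M.w e y) (M.w e (x j)) +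
        ENNReal.ofReal (M.p e y) * edist (M.w e (x (M.src e))) (x (M.tgt e))) := by
        refine ENNReal.tsum_le_tsum fun e => ?_
        by_cases h : ENNReal.ofReal (M.p e y) = 0
        · simp [h]
        · have hy := mem_vset_src_of_ne_zero h
          rw [← eq_of_mem_vset hy hj, M.deviation_eq x (M.w_mapsTo e hy), ← mul_add]
          gcongr
          exact edist_triangle _ _ _
    _ ≤ _ := by
        rw [ENNReal.tsum_add]
        refine add_le_add (hc.tsum_le hj (hx j)) ?_
        rw [← M.tsum_src hj fun e => edist (M.w e (x (M.src e))) (x (M.tgt e))]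
        exact le_iSup₂_of_le j y (le_iSup_of_le hj le_rfl)

variable [OpensMeasurableSpace X] [Countable V] [Countable E]

theorem IsContractive.lintegral_deviation_adjointOp_le (hc : M.IsContractive a)
    (hx : ∀ j, x j ∈ M.vset j) (ν : Measure X) [IsProbabilityMeasure ν] :
    ∫⁻ y, M.deviation x y ∂(M.adjointOp ν)
      ≤ ENNReal.ofReal a * ∫⁻ y, M.deviation x y ∂ν + M.bConst x := by
  rw [M.lintegral_adjointOp ν (M.measurable_deviation x)]
  refine (lintegral_mono (hc.markovOp_deviation_le hx)).trans ?_
  rw [lintegral_add_right _ measurable_const, lintegral_const_mul _ (M.measurable_deviation x)]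
  simp

/-- The set of distributions with mean deviation at most `c` is invariant once `a c + b ≤ c`. -/
theorem IsContractive.lintegral_deviation_iterate_le (hc : M.IsContractive a)
    (hx : ∀ j, x j ∈ M.vset j) {c : ℝ≥0∞} (hac : ENNReal.ofReal a * c + M.bConst x ≤ c)
    (ν : Measure X) [IsProbabilityMeasure ν] (hν : ∫⁻ y, M.deviation x y ∂ν ≤ c) (n : ℕ) :
    ∫⁻ y, M.deviation x y ∂(M.adjointOp^[n] ν) ≤ c := by
  induction n with
  | zero => exact hν
  | succ n ih =>
    rw [Function.iterate_succ_apply']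
    have := M.isProbabilityMeasure_adjointOp_iterate ν n
    refine (hc.lintegral_deviation_adjointOp_le hx _).trans (le_trans ?_ hac)
    gcongr

/-- The mean distance between the points determined by a word and by a final segment of it. -/
theorem IsContractive.tsum_wordLaw_edist_le (hc : M.IsContractive a)
    (hx : ∀ j, x j ∈ M.vset j) {c : ℝ≥0∞} (hac : ENNReal.ofReal a * c + M.bConst x ≤ c)
    (ν : Measure X) [IsProbabilityMeasure ν] (hν : ∫⁻ y, M.deviation x y ∂ν ≤ c) (n : ℕ) {m : ℕ}
    (hm : m ≠ 0) :
    ∑' (u : Fin n → E) (v : Fin m → E), M.wordLaw ν (List.ofFn u ++ List.ofFn v) *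
        edist (M.wordPoint x (List.ofFn u ++ List.ofFn v)) (M.wordPoint x (List.ofFn v))
      ≤ (ENNReal.ofReal a ^ (n + m) + ENNReal.ofReal a ^ m) * c := by
  have hmeas : ∀ (l : List E) (r : ℝ≥0∞), Measurable fun y => M.pathProb l y * r :=
    fun l r => (M.measurable_pathProb l).mul_const r
  simp only [wordLaw]
  simp_rw [← lintegral_mul_const _ (M.measurable_pathProb _)]
  simp_rw [← lintegral_tsum fun v : Fin m → E =>
    (hmeas (List.ofFn _ ++ List.ofFn v) _).aemeasurable]
  rw [← lintegral_tsum fun u => (Measurable.tsum fun v => hmeas _ _).aemeasurable]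
  have hg : Measurable fun y => ENNReal.ofReal a ^ (n + m) * M.deviation x y :=
    (M.measurable_deviation x).const_mul _
  calc _ ≤ ∫⁻ y, (ENNReal.ofReal a ^ (n + m) * M.deviation x y + ∑' u : Fin n → E,
        M.pathProb (List.ofFn u) y *
          (ENNReal.ofReal a ^ m * M.deviation x (M.wordMap (List.ofFn u) y))) ∂ν := by
        refine lintegral_mono fun y => ?_
        have h1 := hc.tsum_wordPoint_le hx (n := n + m) (by omega) y
        rw [tsum_word_add n m (fun l => M.pathProb l y *
          edist (M.wordMap l y) (M.wordPoint x l))] at h1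
        refine le_trans ?_ (add_le_add_left h1 _)
        rw [← ENNReal.tsum_add]
        refine ENNReal.tsum_le_tsum fun u => ?_
        refine le_trans ?_ (add_le_add_right (mul_le_mul_right
          (hc.tsum_wordPoint_le hx hm (M.wordMap (List.ofFn u) y)) _) _)
        rw [← ENNReal.tsum_mul_left, ← ENNReal.tsum_add]
        refine ENNReal.tsum_le_tsum fun v => ?_
        rw [← mul_assoc, ← pathProb_append, ← wordMap_append, ← mul_add,
          edist_comm (M.wordMap (List.ofFn u ++ List.ofFn v) y)]
        gcongr
        exact edist_triangle _ _ _
    _ = ENNReal.ofReal a ^ (n + m) * ∫⁻ y, M.deviation x y ∂ν +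
        ENNReal.ofReal a ^ m * ∫⁻ y, M.deviation x y ∂(M.adjointOp^[n] ν) := by
        rw [lintegral_add_left hg,
          ← lintegral_const_mul (ENNReal.ofReal a ^ m) (M.measurable_deviation x),
          ← lintegral_const_mul _ (M.measurable_deviation x),
          M.lintegral_adjointOp_iterate ν n ((M.measurable_deviation x).const_mul _)]
    _ ≤ _ := by
        rw [add_mul]
        gcongr
        exact hc.lintegral_deviation_iterate_le hx hac ν hν n

end Contraction

section Invariant

variable {X E V : Type*} [MetricSpace X] [MeasurableSpace X] {M : MarkovSystem X E V} {x : V → X}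
  {a : ℝ}

/-- Uniform continuity of the bounded function `p_e`, in a form which is linear in the distance
and can therefore be averaged. -/
theorem IsUniformlyContinuous.exists_p_le (hu : M.IsUniformlyContinuous) (e : E) {ε : ℝ≥0∞}
    (hε : ε ≠ 0) :
    ∃ K : ℝ≥0∞, K ≠ ∞ ∧ ∀ (k : V), ∀ y ∈ M.vset k, ∀ z ∈ M.vset k,
      ENNReal.ofReal (M.p e y) ≤ ENNReal.ofReal (M.p e z) + (ε + K * edist y z) := by
  obtain ⟨δ, hδ, h⟩ := EMetric.uniformContinuousOn_iff.1 (hu e).2 ε (pos_iff_ne_zero.2 hε)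
  refine ⟨δ⁻¹, ENNReal.inv_ne_top.2 hδ.ne', fun k y hy z hz => ?_⟩
  by_cases hk : M.src e = k
  · subst hk
    by_cases hd : edist y z < δ
    · refine le_trans ?_ (add_le_add_right (le_add_right (h hy hz hd).le) _)
      rw [edist_dist, ← ENNReal.ofReal_add (M.p_mem_Icc e z).1 dist_nonneg, Real.dist_eq]
      refine ENNReal.ofReal_le_ofReal ?_
      linarith [le_abs_self (M.p e y - M.p e z)]
    · -- at distance at least `δ` the trivial bound `p_e ≤ 1` suffices
      refine (ENNReal.ofReal_le_one.2 (M.p_mem_Icc e y).2).trans (le_add_left (le_add_left ?_))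
      rw [← ENNReal.inv_mul_cancel hδ.ne' (ne_top_of_le_ne_top (edist_ne_top y z) (not_lt.1 hd))]
      gcongr
      exact not_lt.1 hd
  · have : y ∉ M.vset (M.src e) := fun h => hk (eq_of_mem_vset h hy)
    simp [M.p_eq_zero e y this]

variable [OpensMeasurableSpace X] [Countable V] [Countable E]

/-- Along long words the transition probability at the current position of the chain may be
replaced by its value at the point determined by the word. -/
theorem IsContractive.exists_wordLaw_snoc_le (hc : M.IsContractive a)
    (hx : ∀ j, x j ∈ M.vset j) (hu : M.IsUniformlyContinuous) (e : E) {ε : ℝ≥0∞} (hε : ε ≠ 0) :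
    ∃ K : ℝ≥0∞, K ≠ ∞ ∧ ∀ (c : ℝ≥0∞) (ν : Measure X), IsProbabilityMeasure ν →
      ∫⁻ y, M.deviation x y ∂ν ≤ c → ∀ n : ℕ, n ≠ 0 → ∃ t : (Fin n → E) → ℝ≥0∞,
        ∑' u, t u ≤ ε + K * (ENNReal.ofReal a ^ n * c) ∧ ∀ u,
          M.wordLaw ν (List.ofFn u ++ [e]) ≤ M.wordLaw ν (List.ofFn u) *
              ENNReal.ofReal (M.p e (M.wordPoint x (List.ofFn u))) + t u ∧
          M.wordLaw ν (List.ofFn u) * ENNReal.ofReal (M.p e (M.wordPoint x (List.ofFn u)))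
            ≤ M.wordLaw ν (List.ofFn u ++ [e]) + t u := by
  obtain ⟨K, hK, h⟩ := hu.exists_p_le e hε
  refine ⟨K, hK, fun c ν hν hνc n hn => ?_⟩
  have hm : ∀ u : Fin n → E, Measurable fun y => M.pathProb (List.ofFn u) y *
      (ε + K * edist (M.wordMap (List.ofFn u) y) (M.wordPoint x (List.ofFn u))) := fun u =>
    (M.measurable_pathProb _).mul
      (((measurable_edist_left.comp (M.measurable_wordMap _)).const_mul K).const_add ε)
  refine ⟨fun u => ∫⁻ y, M.pathProb (List.ofFn u) y *
      (ε + K * edist (M.wordMap (List.ofFn u) y) (M.wordPoint x (List.ofFn u))) ∂ν, ?_, fun u => ?_⟩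
  · rw [← lintegral_tsum fun u => (hm u).aemeasurable]
    calc _ ≤ ∫⁻ y, (ε + K * (ENNReal.ofReal a ^ n * M.deviation x y)) ∂ν := by
          refine lintegral_mono fun y => ?_
          refine le_trans (le_of_eq ?_) (add_le_add_right
            (mul_le_mul_right (hc.tsum_wordPoint_le hx hn y) K) ε)
          simp only [mul_add, ENNReal.tsum_add, ENNReal.tsum_mul_right, M.tsum_pathProb, one_mul]
          rw [← ENNReal.tsum_mul_left]
          congr 1
          exact tsum_congr fun u => by ring
      _ ≤ _ := by
          rw [lintegral_add_left measurable_const, lintegral_const,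
            lintegral_const_mul _ ((M.measurable_deviation x).const_mul _),
            lintegral_const_mul _ (M.measurable_deviation x)]
          simp only [measure_univ, mul_one]
          gcongr
  · have key : ∀ y, M.pathProb (List.ofFn u) y ≠ 0 → ∃ k,
        M.wordMap (List.ofFn u) y ∈ M.vset k ∧ M.wordPoint x (List.ofFn u) ∈ M.vset k := by
      intro y hy
      obtain ⟨j, hj⟩ := M.exists_mem_vset y
      rw [wordPoint_eq x (by simpa using hn) hj hy]
      exact exists_vset_wordMap hj (hx j) hy
    simp only [wordLaw]
    rw [← lintegral_mul_const _ (M.measurable_pathProb _), ← lintegral_add_right _ (hm u),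
      ← lintegral_add_right _ (hm u)]
    constructor <;> refine lintegral_mono fun y => ?_
    · rw [pathProb_append]
      by_cases hy : M.pathProb (List.ofFn u) y = 0
      · simp [hy]
      obtain ⟨k, h1, h2⟩ := key y hy
      rw [← mul_add]
      gcongr
      simpa [pathProb] using h k _ h1 _ h2
    · rw [pathProb_append]
      by_cases hy : M.pathProb (List.ofFn u) y = 0
      · simp [hy]
      obtain ⟨k, h1, h2⟩ := key y hy
      rw [← mul_add]
      gcongr
      rw [edist_comm]
      simpa [pathProb] using h k _ h2 _ h1

/-- Invariant measures have mean deviation at most `c` as soon as `a c + b ≤ c`. The truncations of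
the deviation have bounded integrals, and the contribution of the starting point dies out. -/
theorem IsContractive.lintegral_deviation_le_of_invariant (hc : M.IsContractive a) (ha : a < 1)
    (hx : ∀ j, x j ∈ M.vset j) {c : ℝ≥0∞} (hac : ENNReal.ofReal a * c + M.bConst x ≤ c)
    {μ : Measure X} (hμ : μ ∈ M.invariantMeasures) : ∫⁻ y, M.deviation x y ∂μ ≤ c := by
  have hprob := hμ.1
  have hA : ENNReal.ofReal a < 1 := ENNReal.ofReal_lt_one.2 ha
  have hdev := M.measurable_deviation x
  have hpt : ∀ (n : ℕ) (y : X), ∫⁻ z, M.deviation x z ∂(M.adjointOp^[n] (Measure.dirac y))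
      ≤ ENNReal.ofReal a ^ n * M.deviation x y + c := by
    intro n y
    induction n with
    | zero => simp [lintegral_dirac' y hdev]
    | succ n ih =>
      rw [Function.iterate_succ_apply']
      have := M.isProbabilityMeasure_adjointOp_iterate (Measure.dirac y) n
      calc _ ≤ _ := hc.lintegral_deviation_adjointOp_le hx _
        _ ≤ ENNReal.ofReal a * (ENNReal.ofReal a ^ n * M.deviation x y + c) + M.bConst x := by
            gcongr
        _ = ENNReal.ofReal a ^ (n + 1) * M.deviation x y +
            (ENNReal.ofReal a * c + M.bConst x) := by ring
        _ ≤ _ := by gcongr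
  have htr : ∀ N : ℕ, ∫⁻ y, min (M.deviation x y) N ∂μ ≤ c := by
    intro N
    have hmin : Measurable fun y => min (M.deviation x y) (N : ℝ≥0∞) := hdev.min measurable_const
    have hle : ∀ n : ℕ, ∫⁻ y, min (M.deviation x y) N ∂μ
        ≤ ∫⁻ y, min (ENNReal.ofReal a ^ n * M.deviation x y + c) N ∂μ := by
      intro n
      conv_lhs => rw [← adjointOp_iterate_of_mem hμ n]
      rw [M.lintegral_adjointOp_iterate μ n hmin]
      refine lintegral_mono fun y => le_min ?_ ?_
      · refine le_trans ?_ (hpt n y)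
        rw [M.lintegral_adjointOp_iterate _ n hdev, lintegral_dirac']
        · exact ENNReal.tsum_le_tsum fun u => mul_le_mul_right (min_le_left _ _) _
        · exact Measurable.tsum fun u =>
            (M.measurable_pathProb _).mul (hdev.comp (M.measurable_wordMap _))
      · calc _ ≤ ∑' u : Fin n → E, M.pathProb (List.ofFn u) y * N :=
              ENNReal.tsum_le_tsum fun u => mul_le_mul_right (min_le_right _ _) _
          _ = N := by rw [ENNReal.tsum_mul_right, M.tsum_pathProb, one_mul]
    have hlim : Tendsto (fun n : ℕ => ∫⁻ y, min (ENNReal.ofReal a ^ n * M.deviation x y + c) N ∂μ)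
        atTop (𝓝 (∫⁻ _, min c N ∂μ)) := by
      refine tendsto_lintegral_of_dominated_convergence (fun _ => (N : ℝ≥0∞)) (fun n => ?_)
        (fun n => ?_) ?_ (ae_of_all _ fun y => ?_)
      · exact ((hdev.const_mul _).add_const c).min measurable_const
      · exact ae_of_all _ fun y => min_le_right _ _
      · simp
      · have h1 : Tendsto (fun n : ℕ => ENNReal.ofReal a ^ n * M.deviation x y) atTop (𝓝 0) := by
          simpa using ENNReal.Tendsto.mul_const
            (ENNReal.tendsto_pow_atTop_nhds_zero_of_lt_one hA)
            (Or.inr (M.deviation_lt_top x y).ne)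
        simpa using (h1.add_const c).min tendsto_const_nhds
    refine (ge_of_tendsto' hlim hle).trans ?_
    simp
  have hsup : ∀ y, M.deviation x y = ⨆ N : ℕ, min (M.deviation x y) N := by
    intro y
    refine le_antisymm ?_ (iSup_le fun N => min_le_left _ _)
    obtain ⟨N, hN⟩ := ENNReal.exists_nat_gt (M.deviation_lt_top x y).ne
    exact le_iSup_of_le N (le_min le_rfl hN.le)
  rw [lintegral_congr hsup, lintegral_iSup]
  · exact iSup_le htr
  · exact fun N => hdev.min measurable_const
  · exact fun N N' h y => min_le_min le_rfl (by exact_mod_cast h)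

end Invariant

end MarkovSystem

/-! ### Construction of measures on sequence spaces -/

section Extension

open ProbabilityTheory

variable {α : Type*}

/-- The word formed by the first `n + 1` letters of a sequence. -/
def historyWord {n : ℕ} (h : (i : Finset.Iic n) → α) : List α :=
  List.ofFn fun k : Fin (n + 1) => h ⟨k, Finset.mem_Iic.2 (Nat.lt_succ_iff.1 k.2)⟩

variable [MeasurableSpace α]

open Classical in
/-- The conditional law of the next letter when words have the probabilities `m`. After a word of
probability zero it is an arbitrary point mass. -/
def nextLetter (m : List α → ℝ≥0∞) (l : List α) (d : α) : Measure α :=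
  if m l = 0 then Measure.dirac d else (m l)⁻¹ • Measure.sum fun a => m (l ++ [a]) • Measure.dirac a

theorem isProbabilityMeasure_nextLetter {m : List α → ℝ≥0∞}
    (h : ∀ l, ∑' a, m (l ++ [a]) = m l) (hfin : ∀ l, m l ≠ ∞) (l : List α) (d : α) :
    IsProbabilityMeasure (nextLetter m l d) := by
  constructor
  rw [nextLetter]
  split_ifs with h0
  · simp
  · simp [h l, ENNReal.inv_mul_cancel h0 (hfin l)]

theorem nextLetter_singleton_mul [MeasurableSingletonClass α] {m : List α → ℝ≥0∞}
    (h : ∀ l, ∑' a, m (l ++ [a]) = m l) (hfin : ∀ l, m l ≠ ∞) (l : List α) (d a : α) :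
    nextLetter m l d {a} * m l = m (l ++ [a]) := by
  rw [nextLetter]
  split_ifs with h0
  · rw [h0, mul_zero, eq_comm, ← nonpos_iff_eq_zero, ← h0, ← h l]
    exact ENNReal.le_tsum a
  · have : ∑' b, m (l ++ [b]) * ({a} : Set α).indicator 1 b = m (l ++ [a]) := by
      rw [tsum_eq_single a]
      · simp
      · intro b hb
        simp [hb]
    simp only [Measure.smul_apply, smul_eq_mul, Measure.sum_apply _ (measurableSet_singleton a),
      Measure.dirac_apply' _ (measurableSet_singleton a), this]
    rw [mul_right_comm, ENNReal.inv_mul_cancel h0 (hfin l), one_mul]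

/-- Consistent probabilities for all finite words over a countable alphabet are the cylinder
probabilities of a measure on the one-sided sequences. -/
theorem exists_measure_posWord [Countable α] [MeasurableSingletonClass α] (m : List α → ℝ≥0∞)
    (h0 : m [] = 1) (h : ∀ l, ∑' a, m (l ++ [a]) = m l) :
    ∃ P : Measure (ℕ → α), IsProbabilityMeasure P ∧
      ∀ l : List α, P {τ | ∀ (k : ℕ) (hk : k < l.length), τ k = l[k]} = m l := by
  have hle : ∀ l, m l ≤ 1 := by
    intro l
    induction l using List.reverseRecOn with
    | nil => exact h0.le
    | append_singleton l a ih => exact (ENNReal.le_tsum a).trans ((h l).le.trans ih)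
  have hfin : ∀ l, m l ≠ ∞ := fun l => ne_top_of_le_ne_top ENNReal.one_ne_top (hle l)
  let κ : (n : ℕ) → Kernel ((i : Finset.Iic n) → α) α := fun n =>
    { toFun := fun w => nextLetter m (historyWord w) (w ⟨0, by simp⟩)
      measurable' := measurable_of_countable _ }
  have hκ : ∀ n, IsMarkovKernel (κ n) :=
    fun n => ⟨fun w => isProbabilityMeasure_nextLetter h hfin _ _⟩
  let μ₀ : Measure α := Measure.sum fun a => m [a] • Measure.dirac a
  have hμ₀ : ∀ a, μ₀ {a} = m [a] := by
    intro a
    rw [Measure.sum_apply _ (measurableSet_singleton a), tsum_eq_single a]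
    · simp
    · intro b hb
      simp [hb]
  have : IsProbabilityMeasure μ₀ := by
    constructor
    rw [Measure.sum_apply _ .univ]
    simpa [h0] using h []
  let P : Measure (ℕ → α) := Kernel.trajMeasure (X := fun _ => α) μ₀ κ
  have hP : ∀ (n : ℕ) (w : (i : Finset.Iic n) → α),
      P.map (Preorder.frestrictLe (π := fun _ => α) n) {w} = m (historyWord w) := by
    intro n
    induction n with
    | zero =>
      intro w
      have hmap : P.map (Preorder.frestrictLe (π := fun _ => α) 0) =
          μ₀.map (MeasurableEquiv.piUnique (fun _ : Finset.Iic 0 => α)).symm := by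
        simp only [P, Kernel.trajMeasure]
        rw [Measure.map_comp _ _ (by fun_prop), Kernel.traj_map_frestrictLe,
          Kernel.partialTraj_self]
        exact Measure.id_comp
      rw [hmap, Measure.map_apply (MeasurableEquiv.measurable _) (measurableSet_singleton w)]
      have hset : (MeasurableEquiv.piUnique (fun _ : Finset.Iic 0 => α)).symm ⁻¹' {w}
          = {w ⟨0, by simp⟩} := by
        ext b
        simp only [mem_preimage, mem_singleton_iff, MeasurableEquiv.symm_apply_eq]
        rfl
      rw [hset, hμ₀]
      simp [historyWord]
    | succ n ih =>
      intro w
      let w' : (i : Finset.Iic n) → α := Preorder.frestrictLe₂ (π := fun _ => α) n.le_succ w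
      let b : α := w ⟨n + 1, by simp⟩
      have hword : historyWord w = historyWord w' ++ [b] := by
        rw [historyWord, List.ofFn_succ_last]
        rfl
      have hset : Preorder.frestrictLe (π := fun _ => α) (n + 1) ⁻¹' {w} =
          (fun τ : ℕ → α => (Preorder.frestrictLe (π := fun _ => α) n τ, τ (n + 1))) ⁻¹'
            ({w'} ×ˢ {b}) := by
        ext τ
        simp only [mem_preimage, mem_singleton_iff, mem_prod, funext_iff]
        constructor
        · exact fun hτ => ⟨fun i => hτ ⟨i.1, Finset.mem_Iic.2
            ((Finset.mem_Iic.1 i.2).trans n.le_succ)⟩, hτ ⟨n + 1, by simp⟩⟩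
        · rintro ⟨h1, h2⟩ ⟨i, hi⟩
          rcases Nat.le_succ_iff.1 (Finset.mem_Iic.1 hi) with h3 | rfl
          · exact h1 ⟨i, Finset.mem_Iic.2 h3⟩
          · exact h2
      have hprod := Kernel.map_frestrictLe_trajMeasure_compProd_eq_map_trajMeasure
        (X := fun _ => α) (μ₀ := μ₀) (κ := κ) (a := n)
      rw [Measure.map_apply (by fun_prop) (measurableSet_singleton w), hset,
        ← Measure.map_apply (by fun_prop) (measurableSet_singleton _ |>.prod
          (measurableSet_singleton _)), ← hprod,
        Measure.compProd_apply_prod (measurableSet_singleton _) (measurableSet_singleton _),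
        lintegral_singleton, ih w', hword]
      exact nextLetter_singleton_mul h hfin _ _ _
  refine ⟨P, inferInstance, fun l => ?_⟩
  rcases l.eq_nil_or_concat with rfl | ⟨l, a, rfl⟩
  · simp [h0]
  · rw [List.concat_eq_append]
    let w : (i : Finset.Iic l.length) → α := fun i => (l ++ [a])[i.1]'(by
      simpa using Nat.lt_succ_iff.2 (Finset.mem_Iic.1 i.2))
    have hw := hP l.length w
    rw [Measure.map_apply (by fun_prop) (measurableSet_singleton _)] at hw
    convert hw using 2
    · ext τ
      simp only [mem_ofPred_eq, mem_preimage, mem_singleton_iff, funext_iff]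
      exact ⟨fun h i => h i.1 _, fun h k hk => h ⟨k, by simp at hk ⊢; omega⟩⟩
    · refine List.ext_getElem (by simp [historyWord]) fun k h1 h2 => ?_
      simp only [historyWord, List.getElem_ofFn, w]

end Extension

/-! ### Cylinders in the two-sided code space -/

section Cylinders

variable {E : Type*}

theorem cyl_nil (z : ℤ) : cyl z ([] : List (Letter E)) = univ := by
  ext σ
  simp [cyl]

theorem mem_cyl_cons {z : ℤ} {s : Letter E} {l : List (Letter E)} {σ : BiCode E} :
    σ ∈ cyl z (s :: l) ↔ σ z = s ∧ σ ∈ cyl (z + 1) l := by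
  constructor
  · intro h
    have h0 : σ (z + ((0 : ℕ) : ℤ)) = s := h 0 (by simp)
    refine ⟨by simpa using h0, fun k hk => ?_⟩
    have := h (k + 1) (by simpa using hk)
    rw [List.getElem_cons_succ] at this
    rw [← this]
    congr 1
    push_cast
    ring
  · rintro ⟨h1, h2⟩ k hk
    cases k with
    | zero => simpa using h1
    | succ k =>
      rw [List.getElem_cons_succ, ← h2 k (by simpa using hk)]
      congr 1
      push_cast
      ring

theorem mem_cyl_singleton {z : ℤ} {s : Letter E} {σ : BiCode E} : σ ∈ cyl z [s] ↔ σ z = s := by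
  rw [mem_cyl_cons, cyl_nil]
  simp

theorem mem_cyl_append {z : ℤ} {l l' : List (Letter E)} {σ : BiCode E} :
    σ ∈ cyl z (l ++ l') ↔ σ ∈ cyl z l ∧ σ ∈ cyl (z + l.length) l' := by
  induction l generalizing z with
  | nil => simp [cyl_nil]
  | cons s l ih =>
    rw [List.cons_append, mem_cyl_cons, ih, mem_cyl_cons, and_assoc]
    simp only [List.length_cons, Nat.cast_add, Nat.cast_one, add_assoc, add_comm (1 : ℤ)]

theorem measurableSet_cyl (z : ℤ) (l : List (Letter E)) : MeasurableSet (cyl z l) := by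
  induction l generalizing z with
  | nil => rw [cyl_nil]; exact .univ
  | cons s l ih =>
    have : cyl z (s :: l) = (fun σ : BiCode E => σ z) ⁻¹' {s} ∩ cyl (z + 1) l := by
      ext σ
      rw [mem_cyl_cons]
      rfl
    rw [this]
    exact ((measurable_pi_apply z) (MeasurableSet.of_discrete)).inter (ih _)

theorem measurable_shift : Measurable (shift : BiCode E → BiCode E) :=
  measurable_pi_lambda _ fun i => measurable_pi_apply (i + 1)

theorem shift_preimage_cyl (z : ℤ) (l : List (Letter E)) : shift ⁻¹' cyl z l = cyl (z + 1) l := by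
  induction l generalizing z with
  | nil => simp [cyl_nil]
  | cons s l ih =>
    ext σ
    rw [mem_preimage, mem_cyl_cons, ← mem_preimage, ih, mem_cyl_cons]
    rfl

theorem exists_eq_map_edge_or (l : List (Letter E)) :
    (∃ l' : List E, l = l'.map Letter.edge) ∨ ∃ s ∈ l, s ∉ range (Letter.edge : E → Letter E) := by
  by_cases h : ∀ s ∈ l, s ∈ range (Letter.edge : E → Letter E)
  · left
    induction l with
    | nil => exact ⟨[], rfl⟩
    | cons s l ih =>
      obtain ⟨e, rfl⟩ := h s (by simp)
      obtain ⟨l', rfl⟩ := ih fun t ht => h t (by simp [ht])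
      exact ⟨e :: l', rfl⟩
  · push Not at h
    exact Or.inr h

theorem Letter.edge_injective : Function.Injective (Letter.edge : E → Letter E) :=
  OnePoint.coe_injective

/-- Almost every sequence consists of edges. -/
def EdgeValued (Λ : Measure (BiCode E)) : Prop :=
  ∀ᵐ σ ∂Λ, ∀ n : ℤ, σ n ∈ range (Letter.edge : E → Letter E)

theorem EdgeValued.measure_cyl_eq_zero {Λ : Measure (BiCode E)} (h : EdgeValued Λ) {z : ℤ}
    {l : List (Letter E)} (hl : ∃ s ∈ l, s ∉ range (Letter.edge : E → Letter E)) :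
    Λ (cyl z l) = 0 := by
  obtain ⟨s, hs, hne⟩ := hl
  obtain ⟨k, hk, rfl⟩ := List.getElem_of_mem hs
  refine measure_mono_null (fun σ hσ => ?_) h
  simp only [mem_compl_iff, mem_ofPred_eq, not_forall]
  exact ⟨z + k, by rw [hσ k hk]; exact hne⟩

/-- The letters with the indices `z, …, z + n - 1`. -/
def window (z : ℤ) (n : ℕ) (σ : BiCode E) : Fin n → Letter E := fun k => σ (z + k)

theorem window_preimage_singleton (z : ℤ) (n : ℕ) (v : Fin n → Letter E) :
    window z n ⁻¹' {v} = cyl z (List.ofFn v) := by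
  ext σ
  simp only [mem_preimage, mem_singleton_iff, funext_iff, window, cyl, mem_ofPred_eq]
  refine ⟨fun h k hk => ?_, fun h k => ?_⟩
  · simpa using h ⟨k, by simpa using hk⟩
  · simpa using h k (by simp)

theorem measurable_window (z : ℤ) (n : ℕ) : Measurable (window (E := E) z n) :=
  measurable_pi_lambda _ fun _ => measurable_pi_apply _

theorem past_le : past E ≤ MeasurableSpace.pi :=
  iSup_le fun i => (measurable_pi_apply (i : ℤ)).comap_le

variable [Countable E]

theorem EdgeValued.tsum_measure_inter {Λ : Measure (BiCode E)} (h : EdgeValued Λ) (z : ℤ)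
    {A : Set (BiCode E)} (hA : MeasurableSet A) :
    ∑' e, Λ (A ∩ cyl z [Letter.edge e]) = Λ A := by
  rw [← measure_iUnion]
  · refine measure_congr ?_
    filter_upwards [h] with σ hσ
    obtain ⟨e, he⟩ := hσ z
    refine propext ⟨fun h' => ?_, fun h' => mem_iUnion.2 ⟨e, h', mem_cyl_singleton.2 he.symm⟩⟩
    exact (mem_iUnion.1 h').choose_spec.1
  · intro e e' hne
    refine disjoint_left.2 fun σ h1 h2 => hne (Letter.edge_injective ?_)
    rw [← mem_cyl_singleton.1 h1.2, mem_cyl_singleton.1 h2.2]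
  · exact fun e => hA.inter (measurableSet_cyl _ _)

theorem EdgeValued.tsum_cyl_cons {Λ : Measure (BiCode E)} (h : EdgeValued Λ) (z : ℤ)
    (l : List (Letter E)) :
    ∑' e, Λ (cyl z (Letter.edge e :: l)) = Λ (cyl (z + 1) l) := by
  rw [← h.tsum_measure_inter z (measurableSet_cyl _ _)]
  congr! 3 with e
  ext σ
  rw [mem_cyl_cons, mem_inter_iff, mem_cyl_singleton, and_comm]

theorem EdgeValued.tsum_cyl_snoc {Λ : Measure (BiCode E)} (h : EdgeValued Λ) (z : ℤ)
    (l : List (Letter E)) :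
    ∑' e, Λ (cyl z (l ++ [Letter.edge e])) = Λ (cyl z l) := by
  rw [← h.tsum_measure_inter (z + l.length) (measurableSet_cyl _ _)]
  congr! 3 with e
  ext σ
  rw [mem_cyl_append, mem_inter_iff]

theorem EdgeValued.tsum_setLIntegral {Λ : Measure (BiCode E)} (h : EdgeValued Λ) (z : ℤ)
    (g : BiCode E → ℝ≥0∞) : ∑' e, ∫⁻ σ in cyl z [Letter.edge e], g σ ∂Λ = ∫⁻ σ, g σ ∂Λ := by
  rw [← lintegral_iUnion fun e => measurableSet_cyl _ _]
  · rw [Measure.restrict_eq_self_of_ae_mem]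
    filter_upwards [h] with σ hσ
    obtain ⟨e, he⟩ := hσ z
    exact mem_iUnion.2 ⟨e, mem_cyl_singleton.2 he.symm⟩
  · intro e e' hne
    refine disjoint_left.2 fun σ h1 h2 => hne (Letter.edge_injective ?_)
    rw [← mem_cyl_singleton.1 h1, mem_cyl_singleton.1 h2]

/-- Integrals of functions which depend on finitely many coordinates only are sums over words. -/
theorem EdgeValued.lintegral_eq_tsum {Λ : Measure (BiCode E)} (h : EdgeValued Λ) (z : ℤ) (n : ℕ)
    {H : BiCode E → ℝ≥0∞} {f : (Fin n → E) → ℝ≥0∞}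
    (hH : ∀ (u : Fin n → E), ∀ σ ∈ cyl z ((List.ofFn u).map Letter.edge), H σ = f u) :
    ∫⁻ σ, H σ ∂Λ = ∑' u : Fin n → E, Λ (cyl z ((List.ofFn u).map Letter.edge)) * f u := by
  have hcover : ∀ᵐ σ ∂Λ, σ ∈ ⋃ u : Fin n → E, cyl z ((List.ofFn u).map Letter.edge) := by
    filter_upwards [h] with σ hσ
    choose e he using hσ
    refine mem_iUnion.2 ⟨fun k => e (z + k), fun k hk => ?_⟩
    simp [he]
  rw [← Measure.restrict_eq_self_of_ae_mem hcover,
    lintegral_iUnion (fun u => measurableSet_cyl _ _), Measure.restrict_eq_self_of_ae_mem hcover]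
  · refine tsum_congr fun u => ?_
    rw [setLIntegral_congr_fun (measurableSet_cyl _ _) (hH u), setLIntegral_const, mul_comm]
  · intro u v huv
    refine disjoint_left.2 fun σ h1 h2 => huv ?_
    funext k
    have h3 := h1 k (by simp)
    have h4 := h2 k (by simp)
    rw [h3] at h4
    simpa using Letter.edge_injective (by simpa using h4)

theorem comap_window_mono {z z' : ℤ} {n n' : ℕ} (h1 : z' ≤ z) (h2 : z + n ≤ z' + n') :
    MeasurableSpace.comap (window (E := E) z n) inferInstance
      ≤ MeasurableSpace.comap (window (E := E) z' n') inferInstance := by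
  rintro _ ⟨B, hB, rfl⟩
  refine ⟨(fun (v : Fin n' → Letter E) (k : Fin n) =>
    v ⟨(z - z' + k).toNat, by have := k.2; omega⟩) ⁻¹' B, .of_discrete, ?_⟩
  ext σ
  have : ∀ k : Fin n, z' + ((z - z' + k).toNat : ℤ) = z + k := fun k => by omega
  simp only [mem_preimage, window, this]
  rfl

theorem comap_eval_le_comap_window {z i : ℤ} {n : ℕ} (h1 : z ≤ i) (h2 : i < z + n) :
    MeasurableSpace.comap (fun σ : BiCode E => σ i) inferInstance
      ≤ MeasurableSpace.comap (window (E := E) z n) inferInstance := by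
  rintro _ ⟨B, hB, rfl⟩
  refine ⟨(fun v : Fin n → Letter E => v ⟨(i - z).toNat, by omega⟩) ⁻¹' B, .of_discrete, ?_⟩
  ext σ
  have : z + ((i - z).toNat : ℤ) = i := by omega
  simp only [mem_preimage, window, this]

theorem past_eq_iSup_comap_window :
    past E = ⨆ n : ℕ, MeasurableSpace.comap (window (E := E) (-n) (n + 1)) inferInstance := by
  refine le_antisymm (iSup_le fun i => ?_) (iSup_le fun n => ?_)
  · have hi := i.2
    refine le_trans ?_ (le_iSup _ (-(i : ℤ)).toNat)
    exact comap_eval_le_comap_window (by omega) (by omega)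
  · refine (@measurable_pi_lambda _ _ _ (past E) _ _ fun k => ?_).comap_le
    have := k.2
    exact measurable_iff_comap_le.2 (le_iSup (fun i : {i : ℤ // i ≤ 0} =>
      MeasurableSpace.comap (fun σ : BiCode E => σ i) inferInstance) ⟨-n + k, by omega⟩)

/-- Two measures agree on the past if they agree on the events determined by finitely many past
coordinates. -/
theorem measure_eq_of_past {μ ν : Measure (BiCode E)} [IsFiniteMeasure μ]
    (h : ∀ (n : ℕ) (B : Set (Fin (n + 1) → Letter E)),
      μ (window (-n) (n + 1) ⁻¹' B) = ν (window (-n) (n + 1) ⁻¹' B))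
    {s : Set (BiCode E)} (hs : MeasurableSet[past E] s) : μ s = ν s := by
  refine ext_on_measurableSpace_of_generate_finite MeasurableSpace.pi
    (⋃ n : ℕ, {t | MeasurableSet[MeasurableSpace.comap (window (E := E) (-n) (n + 1))
      inferInstance] t}) ?_ past_le ?_ ?_ ?_ hs
  · intro t ht
    obtain ⟨n, B, -, rfl⟩ := mem_iUnion.1 ht
    exact h n B
  · exact past_eq_iSup_comap_window.trans
      (MeasurableSpace.generateFrom_iUnion_measurableSet _).symm
  · refine isPiSystem_iUnion_of_monotone _
      (fun n => @MeasurableSpace.isPiSystem_measurableSet _ (_)) fun n n' hn => ?_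
    exact comap_window_mono (by omega) (by push_cast; omega)
  · exact h 0 univ

/-- A measure on the code space is determined by the cylinders which start early. -/
theorem ext_of_cyl {μ ν : Measure (BiCode E)} [IsFiniteMeasure μ] (r : ℤ)
    (h : ∀ z ≤ r, ∀ l, μ (cyl z l) = ν (cyl z l)) : μ = ν := by
  refine ext_of_generate_finite (⋃ n : ℕ, {t | MeasurableSet[MeasurableSpace.comap
    (window (E := E) (r - n) (2 * n)) inferInstance] t}) ?_ ?_ ?_ ?_
  · refine Eq.trans ?_ (MeasurableSpace.generateFrom_iUnion_measurableSet _).symm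
    refine le_antisymm (iSup_le fun i => ?_) (iSup_le fun n => ?_)
    · refine le_trans ?_ (le_iSup _ ((i - r).natAbs + 1))
      exact comap_eval_le_comap_window (by omega) (by omega)
    · exact (measurable_window _ _).comap_le
  · refine isPiSystem_iUnion_of_monotone _
      (fun n => @MeasurableSpace.isPiSystem_measurableSet _ (_)) fun n n' hn => ?_
    exact comap_window_mono (by omega) (by push_cast; omega)
  · intro t ht
    obtain ⟨n, B, hB, rfl⟩ := mem_iUnion.1 ht
    rw [← Measure.map_apply (measurable_window _ _) hB,
      ← Measure.map_apply (measurable_window _ _) hB]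
    congr 1
    refine Measure.ext_of_singleton fun v => ?_
    rw [Measure.map_apply (measurable_window _ _) (measurableSet_singleton v),
      Measure.map_apply (measurable_window _ _) (measurableSet_singleton v),
      window_preimage_singleton]
    exact h _ (by omega) _
  · have := h r le_rfl []
    rwa [cyl_nil] at this

end Cylinders

/-! ### Two-sided extension of consistent word probabilities -/

section TwoSided

variable {E : Type*}

/-- The two-sided sequence whose letters at `n + 1` and `-n` are the components of the
`n`-th pair. -/
def unfoldPairs (τ : ℕ → E × E) : BiCode E := fun z =>
  if 0 < z then Letter.edge (τ (z - 1).toNat).1 else Letter.edge (τ (-z).toNat).2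

theorem edgeValued_unfoldPairs (τ : ℕ → E × E) (z : ℤ) :
    unfoldPairs τ z ∈ range (Letter.edge : E → Letter E) := by
  unfold unfoldPairs
  split_ifs
  exacts [mem_range_self _, mem_range_self _]

/-- The word which a finite sequence of pairs codes on a window symmetric about `1 / 2`. -/
def pairWord (q : List (E × E)) : List E := (q.map Prod.snd).reverse ++ q.map Prod.fst

theorem pairWord_append_singleton (q : List (E × E)) (a b : E) :
    pairWord (q ++ [(a, b)]) = b :: (pairWord q ++ [a]) := by
  simp [pairWord]

theorem length_pairWord (q : List (E × E)) : (pairWord q).length = 2 * q.length := by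
  simp [pairWord]
  omega

theorem exists_pairWord_eq (n : ℕ) (l : List E) (hl : l.length = 2 * n) :
    ∃ q : List (E × E), q.length = n ∧ pairWord q = l := by
  have h1 : (l.drop n).length = n := by simp; omega
  have h2 : (l.take n).reverse.length = n := by simp; omega
  refine ⟨(l.drop n).zip (l.take n).reverse, by rw [List.length_zip, h1, h2, min_self], ?_⟩
  rw [pairWord, List.map_fst_zip (by rw [h1, h2]), List.map_snd_zip (by rw [h1, h2]),
    List.reverse_reverse, List.take_append_drop]

theorem unfoldPairs_mem_cyl (q : List (E × E)) (τ : ℕ → E × E) :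
    unfoldPairs τ ∈ cyl (-q.length + 1) ((pairWord q).map Letter.edge) ↔
      ∀ (k : ℕ) (hk : k < q.length), τ k = q[k] := by
  induction q using List.reverseRecOn with
  | nil => simp [pairWord, cyl_nil]
  | append_singleton q ab ih =>
    obtain ⟨a, b⟩ := ab
    have h1 : unfoldPairs τ (-((q ++ [(a, b)]).length : ℤ) + 1) = Letter.edge (τ q.length).2 := by
      have : (-(-((q ++ [(a, b)]).length : ℤ) + 1)).toNat = q.length := by simp
      rw [unfoldPairs, if_neg (by simp), this]
    have h2 : unfoldPairs τ ((q.length : ℤ) + 1) = Letter.edge (τ q.length).1 := by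
      rw [unfoldPairs, if_pos (by omega)]
      simp
    have h3 : -((q ++ [(a, b)]).length : ℤ) + 1 + 1 = -q.length + 1 := by simp
    have h4 : -(q.length : ℤ) + 1 + ((pairWord q).map Letter.edge).length = q.length + 1 := by
      rw [List.length_map, length_pairWord]
      push_cast
      ring
    rw [pairWord_append_singleton, List.map_cons, mem_cyl_cons, h1, h3, List.map_append,
      mem_cyl_append, ih, h4, List.map_singleton, mem_cyl_singleton, h2,
      Letter.edge_injective.eq_iff, Letter.edge_injective.eq_iff]
    constructor
    · rintro ⟨hb, h, ha⟩ k hk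
      rcases Nat.lt_succ_iff_lt_or_eq.1 (by simpa using hk) with hk' | rfl
      · rw [List.getElem_append_left hk']
        exact h k hk'
      · simp [Prod.ext_iff, ha, hb]
    · intro h
      have hq := h q.length (by simp)
      simp only [List.getElem_concat_length] at hq
      refine ⟨by rw [hq], fun k hk => ?_, by rw [hq]⟩
      rw [h k (by simp; omega), List.getElem_append_left hk]

/-- Probabilities of finite words which are consistent under extension to both sides are the
cylinder probabilities of a shift-invariant measure. -/
theorem exists_measure_biWord [Countable E] (m : List E → ℝ≥0∞) (h0 : m [] = 1)
    (hr : ∀ l, ∑' e, m (l ++ [e]) = m l) (hl : ∀ l, ∑' e, m (e :: l) = m l) :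
    ∃ Λ : Measure (BiCode E), IsProbabilityMeasure Λ ∧ EdgeValued Λ ∧
      ∀ (z : ℤ) (l : List E), Λ (cyl z (l.map Letter.edge)) = m l := by
  let _ : MeasurableSpace E := ⊤
  have : DiscreteMeasurableSpace E := ⟨fun _ => trivial⟩
  have hpair : ∀ q : List (E × E), ∑' ab, m (pairWord (q ++ [ab])) = m (pairWord q) := by
    intro q
    rw [ENNReal.tsum_prod']
    simp only [pairWord_append_singleton, hl, hr]
  obtain ⟨P, hP, hcylP⟩ := exists_measure_posWord (fun q : List (E × E) => m (pairWord q))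
    (by simpa [pairWord] using h0) hpair
  have hmeas : Measurable (unfoldPairs : (ℕ → E × E) → BiCode E) := by
    refine measurable_pi_lambda _ fun z => ?_
    unfold unfoldPairs
    split_ifs
    · exact (measurable_of_countable (fun ab : E × E => (Letter.edge ab.1 : Letter E))).comp
        (measurable_pi_apply _)
    · exact (measurable_of_countable (fun ab : E × E => (Letter.edge ab.2 : Letter E))).comp
        (measurable_pi_apply _)
  have hedge : EdgeValued (P.map unfoldPairs) := by
    rw [EdgeValued, ae_map_iff hmeas.aemeasurable]
    · exact ae_of_all _ fun τ z => edgeValued_unfoldPairs τ z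
    · refine (MeasurableSet.iInter fun z => ?_ : MeasurableSet (⋂ z : ℤ,
        (fun σ : BiCode E => σ z) ⁻¹' range (Letter.edge : E → Letter E))).congr ?_
      · exact measurable_pi_apply z .of_discrete
      · ext σ
        simp
  refine ⟨P.map unfoldPairs, Measure.isProbabilityMeasure_map hmeas.aemeasurable, hedge, ?_⟩
  have hsymm : ∀ (n : ℕ) (l : List E), l.length = 2 * n →
      P.map unfoldPairs (cyl (-n + 1) (l.map Letter.edge)) = m l := by
    intro n l hn
    obtain ⟨q, rfl, rfl⟩ := exists_pairWord_eq n l hn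
    rw [Measure.map_apply hmeas (measurableSet_cyl _ _), ← hcylP q]
    congr 1
    ext τ
    exact unfoldPairs_mem_cyl q τ
  have hgap : ∀ (n k j : ℕ) (z : ℤ) (l : List E), z = -n + 1 + k → l.length + k + j = 2 * n →
      P.map unfoldPairs (cyl z (l.map Letter.edge)) = m l := by
    intro n k
    induction k with
    | zero =>
      intro j
      induction j with
      | zero =>
        rintro z l rfl h
        simpa using hsymm n l (by simpa using h)
      | succ j ih =>
        intro z l hz h
        rw [← hedge.tsum_cyl_snoc, ← hr]
        refine tsum_congr fun e => ?_
        rw [← ih z (l ++ [e]) hz (by simp; omega)]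
        simp
    | succ k ih =>
      intro j z l hz h
      obtain ⟨z, rfl⟩ : ∃ z', z = z' + 1 := ⟨z - 1, by ring⟩
      rw [← hedge.tsum_cyl_cons, ← hl]
      refine tsum_congr fun e => ?_
      rw [← ih j z (e :: l) (by push_cast at hz; linarith) (by simp; omega)]
      simp
  intro z l
  refine hgap (z.natAbs + l.length + 1) (z + (z.natAbs + l.length)).toNat
    (2 * (z.natAbs + l.length + 1) - l.length - (z + (z.natAbs + l.length)).toNat) z l ?_ ?_
  · omega
  · omega

end TwoSided

/-! ### Measurability of the approximations of the coding map -/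

theorem measurable_of_window {E Y : Type*} [Countable E] [MeasurableSpace Y] {z : ℤ} {n : ℕ}
    {H : BiCode E → Y} (h : ∀ σ σ', window z n σ = window z n σ' → H σ = H σ') :
    Measurable[MeasurableSpace.comap (window (E := E) z n) inferInstance] H := by
  intro B _
  refine ⟨window z n '' (H ⁻¹' B), .of_discrete, ?_⟩
  ext σ
  constructor
  · rintro ⟨σ', h1, h2⟩
    rw [mem_preimage, ← h σ' σ h2]
    exact h1
  · exact fun hσ => ⟨σ, hσ, rfl⟩

theorem window_apply_eq {E : Type*} {z : ℤ} {n : ℕ} {σ σ' : BiCode E}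
    (h : window z n σ = window z n σ') {i : ℤ} (h1 : z ≤ i) (h2 : i < z + n) : σ i = σ' i := by
  have := congrFun h ⟨(i - z).toNat, by omega⟩
  simp only [window] at this
  rwa [show z + ((i - z).toNat : ℤ) = i by omega] at this

theorem mem_cyl_map_edge_ofFn {E : Type*} {z : ℤ} {n : ℕ} {u : Fin n → E} {σ : BiCode E} :
    σ ∈ cyl z ((List.ofFn u).map Letter.edge) ↔ window z n σ = Letter.edge ∘ u := by
  rw [List.map_ofFn, ← window_preimage_singleton]
  rfl

namespace MarkovSystem

section Approximation

variable {X E V : Type*} [MeasurableSpace X] {M : MarkovSystem X E V} {x : V → X}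

theorem backComp_congr {σ σ' : BiCode E} {n : ℕ}
    (h : ∀ k : ℕ, k ≤ n → σ (-(k : ℤ)) = σ' (-(k : ℤ))) :
    M.backComp σ n = M.backComp σ' n := by
  induction n with
  | zero => simpa [backComp] using congrArg M.wExt (h 0 le_rfl)
  | succ n ih =>
    have h1 := h (n + 1) le_rfl
    push_cast at h1
    rw [backComp, backComp, ih fun k hk => h k (by omega), h1]

theorem approx_congr {σ σ' : BiCode E} {n : ℕ} (h : ∀ k : ℕ, k ≤ n → σ (-(k : ℤ)) = σ' (-(k : ℤ))) :
    M.approx x σ n = M.approx x σ' n := by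
  rw [approx, approx, backComp_congr h, h n le_rfl]

theorem approx_congr_window {σ σ' : BiCode E} {N n : ℕ} (hn : n ≤ N)
    (h : window (-N) (N + 1) σ = window (-N) (N + 1) σ') : M.approx x σ n = M.approx x σ' n :=
  approx_congr fun k hk => window_apply_eq h (by omega) (by push_cast; omega)

theorem backComp_eq_wordMap {σ : BiCode E} {n : ℕ} {l : List E} (hl : l.length = n + 1)
    (hσ : σ ∈ cyl (-n) (l.map Letter.edge)) (y : X) : M.backComp σ n y = M.wordMap l y := by
  induction n generalizing l y with
  | zero =>
    obtain ⟨e, rfl⟩ := List.length_eq_one_iff.1 hl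
    have h0 : σ 0 = Letter.edge e := by simpa using mem_cyl_singleton.1 hσ
    rw [backComp, h0]
    rfl
  | succ n ih =>
    obtain ⟨e, l, rfl⟩ := List.exists_cons_of_length_eq_add_one hl
    rw [List.map_cons, mem_cyl_cons] at hσ
    have h1 : σ (-((n : ℤ) + 1)) = Letter.edge e := by simpa using hσ.1
    rw [backComp, Function.comp_apply, h1, ih (l := l) (by simpa using hl)]
    · rfl
    · have : -((n + 1 : ℕ) : ℤ) + 1 = -n := by push_cast; ring
      rw [← this]
      exact hσ.2

theorem approx_eq_wordPoint {σ : BiCode E} {n : ℕ} {l : List E} (hl : l.length = n + 1)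
    (hσ : σ ∈ cyl (-n) (l.map Letter.edge)) : M.approx x σ n = M.wordPoint x l := by
  rw [approx, backComp_eq_wordMap hl hσ]
  obtain ⟨e, l, rfl⟩ := List.exists_cons_of_length_eq_add_one hl
  rw [List.map_cons, mem_cyl_cons] at hσ
  rw [hσ.1]
  rfl

theorem wExt_mem_vset {s : Letter E} (hs : s ∈ range (Letter.edge : E → Letter E)) {y : X}
    (hy : y ∈ M.vset (M.srcExt s)) : M.wExt s y ∈ M.vset (M.tgtExt s) := by
  obtain ⟨e, rfl⟩ := hs
  exact M.w_mapsTo e hy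

theorem backComp_mem_vset {σ : BiCode E} (hσ : σ ∈ M.pathSpace) {n : ℕ} {y : X}
    (hy : y ∈ M.vset (M.srcExt (σ (-(n : ℤ))))) : M.backComp σ n y ∈ M.vset (M.tgtExt (σ 0)) := by
  induction n generalizing y with
  | zero => exact wExt_mem_vset (hσ.1 0) (by simpa using hy)
  | succ n ih =>
    refine ih ?_
    have h1 := hσ.2 (-((n : ℤ) + 1))
    rw [show -((n : ℤ) + 1) + 1 = -n by ring] at h1
    rw [h1]
    push_cast at hy
    exact wExt_mem_vset (hσ.1 _) hy

theorem approx_mem_vset (hx : ∀ j, x j ∈ M.vset j) {σ : BiCode E} (hσ : σ ∈ M.pathSpace) (n : ℕ) :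
    M.approx x σ n ∈ M.vset (M.tgtExt (σ 0)) :=
  backComp_mem_vset hσ (hx _)

variable [Countable E]

variable (M) in
theorem measurableSet_pathSpace : MeasurableSet M.pathSpace := by
  have : M.pathSpace = ⋂ n : ℤ, ({σ | σ n ∈ range (Letter.edge : E → Letter E)} ∩
      {σ | M.srcExt (σ (n + 1)) = M.tgtExt (σ n)}) := by
    ext σ
    simp only [pathSpace, mem_ofPred_eq, mem_iInter, mem_inter_iff, forall_and]
  rw [this]
  refine MeasurableSet.iInter fun n => ?_
  have hn : Measurable fun σ : BiCode E => (σ n, σ (n + 1)) :=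
    (measurable_pi_apply n).prodMk (measurable_pi_apply (n + 1))
  have h2 : MeasurableSet {st : Letter E × Letter E | st.1 ∈ range (Letter.edge : E → Letter E) ∧
    M.srcExt st.2 = M.tgtExt st.1} := .of_discrete
  exact hn h2

theorem measurable_approx_comap {Y : Type*} [MeasurableSpace Y] (φ : X → Y) (n : ℕ) :
    Measurable[MeasurableSpace.comap (window (E := E) (-n) (n + 1)) inferInstance]
      fun σ => φ (M.approx x σ n) :=
  measurable_of_window fun _ _ h => congrArg φ (approx_congr_window le_rfl h)

theorem measurable_approx_past {Y : Type*} [MeasurableSpace Y] (φ : X → Y) (n : ℕ) :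
    Measurable[past E] fun σ => φ (M.approx x σ n) :=
  (measurable_approx_comap φ n).mono (past_eq_iSup_comap_window (E := E) ▸
    le_iSup (fun n : ℕ => MeasurableSpace.comap (window (E := E) (-n) (n + 1)) inferInstance) n)
    le_rfl

theorem measurable_approx (n : ℕ) : Measurable fun σ => M.approx x σ n :=
  (measurable_approx_past id n).mono past_le le_rfl

end Approximation

section Domain

variable {X E V : Type*} [MetricSpace X] [MeasurableSpace X] {M : MarkovSystem X E V} {x : V → X}

theorem measurable_edist_approx_past [Countable E] (n m : ℕ) :
    Measurable[past E] fun σ => edist (M.approx x σ n) (M.approx x σ m) := by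
  have h : Measurable[MeasurableSpace.comap (window (E := E) (-(max n m : ℕ)) (max n m + 1))
      inferInstance] fun σ => edist (M.approx x σ n) (M.approx x σ m) :=
    measurable_of_window fun σ σ' h => by
      rw [approx_congr_window (le_max_left n m) h, approx_congr_window (le_max_right n m) h]
  exact h.mono (past_eq_iSup_comap_window (E := E) ▸ le_iSup (fun n : ℕ =>
    MeasurableSpace.comap (window (E := E) (-n) (n + 1)) inferInstance) (max n m)) le_rfl

theorem measurable_edist_approx [Countable E] (n m : ℕ) :
    Measurable fun σ => edist (M.approx x σ n) (M.approx x σ m) :=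
  (measurable_edist_approx_past n m).mono past_le le_rfl

theorem tendsto_approx_codingMap {σ : BiCode E} (hσ : σ ∈ M.codingDomain x) :
    Tendsto (M.approx x σ) atTop (𝓝 (M.codingMap x σ)) := by
  rw [codingMap, dif_pos hσ]
  exact hσ.2.choose_spec

theorem codingMap_eq_of_tendsto {σ : BiCode E} (hσ : σ ∈ M.pathSpace) {y : X}
    (h : Tendsto (M.approx x σ) atTop (𝓝 y)) : M.codingMap x σ = y :=
  tendsto_nhds_unique (tendsto_approx_codingMap ⟨hσ, y, h⟩) h

theorem measurableSet_exists_tendsto_approx [CompleteSpace X] [Countable E] :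
    MeasurableSet[past E] {σ | ∃ y, Tendsto (M.approx x σ) atTop (𝓝 y)} := by
  have : {σ | ∃ y, Tendsto (M.approx x σ) atTop (𝓝 y)} = ⋂ k : ℕ, ⋃ N : ℕ, ⋂ n : ℕ, ⋂ _ : N ≤ n,
      {σ | edist (M.approx x σ n) (M.approx x σ N) < ((k : ℝ≥0∞) + 1)⁻¹} := by
    ext σ
    simp only [mem_ofPred_eq, mem_iInter, mem_iUnion]
    refine ⟨?_, fun h => ?_⟩
    · rintro ⟨y, hy⟩ k
      exact EMetric.cauchySeq_iff'.1 hy.cauchySeq _ (by simp)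
    · refine cauchySeq_tendsto_of_complete (EMetric.cauchySeq_iff'.2 fun ε hε => ?_)
      obtain ⟨k, hk⟩ := ENNReal.exists_inv_nat_lt hε.ne'
      obtain ⟨N, hN⟩ := h k
      refine ⟨N, fun n hn => (hN n hn).trans_le (le_trans ?_ hk.le)⟩
      exact ENNReal.inv_le_inv.2 le_self_add
  rw [this]
  exact .iInter fun k => .iUnion fun N => .iInter fun n => .iInter fun _ =>
    measurable_edist_approx_past n N measurableSet_Iio

theorem measurableSet_codingDomain [CompleteSpace X] [Countable E] :
    MeasurableSet (M.codingDomain x) :=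
  M.measurableSet_pathSpace.inter (past_le _ measurableSet_exists_tendsto_approx)

/-- On its domain the coding map agrees with a function of the past. The domain itself also
restricts the future coordinates. -/
theorem exists_measurable_past_codingMap [CompleteSpace X] [BorelSpace X] [Countable E] :
    ∃ F : BiCode E → X, Measurable[past E] F ∧ ∀ σ ∈ M.codingDomain x, M.codingMap x σ = F σ := by
  classical
  let C : Set (BiCode E) := {σ | ∃ y, Tendsto (M.approx x σ) atTop (𝓝 y)}
  let f : ℕ → BiCode E → X := fun n => C.piecewise (fun σ => M.approx x σ n) fun _ => x M.base
  have hf : ∀ σ, ∃ y, Tendsto (fun n => f n σ) atTop (𝓝 y) := by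
    intro σ
    by_cases h : σ ∈ C
    · simp only [f, piecewise_eq_of_mem _ _ _ h]
      exact h
    · simpa only [f, piecewise_eq_of_notMem _ _ _ h] using ⟨_, tendsto_const_nhds⟩
  choose F hF using hf
  refine ⟨F, ?_, fun σ hσ => ?_⟩
  · refine @measurable_of_tendsto_metrizable _ _ (past E) _ _ _ _ f F (fun n => ?_)
      (tendsto_pi_nhds.2 hF)
    have hC : MeasurableSet[past E] C := measurableSet_exists_tendsto_approx
    exact Measurable.piecewise hC (measurable_approx_past id n)
      (@measurable_const _ _ _ (past E) _)
  · refine tendsto_nhds_unique (tendsto_approx_codingMap hσ) ((hF σ).congr fun n => ?_)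
    exact piecewise_eq_of_mem _ _ _ hσ.2

theorem aemeasurable_codingMap [BorelSpace X] [Countable E] {Λ : Measure (BiCode E)}
    (h : ∀ᵐ σ ∂Λ, σ ∈ M.codingDomain x) : AEMeasurable (M.codingMap x) Λ :=
  aemeasurable_of_tendsto_metrizable_ae atTop (f := fun n σ => M.approx x σ n)
    (fun n => (measurable_approx n).aemeasurable)
    (h.mono fun _ hσ => tendsto_approx_codingMap hσ)

/-- A uniformly continuous `p_e` has limits at the points of the closure of its vertex set, and
hence the values of `p_e` along the approximations converge. -/
theorem IsUniformlyContinuous.tendsto_p_approx (hu : M.IsUniformlyContinuous)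
    (hx : ∀ j, x j ∈ M.vset j) (e : E) {σ : BiCode E} (hσ : σ ∈ M.codingDomain x) :
    Tendsto (fun n => M.p e (M.approx x σ n)) atTop
      (𝓝 ((M.arrival (M.src e)).indicator (fun σ => M.pBar e (M.codingMap x σ)) σ)) := by
  have hlim := tendsto_approx_codingMap hσ
  have hmem := approx_mem_vset hx hσ.1
  by_cases he : M.tgtExt (σ 0) = M.src e
  · rw [indicator_of_mem (show σ ∈ M.arrival (M.src e) from ⟨hσ.1, he⟩)]
    rw [he] at hmem
    have hcl : M.codingMap x σ ∈ closure (M.vset (M.src e)) :=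
      mem_closure_of_tendsto hlim (Eventually.of_forall hmem)
    have := mem_closure_iff_nhdsWithin_neBot.1 hcl
    obtain ⟨c, hc⟩ := CompleteSpace.complete
      (((cauchy_nhds (a := M.codingMap x σ)).mono nhdsWithin_le_nhds).map_of_le (hu e).2
        inf_le_right)
    rw [pBar, if_pos hcl]
    exact (tendsto_extendFrom ⟨c, hc⟩).comp
      (tendsto_nhdsWithin_iff.2 ⟨hlim, Eventually.of_forall hmem⟩)
  · rw [indicator_of_notMem fun h => he h.2]
    refine tendsto_const_nhds.congr fun n => (M.p_eq_zero e _ fun h => he ?_).symm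
    exact eq_of_mem_vset (hmem n) h

end Domain

end MarkovSystem

/-! ### Limits of chain laws on the code space -/

theorem tsum_le_of_tendsto {ι T : Type*} {𝒰 : Filter ι} [𝒰.NeBot] {f : ι → T → ℝ≥0∞} {g : T → ℝ≥0∞}
    {B : ℝ≥0∞} (h : ∀ t, Tendsto (fun i => f i t) 𝒰 (𝓝 (g t))) (hB : ∀ i, ∑' t, f i t ≤ B) :
    ∑' t, g t ≤ B := by
  rw [ENNReal.tsum_eq_iSup_sum]
  exact iSup_le fun s => le_of_tendsto' (tendsto_finsetSum s fun t _ => h t)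
    fun i => (ENNReal.sum_le_tsum s).trans (hB i)

namespace MarkovSystem

/-- The measure `Λ` is the limit along `𝒰`, in the sense of cylinder probabilities, of the two-sided
chains whose distribution at the beginning of the cylinder is `ν i`. Both the measures `Φ(μ)`
(constant family `μ`) and the limits of occupation averages are of this form. -/
structure IsLimitState {X E V ι : Type*} [MeasurableSpace X] (M : MarkovSystem X E V)
    (𝒰 : Filter ι) (ν : ι → Measure X) (Λ : Measure (BiCode E)) : Prop where
  isProbabilityMeasure : IsProbabilityMeasure Λ
  edgeValued : EdgeValued Λ
  tendsto_wordLaw : ∀ (z : ℤ) (l : List E),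
    Tendsto (fun i => M.wordLaw (ν i) l) 𝒰 (𝓝 (Λ (cyl z (l.map Letter.edge))))

namespace IsLimitState

section Paths

variable {X E V ι : Type*} [MeasurableSpace X] {M : MarkovSystem X E V} {𝒰 : Filter ι} [𝒰.NeBot]
  {ν : ι → Measure X} {Λ : Measure (BiCode E)}

theorem ae_mem_pathSpace [Countable E] (h : M.IsLimitState 𝒰 ν Λ) :
    ∀ᵐ σ ∂Λ, σ ∈ M.pathSpace := by
  have hnull : ∀ (n : ℤ) (ee : E × E), ∀ᵐ σ ∂Λ, M.src ee.2 ≠ M.tgt ee.1 →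
      σ ∉ cyl n [Letter.edge ee.1, Letter.edge ee.2] := by
    rintro n ⟨e, e'⟩
    by_cases hp : M.src e' = M.tgt e
    · exact ae_of_all _ fun σ h => absurd hp h
    · have h1 := h.tendsto_wordLaw n [e, e']
      have h2 : ∀ i, M.wordLaw (ν i) [e, e'] = 0 := by
        intro i
        rw [wordLaw, ← lintegral_zero (μ := ν i)]
        refine lintegral_congr fun y => ?_
        by_contra hne
        have h3 : ENNReal.ofReal (M.p e y) ≠ 0 := left_ne_zero_of_mul hne
        have h4 : ENNReal.ofReal (M.p e' (M.w e y)) ≠ 0 :=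
          left_ne_zero_of_mul (right_ne_zero_of_mul hne)
        exact hp (eq_of_mem_vset (mem_vset_src_of_ne_zero h4)
          (M.w_mapsTo e (mem_vset_src_of_ne_zero h3)))
      simp only [h2] at h1
      have h5 : Λ (cyl n [Letter.edge e, Letter.edge e']) = 0 :=
        tendsto_nhds_unique h1 tendsto_const_nhds
      filter_upwards [measure_eq_zero_iff_ae_notMem.1 h5] with σ hσ _ using hσ
  filter_upwards [h.edgeValued, ae_all_iff.2 fun n => ae_all_iff.2 (hnull n)] with σ h1 h2
  refine ⟨h1, fun n => ?_⟩
  obtain ⟨e, he⟩ := h1 n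
  obtain ⟨e', he'⟩ := h1 (n + 1)
  rw [← he, ← he']
  by_contra hne
  refine h2 n (e, e') hne ?_
  rw [mem_cyl_cons, mem_cyl_singleton]
  exact ⟨he.symm, he'.symm⟩

theorem map_shift [Countable E] (h : M.IsLimitState 𝒰 ν Λ) : Λ.map shift = Λ := by
  have := h.isProbabilityMeasure
  have hmap : IsProbabilityMeasure (Λ.map shift) :=
    Measure.isProbabilityMeasure_map measurable_shift.aemeasurable
  refine ext_of_cyl 0 fun z _ l => ?_
  rw [Measure.map_apply measurable_shift (measurableSet_cyl _ _), shift_preimage_cyl]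
  rcases exists_eq_map_edge_or l with ⟨l', rfl⟩ | hl
  · exact tendsto_nhds_unique (h.tendsto_wordLaw _ l') (h.tendsto_wordLaw _ l')
  · rw [h.edgeValued.measure_cyl_eq_zero hl, h.edgeValued.measure_cyl_eq_zero hl]

end Paths

section Convergence

variable {X E V ι : Type*} [MetricSpace X] [MeasurableSpace X] [OpensMeasurableSpace X]
  [Countable V] [Countable E] {M : MarkovSystem X E V} {x : V → X} {a : ℝ} {c : ℝ≥0∞}
  {𝒰 : Filter ι} [𝒰.NeBot] {ν : ι → Measure X} {Λ : Measure (BiCode E)}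

/-- The contraction estimate for the chain, a sum over words, passes to the limit by Fatou's
lemma. -/
theorem lintegral_edist_approx_le (h : M.IsLimitState 𝒰 ν Λ) (hν : ∀ i, IsProbabilityMeasure (ν i))
    (hc : M.IsContractive a) (hx : ∀ j, x j ∈ M.vset j)
    (hac : ENNReal.ofReal a * c + M.bConst x ≤ c) (hνc : ∀ i, ∫⁻ y, M.deviation x y ∂(ν i) ≤ c)
    (n m : ℕ) :
    ∫⁻ σ, edist (M.approx x σ (n + m)) (M.approx x σ m) ∂Λ
      ≤ (ENNReal.ofReal a ^ (n + (m + 1)) + ENNReal.ofReal a ^ (m + 1)) * c := by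
  have hsum := h.edgeValued.lintegral_eq_tsum (-((n + m : ℕ) : ℤ)) (n + (m + 1))
    (H := fun σ => edist (M.approx x σ (n + m)) (M.approx x σ m))
    (f := fun u => edist (M.wordPoint x (List.ofFn u)) (M.wordPoint x ((List.ofFn u).drop n))) (by
      intro u σ hσ
      rw [approx_eq_wordPoint (l := List.ofFn u) (by simp [add_assoc]) hσ,
        approx_eq_wordPoint (l := (List.ofFn u).drop n) (by simp; omega)]
      rw [← List.take_append_drop n (List.ofFn u), List.map_append, mem_cyl_append] at hσ
      have hz : -((n + m : ℕ) : ℤ) + (((List.ofFn u).take n).map Letter.edge).length = -m := by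
        simp only [List.length_map, List.length_take, List.length_ofFn]
        omega
      rw [hz] at hσ
      exact hσ.2)
  rw [hsum]
  refine tsum_le_of_tendsto (𝒰 := 𝒰)
    (fun u => ENNReal.Tendsto.mul_const (h.tendsto_wordLaw _ _) (Or.inr (edist_ne_top _ _)))
    fun i => ?_
  have := hν i
  rw [tsum_word_add n (m + 1) (fun l => M.wordLaw (ν i) l *
    edist (M.wordPoint x l) (M.wordPoint x (l.drop n)))]
  refine le_trans (le_of_eq ?_)
    (hc.tsum_wordLaw_edist_le hx hac (ν i) (hνc i) n (Nat.succ_ne_zero m))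
  refine tsum_congr fun u => tsum_congr fun v => ?_
  rw [List.drop_left' (by simp)]

/-- A bound which is uniform in the number of further steps. The lower limit makes sense and is
measurable whether or not the approximations converge. -/
theorem lintegral_liminf_edist_approx_le (h : M.IsLimitState 𝒰 ν Λ)
    (hν : ∀ i, IsProbabilityMeasure (ν i)) (ha : a < 1) (hc : M.IsContractive a)
    (hx : ∀ j, x j ∈ M.vset j) (hac : ENNReal.ofReal a * c + M.bConst x ≤ c)
    (hνc : ∀ i, ∫⁻ y, M.deviation x y ∂(ν i) ≤ c) (m : ℕ) :
    ∫⁻ σ, liminf (fun n => edist (M.approx x σ (n + m)) (M.approx x σ m)) atTop ∂Λ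
      ≤ 2 * ENNReal.ofReal a ^ (m + 1) * c := by
  refine (lintegral_liminf_le fun n => measurable_edist_approx _ _).trans ?_
  refine liminf_le_of_le (by isBoundedDefault) fun B hB => ?_
  obtain ⟨n, hn⟩ := hB.exists
  refine hn.trans ((h.lintegral_edist_approx_le hν hc hx hac hνc n m).trans ?_)
  rw [two_mul]
  gcongr ?_ * c
  refine add_le_add_left ?_ _
  exact pow_le_pow_right_of_le_one' (ENNReal.ofReal_le_one.2 ha.le) (by omega)

/-- The approximations converge almost surely, as the sum of the distances between successive ones
has a finite integral. -/
theorem ae_mem_codingDomain [CompleteSpace X] (h : M.IsLimitState 𝒰 ν Λ)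
    (hν : ∀ i, IsProbabilityMeasure (ν i)) (ha : a < 1) (hc : M.IsContractive a)
    (hx : ∀ j, x j ∈ M.vset j) (hac : ENNReal.ofReal a * c + M.bConst x ≤ c) (hc_top : c ≠ ∞)
    (hνc : ∀ i, ∫⁻ y, M.deviation x y ∂(ν i) ≤ c) : ∀ᵐ σ ∂Λ, σ ∈ M.codingDomain x := by
  have hA : ENNReal.ofReal a < 1 := ENNReal.ofReal_lt_one.2 ha
  have hint : ∫⁻ σ, ∑' n, edist (M.approx x σ n) (M.approx x σ (n + 1)) ∂Λ ≠ ∞ := by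
    rw [lintegral_tsum fun n => (measurable_edist_approx _ _).aemeasurable]
    refine ne_top_of_le_ne_top (b := ∑' n, ENNReal.ofReal a ^ n * (2 * c)) ?_ ?_
    · rw [ENNReal.tsum_mul_right, ENNReal.tsum_geometric]
      refine ENNReal.mul_ne_top ?_ (ENNReal.mul_ne_top ENNReal.ofNat_ne_top hc_top)
      exact ENNReal.inv_ne_top.2 (tsub_pos_of_lt hA).ne'
    · refine ENNReal.tsum_le_tsum fun n => ?_
      have := h.lintegral_edist_approx_le hν hc hx hac hνc 1 n
      rw [add_comm 1 n] at this
      simp only [edist_comm (M.approx x _ n)]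
      refine this.trans ?_
      calc _ ≤ (ENNReal.ofReal a ^ n + ENNReal.ofReal a ^ n) * c := by
            gcongr ?_ * c
            exact add_le_add (pow_le_pow_right_of_le_one' hA.le (by omega))
              (pow_le_pow_right_of_le_one' hA.le (by omega))
        _ = _ := by ring
  have hmeas : Measurable fun σ => ∑' n, edist (M.approx x σ n) (M.approx x σ (n + 1)) :=
    Measurable.tsum fun n => measurable_edist_approx _ _
  filter_upwards [h.ae_mem_pathSpace, ae_lt_top hmeas hint] with σ h1 h2
  exact ⟨h1, cauchySeq_tendsto_of_complete (cauchySeq_of_edist_le_of_tsum_ne_top _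
    (fun n => le_rfl) h2.ne)⟩

end Convergence

section Conditional

variable {X E V ι : Type*} [MetricSpace X] [MeasurableSpace X] [OpensMeasurableSpace X]
  [Countable V] [Countable E] {M : MarkovSystem X E V} {x : V → X} {a : ℝ} {c : ℝ≥0∞}
  {𝒰 : Filter ι} [𝒰.NeBot] {ν : ι → Measure X} {Λ : Measure (BiCode E)}

/-- On events of the recent past, the probability that the next edge is `e` is nearly the integral
of `p_e` at the approximation `M.approx x σ N`. -/
theorem exists_measure_inter_le (h : M.IsLimitState 𝒰 ν Λ)
    (hν : ∀ i, IsProbabilityMeasure (ν i)) (hc : M.IsContractive a)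
    (hx : ∀ j, x j ∈ M.vset j) (hu : M.IsUniformlyContinuous)
    (hνc : ∀ i, ∫⁻ y, M.deviation x y ∂(ν i) ≤ c) (e : E) {ε : ℝ≥0∞} (hε : ε ≠ 0) :
    ∃ K : ℝ≥0∞, K ≠ ∞ ∧ ∀ (N : ℕ) (B : Set (Fin (N + 1) → Letter E)),
      Λ (window (-N) (N + 1) ⁻¹' B ∩ cyl 1 [Letter.edge e])
        ≤ ∫⁻ σ in window (-N) (N + 1) ⁻¹' B, ENNReal.ofReal (M.p e (M.approx x σ N)) ∂Λ +
          (ε + K * (ENNReal.ofReal a ^ (N + 1) * c)) ∧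
      ∫⁻ σ in window (-N) (N + 1) ⁻¹' B, ENNReal.ofReal (M.p e (M.approx x σ N)) ∂Λ
        ≤ Λ (window (-N) (N + 1) ⁻¹' B ∩ cyl 1 [Letter.edge e]) +
          (ε + K * (ENNReal.ofReal a ^ (N + 1) * c)) := by
  have := h.isProbabilityMeasure
  obtain ⟨K, hK, hclose⟩ := hc.exists_wordLaw_snoc_le hx hu e hε
  refine ⟨K, hK, fun N B => ?_⟩
  set A := window (-N) (N + 1) ⁻¹' B
  have hAm : MeasurableSet A := measurable_window _ _ .of_discrete
  let D : ℝ≥0∞ := ε + K * (ENNReal.ofReal a ^ (N + 1) * c)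
  let I : (Fin (N + 1) → E) → ℝ≥0∞ := fun u => B.indicator 1 (Letter.edge ∘ u)
  let r : (Fin (N + 1) → E) → ℝ≥0∞ := fun u => ENNReal.ofReal (M.p e (M.wordPoint x (List.ofFn u)))
  let P : (Fin (N + 1) → E) → ℝ≥0∞ := fun u => Λ (cyl (-N) ((List.ofFn u).map Letter.edge))
  let Q : (Fin (N + 1) → E) → ℝ≥0∞ :=
    fun u => Λ (cyl (-N) ((List.ofFn u ++ [e]).map Letter.edge))
  have hI : ∀ u, ∀ σ ∈ cyl (-N) ((List.ofFn u).map Letter.edge),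
      A.indicator (1 : BiCode E → ℝ≥0∞) σ = I u := by
    intro u σ hσ
    rw [mem_cyl_map_edge_ofFn] at hσ
    simp only [I, ← hσ]
    rfl
  have hI1 : ∀ u, I u ≤ 1 := fun u => indicator_le_self' (by simp) _
  have h1 : Λ (A ∩ cyl 1 [Letter.edge e]) = ∑' u, Q u * I u := by
    have hedge : EdgeValued (Λ.restrict (cyl 1 [Letter.edge e])) := ae_restrict_of_ae h.edgeValued
    rw [← Measure.restrict_apply hAm, ← lintegral_indicator_one hAm,
      hedge.lintegral_eq_tsum (-N) (N + 1) hI]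
    refine tsum_congr fun u => ?_
    rw [Measure.restrict_apply (measurableSet_cyl _ _)]
    simp only [Q, List.map_append]
    congr 2
    ext σ
    rw [mem_cyl_append, mem_inter_iff]
    have : -(N : ℤ) + ((List.ofFn u).map Letter.edge).length = 1 := by simp
    rw [this]
    rfl
  have h2 : ∫⁻ σ in A, ENNReal.ofReal (M.p e (M.approx x σ N)) ∂Λ = ∑' u, P u * (I u * r u) := by
    rw [← lintegral_indicator hAm]
    refine h.edgeValued.lintegral_eq_tsum (-N) (N + 1) fun u σ hσ => ?_
    rw [← hI u σ hσ]
    simp only [r, ← approx_eq_wordPoint (x := x) (M := M) (l := List.ofFn u) (by simp) hσ]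
    by_cases hσA : σ ∈ A <;> simp [hσA]
  have hfin : ∀ l, Λ (cyl (-N) l) ≠ ∞ := fun l => measure_ne_top _ _
  have hr : ∀ u, r u ≠ ∞ := fun u => ENNReal.ofReal_ne_top
  have hPl : ∀ u, Tendsto (fun i => M.wordLaw (ν i) (List.ofFn u) * r u) 𝒰 (𝓝 (P u * r u)) :=
    fun u => ENNReal.Tendsto.mul_const (h.tendsto_wordLaw _ _) (Or.inr (hr u))
  have hQl : ∀ u, Tendsto (fun i => M.wordLaw (ν i) (List.ofFn u ++ [e])) 𝒰 (𝓝 (Q u)) :=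
    fun u => h.tendsto_wordLaw _ _
  have hsub1 : ∑' u, (Q u - P u * r u) ≤ D := by
    refine tsum_le_of_tendsto (𝒰 := 𝒰) (fun u => ENNReal.Tendsto.sub (hQl u) (hPl u)
      (Or.inl (hfin _))) fun i => ?_
    obtain ⟨t, ht, htu⟩ := hclose c (ν i) (hν i) (hνc i) (N + 1) N.succ_ne_zero
    exact (ENNReal.tsum_le_tsum fun u => tsub_le_iff_left.2 (htu u).1).trans ht
  have hsub2 : ∑' u, (P u * r u - Q u) ≤ D := by
    refine tsum_le_of_tendsto (𝒰 := 𝒰) (fun u => ENNReal.Tendsto.sub (hPl u) (hQl u)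
      (Or.inr (hfin _))) fun i => ?_
    obtain ⟨t, ht, htu⟩ := hclose c (ν i) (hν i) (hνc i) (N + 1) N.succ_ne_zero
    exact (ENNReal.tsum_le_tsum fun u => tsub_le_iff_left.2 (htu u).2).trans ht
  rw [h1, h2]
  constructor
  · refine le_trans ?_ (add_le_add_right hsub1 _)
    rw [← ENNReal.tsum_add]
    refine ENNReal.tsum_le_tsum fun u => ?_
    calc Q u * I u ≤ (P u * r u + (Q u - P u * r u)) * I u := by
          gcongr
          exact le_add_tsub
      _ ≤ P u * (I u * r u) + (Q u - P u * r u) * 1 := by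
          rw [add_mul]
          refine add_le_add (le_of_eq (by ring)) (by gcongr; exact hI1 u)
      _ = _ := by rw [mul_one]
  · refine le_trans ?_ (add_le_add_right hsub2 _)
    rw [← ENNReal.tsum_add]
    refine ENNReal.tsum_le_tsum fun u => ?_
    calc P u * (I u * r u) = P u * r u * I u := by ring
      _ ≤ (Q u + (P u * r u - Q u)) * I u := by
          gcongr
          exact le_add_tsub
      _ ≤ Q u * I u + (P u * r u - Q u) * 1 := by
          rw [add_mul]
          gcongr
          exact hI1 u
      _ = _ := by rw [mul_one]

/-- The conditional probability of the next edge given the past. On an event determined by finitely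
many coordinates it is the limit of the estimate for approximations of growing index. -/
theorem measure_inter_eq_lintegral [CompleteSpace X] (h : M.IsLimitState 𝒰 ν Λ)
    (hν : ∀ i, IsProbabilityMeasure (ν i)) (ha : a < 1) (hc : M.IsContractive a)
    (hx : ∀ j, x j ∈ M.vset j) (hu : M.IsUniformlyContinuous)
    (hac : ENNReal.ofReal a * c + M.bConst x ≤ c) (hc_top : c ≠ ∞)
    (hνc : ∀ i, ∫⁻ y, M.deviation x y ∂(ν i) ≤ c) (e : E) {s : Set (BiCode E)}
    (hs : MeasurableSet[past E] s) :
    Λ (s ∩ cyl 1 [Letter.edge e]) = ∫⁻ σ in s, ENNReal.ofReal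
      ((M.arrival (M.src e)).indicator (fun σ => M.pBar e (M.codingMap x σ)) σ) ∂Λ := by
  have := h.isProbabilityMeasure
  have hA1 : ENNReal.ofReal a < 1 := ENNReal.ofReal_lt_one.2 ha
  set G : BiCode E → ℝ≥0∞ := fun σ => ENNReal.ofReal
    ((M.arrival (M.src e)).indicator (fun σ => M.pBar e (M.codingMap x σ)) σ)
  have hsm := past_le s hs
  rw [← Measure.restrict_apply hsm, ← withDensity_apply _ hsm]
  refine measure_eq_of_past (fun n B => ?_) hs
  have hAm : MeasurableSet (window (-n) (n + 1) ⁻¹' B : Set (BiCode E)) :=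
    measurable_window _ _ .of_discrete
  rw [Measure.restrict_apply hAm, withDensity_apply _ hAm]
  have hlim : Tendsto (fun N => ∫⁻ σ in window (-n) (n + 1) ⁻¹' B,
      ENNReal.ofReal (M.p e (M.approx x σ N)) ∂Λ) atTop
      (𝓝 (∫⁻ σ in window (-n) (n + 1) ⁻¹' B, G σ ∂Λ)) := by
    refine tendsto_lintegral_of_dominated_convergence (fun _ => 1) (fun N => ?_) (fun N => ?_) ?_ ?_
    · exact (measurable_approx_past (fun y => ENNReal.ofReal (M.p e y)) N).mono past_le le_rfl
    · exact ae_of_all _ fun σ => ENNReal.ofReal_le_one.2 (M.p_mem_Icc e _).2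
    · simp
    · refine ae_restrict_of_ae ?_
      filter_upwards [h.ae_mem_codingDomain hν ha hc hx hac hc_top hνc] with σ hσ
      exact ENNReal.tendsto_ofReal (hu.tendsto_p_approx hx e hσ)
  have herr : ∀ ε K : ℝ≥0∞, K ≠ ∞ → Tendsto (fun N : ℕ =>
      ε + K * (ENNReal.ofReal a ^ (N + 1) * c)) atTop (𝓝 ε) := by
    intro ε K hK
    have h1 : Tendsto (fun N : ℕ => ENNReal.ofReal a ^ (N + 1)) atTop (𝓝 0) :=
      (ENNReal.tendsto_pow_atTop_nhds_zero_of_lt_one hA1).comp (tendsto_add_atTop_nat 1)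
    have h2 := ENNReal.Tendsto.const_mul (a := K)
      (ENNReal.Tendsto.mul_const (b := c) h1 (Or.inr hc_top)) (Or.inr hK)
    simpa using h2.const_add ε
  have hB : ∀ N : ℕ, n ≤ N → ∃ B' : Set (Fin (N + 1) → Letter E),
      window (-N) (N + 1) ⁻¹' B' = (window (-n) (n + 1) ⁻¹' B : Set (BiCode E)) := by
    intro N hN
    obtain ⟨B', -, hB'⟩ := comap_window_mono (E := E) (z := -n) (z' := -N) (n := n + 1)
      (n' := N + 1) (by omega) (by push_cast; omega) _ ⟨B, .of_discrete, rfl⟩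
    exact ⟨B', hB'⟩
  refine le_antisymm ?_ ?_
  · refine ENNReal.le_of_forall_pos_le_add fun ε hε _ => ?_
    obtain ⟨K, hK, hKN⟩ := h.exists_measure_inter_le hν hc hx hu hνc e (ε := ε) (by positivity)
    refine ge_of_tendsto (hlim.add (herr ε K hK)) ?_
    filter_upwards [eventually_ge_atTop n] with N hN
    obtain ⟨B', hB'⟩ := hB N hN
    rw [← hB']
    exact (hKN N B').1
  · refine ENNReal.le_of_forall_pos_le_add fun ε hε _ => ?_
    obtain ⟨K, hK, hKN⟩ := h.exists_measure_inter_le hν hc hx hu hνc e (ε := ε) (by positivity)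
    refine le_of_tendsto_of_tendsto hlim ((herr ε K hK).const_add _) ?_
    filter_upwards [eventually_ge_atTop n] with N hN
    obtain ⟨B', hB'⟩ := hB N hN
    rw [← hB']
    exact (hKN N B').2

/-- Limits of chains with bounded mean deviation are asymptotic states. -/
theorem mem_asymptoticStates [CompleteSpace X] (h : M.IsLimitState 𝒰 ν Λ)
    (hν : ∀ i, IsProbabilityMeasure (ν i)) (ha : a < 1) (hc : M.IsContractive a)
    (hx : ∀ j, x j ∈ M.vset j) (hu : M.IsUniformlyContinuous)
    (hac : ENNReal.ofReal a * c + M.bConst x ≤ c) (hc_top : c ≠ ∞)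
    (hνc : ∀ i, ∫⁻ y, M.deviation x y ∂(ν i) ≤ c) : Λ ∈ M.asymptoticStates x := by
  have := h.isProbabilityMeasure
  have hD := h.ae_mem_codingDomain hν ha hc hx hac hc_top hνc
  refine ⟨⟨h.isProbabilityMeasure, h.map_shift⟩, (prob_compl_eq_zero_iff
    measurableSet_codingDomain).1 hD, fun e => ?_⟩
  set g : BiCode E → ℝ :=
    (M.arrival (M.src e)).indicator fun σ => M.pBar e (M.codingMap x σ)
  have hlim : ∀ᵐ σ ∂Λ, Tendsto (fun n => M.p e (M.approx x σ n)) atTop (𝓝 (g σ)) :=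
    hD.mono fun σ hσ => hu.tendsto_p_approx hx e hσ
  have hg0 : ∀ᵐ σ ∂Λ, 0 ≤ g σ :=
    hlim.mono fun σ hσ => ge_of_tendsto' hσ fun n => (M.p_mem_Icc e _).1
  have hg1 : ∀ᵐ σ ∂Λ, g σ ≤ 1 :=
    hlim.mono fun σ hσ => le_of_tendsto' hσ fun n => (M.p_mem_Icc e _).2
  -- the limit of past-measurable functions is past-measurable up to null sets
  have hgm : AEStronglyMeasurable[past E] g Λ := by
    refine ⟨fun σ => (limsup (fun n => ENNReal.ofReal (M.p e (M.approx x σ n))) atTop).toReal,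
      ?_, ?_⟩
    · refine Measurable.stronglyMeasurable ?_
      exact ENNReal.measurable_toReal.comp (Measurable.limsup fun n =>
        measurable_approx_past (fun y => ENNReal.ofReal (M.p e y)) n)
    · filter_upwards [hlim, hg0] with σ h1 h2
      rw [(ENNReal.tendsto_ofReal h1).limsup_eq, ENNReal.toReal_ofReal h2]
  have hgi : Integrable g Λ := by
    refine Integrable.mono' (integrable_const (1 : ℝ)) (hgm.mono past_le) ?_
    filter_upwards [hg0, hg1] with σ h1 h2
    rwa [Real.norm_of_nonneg h1]
  refine (ae_eq_condExp_of_forall_setIntegral_eq past_le ?_ (fun s _ _ => hgi.integrableOn) ?_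
    hgm).symm
  · exact (integrable_const (1 : ℝ)).indicator (measurableSet_cyl _ _)
  · intro s hs _
    rw [setIntegral_indicator (measurableSet_cyl _ _),
      integral_eq_lintegral_of_nonneg_ae (ae_restrict_of_ae hg0)
        (hgm.mono past_le).restrict,
      ← h.measure_inter_eq_lintegral hν ha hc hx hu hac hc_top hνc e hs]
    simp [measureReal_def]

end Conditional

end IsLimitState

end MarkovSystem

/-! ### Existence of limit states -/

namespace MarkovSystem

section Existence

variable {X E V ι : Type*} [MeasurableSpace X] {M : MarkovSystem X E V}

/-- Limits of chain laws exist along an ultrafilter if the initial distributions are asymptotically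
invariant and no mass escapes to `∞`. Tightness gives consistency of the limits under extension of
words to the left, whence for each length they add up to one, and then Fatou's inequality for
extensions to the right has to be an equality. -/
theorem exists_isLimitState [Countable E] (𝒰 : Ultrafilter ι) {ν : ι → Measure X}
    (hν : ∀ i, IsProbabilityMeasure (ν i))
    (hinv : ∀ (l : List E) (r : ℝ≥0∞), Tendsto (fun i => M.wordLaw (ν i) l) 𝒰 (𝓝 r) →
      Tendsto (fun i => M.wordLaw (M.adjointOp (ν i)) l) 𝒰 (𝓝 r))
    (htight : ∀ ε : ℝ≥0∞, ε ≠ 0 → ∃ C : Finset E, ∀ i, 1 ≤ ∑ e ∈ C, M.wordLaw (ν i) [e] + ε) :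
    ∃ Λ, M.IsLimitState 𝒰 ν Λ := by
  have hlim : ∀ l : List E, ∃ r, Tendsto (fun i => M.wordLaw (ν i) l) 𝒰 (𝓝 r) := fun l =>
    ⟨(𝒰.map fun i => M.wordLaw (ν i) l).lim, (𝒰.map fun i => M.wordLaw (ν i) l).le_nhds_lim⟩
  choose m hm using hlim
  have hm0 : m [] = 1 := by
    refine tendsto_nhds_unique (hm []) ?_
    simp only [fun i => haveI := hν i; M.wordLaw_nil (ν i)]
    exact tendsto_const_nhds
  have hleft : ∀ l, ∑' e, m (e :: l) = m l := by
    intro l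
    refine le_antisymm ?_ (ENNReal.le_of_forall_pos_le_add fun ε hε _ => ?_)
    · rw [ENNReal.tsum_eq_iSup_sum]
      refine iSup_le fun s => le_of_tendsto_of_tendsto' (tendsto_finsetSum s fun e _ => hm (e :: l))
        (hinv l _ (hm l)) fun i => ?_
      rw [← M.tsum_wordLaw_cons]
      exact ENNReal.sum_le_tsum s
    · obtain ⟨C, hC⟩ := htight ε (by positivity)
      calc m l ≤ ∑ e ∈ C, m (e :: l) + ε := by
            refine le_of_tendsto_of_tendsto' (hinv l _ (hm l))
              ((tendsto_finsetSum C fun e _ => hm (e :: l)).add_const _) fun i => ?_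
            have := hν i
            rw [← M.tsum_wordLaw_cons, ← ENNReal.sum_add_tsum_compl C]
            gcongr
            have h1 : ∑' e, M.wordLaw (ν i) [e] = 1 := by
              simpa [M.wordLaw_nil] using M.tsum_wordLaw_snoc (ν i) []
            have h2 := hC i
            rw [← h1, ← ENNReal.sum_add_tsum_compl C] at h2
            refine le_trans (ENNReal.tsum_le_tsum fun e => M.wordLaw_append_le (ν i) [e.1] l) ?_
            refine (ENNReal.add_le_add_iff_left ?_).1 h2
            exact ENNReal.sum_ne_top.2 fun e _ =>
              ne_top_of_le_ne_top ENNReal.one_ne_top (M.wordLaw_le_one _ _)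
        _ ≤ _ := by
            gcongr
            exact ENNReal.sum_le_tsum C
  have htotal : ∀ n : ℕ, ∑' u : Fin n → E, m (List.ofFn u) = 1 := by
    intro n
    induction n with
    | zero => rw [tsum_word_zero m, hm0]
    | succ n ih =>
      rw [tsum_word_cons n m, ENNReal.tsum_comm, ← ih]
      exact tsum_congr fun u => hleft _
  have hright_le : ∀ l, ∑' e, m (l ++ [e]) ≤ m l := by
    intro l
    rw [ENNReal.tsum_eq_iSup_sum]
    refine iSup_le fun s => le_of_tendsto_of_tendsto' (tendsto_finsetSum s fun e _ => hm (l ++ [e]))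
      (hm l) fun i => ?_
    rw [← M.tsum_wordLaw_snoc (ν i) l]
    exact ENNReal.sum_le_tsum s
  have hright : ∀ l, ∑' e, m (l ++ [e]) = m l := by
    intro l
    by_contra hne
    have hsum : ∑' (u : Fin l.length → E) (e : E), m (List.ofFn u ++ [e]) = 1 := by
      rw [← tsum_word_snoc, htotal]
    have hlt := ENNReal.tsum_lt_tsum (i := l.get) (by rw [hsum]; exact ENNReal.one_ne_top)
      (fun u => hright_le (List.ofFn u))
      (by rw [List.ofFn_get]; exact lt_of_le_of_ne (hright_le l) hne)
    rw [hsum, htotal] at hlt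
    exact lt_irrefl _ hlt
  obtain ⟨Λ, hΛ, hedge, hcyl⟩ := exists_measure_biWord m hm0 hright hleft
  exact ⟨Λ, hΛ, hedge, fun z l => by rw [hcyl]; exact hm l⟩

theorem exists_finset_one_le_sum [Countable E] (μ : Measure X) [IsProbabilityMeasure μ] {ε : ℝ≥0∞}
    (hε : ε ≠ 0) : ∃ C : Finset E, 1 ≤ ∑ e ∈ C, M.wordLaw μ [e] + ε := by
  have h1 : ∑' e, M.wordLaw μ [e] = 1 := by
    simpa [M.wordLaw_nil] using M.tsum_wordLaw_snoc μ []
  have h2 : 1 - ε < ∑' e, M.wordLaw μ [e] := by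
    rw [h1]
    exact ENNReal.sub_lt_self ENNReal.one_ne_top one_ne_zero hε
  rw [ENNReal.tsum_eq_iSup_sum, lt_iSup_iff] at h2
  obtain ⟨C, hC⟩ := h2
  exact ⟨C, tsub_le_iff_right.1 hC.le⟩

theorem wordProb_eq_zero {l : List (Letter E)}
    (hl : ∃ s ∈ l, s ∉ range (Letter.edge : E → Letter E)) (y : X) : M.wordProb l y = 0 := by
  induction l generalizing y with
  | nil => simp at hl
  | cons s l ih =>
    rw [wordProb]
    by_cases hs : s ∈ range (Letter.edge : E → Letter E)
    · obtain ⟨t, ht, hne⟩ := hl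
      rcases List.mem_cons.1 ht with rfl | ht
      · exact absurd hs hne
      · rw [ih ⟨t, ht, hne⟩, mul_zero]
    · have : s = Letter.infty := by
        induction s using OnePoint.rec with
        | infty => rfl
        | coe e => exact absurd ⟨e, rfl⟩ hs
      rw [this, pExt, Letter.extend_infty, Pi.zero_apply, ENNReal.ofReal_zero, zero_mul]

/-! ### The measures `Φ(μ)` -/

theorem IsLimitState.isCodeMeasure {μ : Measure X} {Λ : Measure (BiCode E)} {𝒰 : Filter ι}
    [𝒰.NeBot] (h : M.IsLimitState 𝒰 (fun _ => μ) Λ) : M.IsCodeMeasure μ Λ := by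
  refine ⟨h.isProbabilityMeasure, fun z _ l => ?_⟩
  rcases exists_eq_map_edge_or l with ⟨l, rfl⟩ | hl
  · simp only [wordProb_map_edge]
    exact tendsto_nhds_unique (h.tendsto_wordLaw z l) tendsto_const_nhds
  · simp [h.edgeValued.measure_cyl_eq_zero hl, wordProb_eq_zero hl]

theorem IsCodeMeasure.eq_Phi [Countable E] {μ : Measure X} {Λ : Measure (BiCode E)}
    (h : M.IsCodeMeasure μ Λ) : Λ = M.Phi μ := by
  have hex : ∃ Λ, M.IsCodeMeasure μ Λ := ⟨Λ, h⟩
  rw [Phi, dif_pos hex]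
  have := h.1
  exact ext_of_cyl 0 fun z hz l => by rw [h.2 z hz l, hex.choose_spec.2 z hz l]

theorem isLimitState_Phi [Countable E] {μ : Measure X} (hμ : μ ∈ M.invariantMeasures) :
    M.IsLimitState (pure () : Filter Unit) (fun _ => μ) (M.Phi μ) := by
  have := hμ.1
  obtain ⟨Λ, hΛ⟩ := exists_isLimitState (M := M) (pure () : Ultrafilter Unit) (ν := fun _ => μ)
    (fun _ => hμ.1) (fun l r h => by simpa only [hμ.2] using h)
    (fun ε hε => (exists_finset_one_le_sum μ hε).imp fun C hC _ => hC)
  rw [Ultrafilter.coe_pure] at hΛ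
  rwa [← hΛ.isCodeMeasure.eq_Phi]

theorem Phi_cyl [Countable E] {μ : Measure X} (hμ : μ ∈ M.invariantMeasures) (z : ℤ) (l : List E) :
    M.Phi μ (cyl z (l.map Letter.edge)) = M.wordLaw μ l :=
  tendsto_nhds_unique ((isLimitState_Phi hμ).tendsto_wordLaw z l) tendsto_const_nhds

theorem lintegral_comp_approx_Phi [Countable E] {x : V → X} {μ : Measure X}
    (hμ : μ ∈ M.invariantMeasures) (f : X → ℝ≥0∞) (n : ℕ) :
    ∫⁻ σ, f (M.approx x σ n) ∂(M.Phi μ) = ∫⁻ y, ∑' u : Fin (n + 1) → E,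
      M.pathProb (List.ofFn u) y * f (M.wordPoint x (List.ofFn u)) ∂μ := by
  rw [(isLimitState_Phi hμ).edgeValued.lintegral_eq_tsum (-n) (n + 1)
    (f := fun u => f (M.wordPoint x (List.ofFn u)))
    fun u σ hσ => by rw [approx_eq_wordPoint (by simp) hσ]]
  rw [lintegral_tsum fun u => ((M.measurable_pathProb _).mul_const _).aemeasurable]
  refine tsum_congr fun u => ?_
  rw [Phi_cyl hμ, lintegral_mul_const _ (M.measurable_pathProb _), wordLaw]

theorem exists_isPathMeasure [Countable E] (y : X) : ∃ P, M.IsPathMeasure y P := by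
  let _ : MeasurableSpace E := ⊤
  have : DiscreteMeasurableSpace E := ⟨fun _ => trivial⟩
  obtain ⟨P, hP, hcyl⟩ := exists_measure_posWord (fun l => M.pathProb l y) rfl (fun l => by
    simp only [pathProb_append, ENNReal.tsum_mul_left, pathProb, mul_one, M.tsum_ofReal_p])
  have hmeas : Measurable fun (τ : ℕ → E) (k : ℕ) => (Letter.edge (τ k) : Letter E) :=
    measurable_pi_lambda _ fun k => (measurable_of_countable _).comp (measurable_pi_apply k)
  have hpos : ∀ l : List (Letter E), MeasurableSet (posCyl l) := by
    intro l
    have : posCyl l = ⋂ (k : ℕ) (hk : k < l.length), (fun σ : PosCode E => σ k) ⁻¹' {l[k]} := by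
      ext σ
      simp [posCyl]
    rw [this]
    exact .iInter fun k => .iInter fun hk => measurable_pi_apply k .of_discrete
  refine ⟨P.map fun τ k => Letter.edge (τ k), Measure.isProbabilityMeasure_map hmeas.aemeasurable,
    fun l => ?_⟩
  rw [Measure.map_apply hmeas (hpos l)]
  rcases exists_eq_map_edge_or l with ⟨l, rfl⟩ | hl
  · rw [wordProb_map_edge, ← hcyl l]
    congr 1
    ext τ
    simp [posCyl, Letter.edge_injective.eq_iff]
  · rw [wordProb_eq_zero hl]
    obtain ⟨s, hs, hne⟩ := hl
    obtain ⟨k, hk, rfl⟩ := List.getElem_of_mem hs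
    convert measure_empty (μ := P)
    refine eq_empty_of_forall_notMem fun τ hτ => hne ?_
    rw [← hτ k hk]
    exact mem_range_self _

theorem pathMeasure_posCyl [Countable E] (y : X) (l : List E) :
    M.pathMeasure y (posCyl (l.map Letter.edge)) = M.pathProb l y := by
  have h := M.exists_isPathMeasure y
  rw [pathMeasure, dif_pos h, h.choose_spec.2, wordProb_map_edge]

end Existence

section Image

variable {X E V : Type*} [MetricSpace X] [CompleteSpace X] [MeasurableSpace X] [BorelSpace X]
  [Countable V] [Countable E] {M : MarkovSystem X E V} {x : V → X} {a : ℝ} {c : ℝ≥0∞}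

/-- The coding map takes `Φ(μ)` to `μ`: after many steps the chain started from `μ` is close to the
point determined by the word it has followed. -/
theorem map_codingMap_Phi (ha : a < 1) (hc : M.IsContractive a) (hx : ∀ j, x j ∈ M.vset j)
    (hac : ENNReal.ofReal a * c + M.bConst x ≤ c) (hc_top : c ≠ ∞) {μ : Measure X}
    (hμ : μ ∈ M.invariantMeasures) : (M.Phi μ).map (M.codingMap x) = μ := by
  have hprob := hμ.1
  have hstate := isLimitState_Phi hμ
  have hprobΦ := hstate.isProbabilityMeasure
  have hA1 : ENNReal.ofReal a < 1 := ENNReal.ofReal_lt_one.2 ha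
  have hdev : ∫⁻ y, M.deviation x y ∂μ ≤ c := hc.lintegral_deviation_le_of_invariant ha hx hac hμ
  have hD := hstate.ae_mem_codingDomain (fun _ => hμ.1) ha hc hx hac hc_top (fun _ => hdev)
  have hF : AEMeasurable (M.codingMap x) (M.Phi μ) := aemeasurable_codingMap hD
  have hlip : ∀ (f : X → ℝ≥0∞) (K : ℝ≥0∞), Continuous f → (∀ y, f y ≤ 1) → K ≠ ∞ →
      (∀ y z, f y ≤ f z + K * edist y z) → ∫⁻ σ, f (M.codingMap x σ) ∂(M.Phi μ) = ∫⁻ y, f y ∂μ := by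
    intro f K hf hf1 hK hfK
    have hfm := hf.measurable
    have hlim : Tendsto (fun n => ∫⁻ σ, f (M.approx x σ n) ∂(M.Phi μ)) atTop
        (𝓝 (∫⁻ σ, f (M.codingMap x σ) ∂(M.Phi μ))) := by
      refine tendsto_lintegral_of_dominated_convergence (fun _ => 1)
        (fun n => hfm.comp (measurable_approx n)) (fun n => ae_of_all _ fun σ => hf1 _) (by simp) ?_
      filter_upwards [hD] with σ hσ
      exact (hf.tendsto _).comp (tendsto_approx_codingMap hσ)
    have herr : Tendsto (fun n : ℕ => K * (ENNReal.ofReal a ^ (n + 1) * c)) atTop (𝓝 0) := by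
      have h1 : Tendsto (fun N : ℕ => ENNReal.ofReal a ^ (N + 1)) atTop (𝓝 0) :=
        (ENNReal.tendsto_pow_atTop_nhds_zero_of_lt_one hA1).comp (tendsto_add_atTop_nat 1)
      have h2 := ENNReal.Tendsto.const_mul (a := K)
        (ENNReal.Tendsto.mul_const (b := c) h1 (Or.inr hc_top)) (Or.inr hK)
      simpa using h2
    let d : ℕ → X → ℝ≥0∞ := fun n y => ∑' u : Fin (n + 1) → E, M.pathProb (List.ofFn u) y *
      edist (M.wordMap (List.ofFn u) y) (M.wordPoint x (List.ofFn u))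
    have hdm : ∀ n, Measurable (d n) := fun n => Measurable.tsum fun u =>
      (M.measurable_pathProb _).mul (measurable_edist_left.comp (M.measurable_wordMap _))
    have hd : ∀ n, ∫⁻ y, K * d n y ∂μ ≤ K * (ENNReal.ofReal a ^ (n + 1) * c) := by
      intro n
      rw [lintegral_const_mul _ (hdm n)]
      gcongr
      refine (lintegral_mono fun y => hc.tsum_wordPoint_le hx n.succ_ne_zero y).trans ?_
      rw [lintegral_const_mul _ (M.measurable_deviation x)]
      gcongr
    have hμf : ∀ n, ∫⁻ y, f y ∂μ = ∫⁻ y, ∑' u : Fin (n + 1) → E,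
        M.pathProb (List.ofFn u) y * f (M.wordMap (List.ofFn u) y) ∂μ := by
      intro n
      rw [← M.lintegral_adjointOp_iterate μ (n + 1) hfm, adjointOp_iterate_of_mem hμ]
    refine le_antisymm ?_ ?_
    · refine le_of_tendsto_of_tendsto' hlim (by simpa using herr.const_add _) fun n => ?_
      refine le_trans ?_ (add_le_add_right (hd n) _)
      rw [lintegral_comp_approx_Phi hμ, hμf n, ← lintegral_add_right _ ((hdm n).const_mul K)]
      refine lintegral_mono fun y => ?_
      simp only [d]
      rw [← ENNReal.tsum_mul_left, ← ENNReal.tsum_add]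
      refine ENNReal.tsum_le_tsum fun u => ?_
      rw [mul_left_comm, ← mul_add, edist_comm]
      gcongr
      exact hfK _ _
    · refine ge_of_tendsto' (by simpa using hlim.add herr) fun n => ?_
      refine le_trans ?_ (add_le_add_right (hd n) _)
      rw [lintegral_comp_approx_Phi hμ, hμf n, ← lintegral_add_right _ ((hdm n).const_mul K)]
      refine lintegral_mono fun y => ?_
      simp only [d]
      rw [← ENNReal.tsum_mul_left, ← ENNReal.tsum_add]
      refine ENNReal.tsum_le_tsum fun u => ?_
      rw [mul_left_comm, ← mul_add]
      gcongr
      exact hfK _ _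
  have : IsProbabilityMeasure ((M.Phi μ).map (M.codingMap x)) := Measure.isProbabilityMeasure_map hF
  -- closed sets are approximated by Lipschitz functions
  refine ext_of_generate_finite {C | IsClosed C} (borel_eq_generateFrom_isClosed (α := X) ▸
    BorelSpace.measurable_eq) isPiSystem_isClosed (fun C hC => ?_) (by simp)
  have hδ : ∀ n : ℕ, (0 : ℝ) < 1 / ((n : ℝ) + 1) := fun n => Nat.one_div_pos_of_nat
  have hind := thickenedIndicator_tendsto_indicator_closure hδ
    tendsto_one_div_add_atTop_nhds_zero_nat C
  rw [IsClosed.closure_eq hC] at hind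
  have hCm : MeasurableSet C := IsClosed.measurableSet hC
  have hlim : ∀ ρ : Measure X, IsFiniteMeasure ρ → Tendsto (fun n : ℕ =>
      ∫⁻ y, (thickenedIndicator (hδ n) C y : ℝ≥0∞) ∂ρ) atTop (𝓝 (ρ C)) := fun ρ _ =>
    measure_of_cont_bdd_of_tendsto_indicator ρ hCm _
      (fun n y => thickenedIndicator_le_one (hδ n) C y) hind
  refine tendsto_nhds_unique (hlim _ inferInstance) ((hlim μ inferInstance).congr fun n => ?_)
  rw [lintegral_map' (by fun_prop) hF]
  refine (hlip _ ((1 / ((n : ℝ) + 1)).toNNReal⁻¹ : ℝ≥0∞) ?_ (fun y => ?_) ?_ ?_).symm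
  · exact ENNReal.continuous_coe.comp (thickenedIndicator (hδ n) C).continuous
  · exact_mod_cast thickenedIndicator_le_one (hδ n) C y
  · simpa using hδ n
  · intro y z
    have h1 := lipschitzWith_thickenedIndicator (hδ n) C y z
    rw [ENNReal.coe_inv (by simpa using hδ n)] at h1
    refine le_trans ?_ (add_le_add_right h1 _)
    rw [edist_nndist, NNReal.nndist_eq]
    exact_mod_cast le_trans le_add_tsub (add_le_add_right (le_max_left _ _) _)

end Image

end MarkovSystem

/-! ### Equilibrium states -/

/-- The right shift. -/
def shiftBack {E : Type*} (σ : BiCode E) : BiCode E := fun i => σ (i - 1)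

theorem shiftBack_shift {E : Type*} (σ : BiCode E) : shiftBack (shift σ) = σ := by
  funext i
  simp [shiftBack, shift]

theorem measurable_shiftBack_past {E : Type*} :
    Measurable[past E, past E] (shiftBack : BiCode E → BiCode E) := by
  refine measurable_iff_comap_le.2 ?_
  rw [MeasurableSpace.comap_iSup]
  refine iSup_le fun i => ?_
  rw [MeasurableSpace.comap_comp]
  exact le_iSup (fun i : {i : ℤ // i ≤ 0} =>
    MeasurableSpace.comap (fun σ : BiCode E => σ i) inferInstance)
    ⟨(i : ℤ) - 1, by have := i.2; omega⟩

theorem measure_cyl_of_map_shift {E : Type*} {Λ : Measure (BiCode E)} (h : Λ.map shift = Λ)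
    (l : List (Letter E)) (z : ℤ) (n : ℕ) : Λ (cyl (z + n) l) = Λ (cyl z l) := by
  induction n with
  | zero => simp
  | succ n ih =>
    rw [← ih]
    conv_rhs => rw [← h]
    rw [Measure.map_apply measurable_shift (measurableSet_cyl _ _), shift_preimage_cyl]
    push_cast
    rw [add_assoc]

namespace MarkovSystem

theorem shift_mem_pathSpace {X E V : Type*} [MeasurableSpace X] {M : MarkovSystem X E V}
    {σ : BiCode E} (h : σ ∈ M.pathSpace) : shift σ ∈ M.pathSpace :=
  ⟨fun n => h.1 (n + 1), fun n => h.2 (n + 1)⟩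

theorem backComp_shift {X E V : Type*} [MeasurableSpace X] {M : MarkovSystem X E V}
    (σ : BiCode E) (n : ℕ) (y : X) :
    M.backComp (shift σ) (n + 1) y = M.wExt (σ 1) (M.backComp σ n y) := by
  induction n generalizing y with
  | zero => simp [backComp, shift]
  | succ n ih =>
    rw [backComp, Function.comp_apply, ih, backComp, Function.comp_apply]
    congr 3

theorem approx_shift {X E V : Type*} [MeasurableSpace X] {M : MarkovSystem X E V} {x : V → X}
    (σ : BiCode E) (n : ℕ) :
    M.approx x (shift σ) (n + 1) = M.wExt (σ 1) (M.approx x σ n) := by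
  rw [approx, backComp_shift, approx]
  congr 4
  simp [shift]

section Equilibrium

variable {X E V : Type*} [MetricSpace X] [MeasurableSpace X] {M : MarkovSystem X E V} {x : V → X}
  {Λ : Measure (BiCode E)}

/-- The coding map intertwines the shift with the maps of the system at sequences whose image lies
in the vertex set of the next edge, and not just in its closure. -/
theorem codingMap_shift (hx : ∀ j, x j ∈ M.vset j) (hu : M.IsUniformlyContinuous) {σ : BiCode E}
    (hσ : σ ∈ M.codingDomain x) {e : E} (he : σ 1 = Letter.edge e)
    (hF : M.codingMap x σ ∈ M.vset (M.src e)) :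
    M.codingMap x (shift σ) = M.w e (M.codingMap x σ) := by
  refine codingMap_eq_of_tendsto (shift_mem_pathSpace hσ.1) ((tendsto_add_atTop_iff_nat 1).1 ?_)
  simp only [approx_shift, he]
  have hsrc : M.src e = M.tgtExt (σ 0) := by
    have := hσ.1.2 0
    rw [zero_add, he] at this
    exact this
  refine ((hu e).1.continuousOn _ hF).tendsto.comp (tendsto_nhdsWithin_iff.2
    ⟨tendsto_approx_codingMap hσ, Eventually.of_forall fun n => ?_⟩)
  rw [hsrc]
  exact approx_mem_vset hx hσ.1 n

variable [CompleteSpace X] [Countable E]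

theorem ae_mem_codingDomain_of_mem (hΛ : Λ ∈ M.equilibriumStates x) :
    ∀ᵐ σ ∂Λ, σ ∈ M.codingDomain x :=
  haveI := hΛ.1.1
  (prob_compl_eq_zero_iff measurableSet_codingDomain).2 hΛ.2.1

theorem edgeValued_of_mem (hΛ : Λ ∈ M.equilibriumStates x) : EdgeValued Λ :=
  (ae_mem_codingDomain_of_mem hΛ).mono fun _ hσ => hσ.1.1

variable [BorelSpace X]

theorem aemeasurable_ofReal_p_codingMap (hΛ : Λ ∈ M.equilibriumStates x) (e : E) :
    AEMeasurable (fun σ => ENNReal.ofReal (M.p e (M.codingMap x σ))) Λ :=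
  (M.p_measurable e).ennreal_ofReal.comp_aemeasurable
    (aemeasurable_codingMap (ae_mem_codingDomain_of_mem hΛ))

theorem measure_inter_of_mem_equilibriumStates (hΛ : Λ ∈ M.equilibriumStates x) (e : E)
    {s : Set (BiCode E)} (hs : MeasurableSet[past E] s) :
    Λ (s ∩ cyl 1 [Letter.edge e]) = ∫⁻ σ in s, ENNReal.ofReal (M.p e (M.codingMap x σ)) ∂Λ := by
  have := hΛ.1.1
  have h1 := setIntegral_condExp (μ := Λ) past_le (f := (cyl 1 [Letter.edge e]).indicator
    fun _ => (1 : ℝ)) ((integrable_const (1 : ℝ)).indicator (measurableSet_cyl _ _)) hs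
  have h2 : ∫ σ in s, M.p e (M.codingMap x σ) ∂Λ = Λ.real (s ∩ cyl 1 [Letter.edge e]) := by
    rw [setIntegral_congr_ae (past_le s hs)
      ((hΛ.2.2 e).mono fun σ h _ => h.symm), h1, setIntegral_indicator (measurableSet_cyl _ _)]
    simp
  have h3 : AEMeasurable (fun σ => M.p e (M.codingMap x σ)) (Λ.restrict s) :=
    ((M.p_measurable e).comp_aemeasurable
      (aemeasurable_codingMap (ae_mem_codingDomain_of_mem hΛ))).restrict
  rw [← ofReal_integral_eq_lintegral_ofReal, h2, ofReal_measureReal]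
  · refine Integrable.mono' (integrable_const (1 : ℝ)) h3.aestronglyMeasurable ?_
    refine ae_of_all _ fun σ => ?_
    rw [Real.norm_of_nonneg (M.p_mem_Icc e _).1]
    exact (M.p_mem_Icc e _).2
  · exact ae_of_all _ fun σ => (M.p_mem_Icc e _).1

/-- The conditional probability of the next edge, tested against functions of the past. -/
theorem setLIntegral_of_mem_equilibriumStates (hΛ : Λ ∈ M.equilibriumStates x) (e : E)
    {h : BiCode E → ℝ≥0∞} (hh : Measurable[past E] h) :
    ∫⁻ σ in cyl 1 [Letter.edge e], h σ ∂Λ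
      = ∫⁻ σ, ENNReal.ofReal (M.p e (M.codingMap x σ)) * h σ ∂Λ := by
  have hm := aemeasurable_ofReal_p_codingMap hΛ e
  have htrim : (Λ.restrict (cyl 1 [Letter.edge e])).trim past_le
      = (Λ.withDensity fun σ => ENNReal.ofReal (M.p e (M.codingMap x σ))).trim past_le := by
    refine @Measure.ext _ (past E) _ _ fun s hs => ?_
    rw [trim_measurableSet_eq past_le hs, trim_measurableSet_eq past_le hs,
      Measure.restrict_apply (past_le s hs), withDensity_apply _ (past_le s hs),
      measure_inter_of_mem_equilibriumStates hΛ e hs]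
  rw [← lintegral_trim past_le hh, htrim, lintegral_trim past_le hh,
    lintegral_withDensity_eq_lintegral_mul₀ hm (hh.mono past_le le_rfl).aemeasurable]
  rfl

/-- Almost surely the image point lies in the vertex set of the next edge, because the latter is
chosen with the probability `p_e`, which vanishes elsewhere. -/
theorem ae_codingMap_shift (hΛ : Λ ∈ M.equilibriumStates x) (hx : ∀ j, x j ∈ M.vset j)
    (hu : M.IsUniformlyContinuous) (e : E) :
    ∀ᵐ σ ∂(Λ.restrict (cyl 1 [Letter.edge e])),
      M.codingMap x (shift σ) = M.w e (M.codingMap x σ) := by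
  have hD := ae_mem_codingDomain_of_mem hΛ
  obtain ⟨F, hFm, hF⟩ := exists_measurable_past_codingMap (M := M) (x := x)
  have hs : MeasurableSet[past E] {σ | M.p e (F σ) = 0} :=
    ((M.p_measurable e).comp hFm) (measurableSet_singleton 0)
  have h0 : Λ ({σ | M.p e (F σ) = 0} ∩ cyl 1 [Letter.edge e]) = 0 := by
    rw [measure_inter_of_mem_equilibriumStates hΛ e hs, ← lintegral_zero (μ := Λ.restrict _)]
    refine setLIntegral_congr_fun_ae (past_le _ hs) ?_
    filter_upwards [hD] with σ hσ h
    rw [hF σ hσ, show M.p e (F σ) = 0 from h, ENNReal.ofReal_zero]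
  rw [ae_restrict_iff' (measurableSet_cyl _ _)]
  filter_upwards [hD, measure_eq_zero_iff_ae_notMem.1 h0] with σ h1 h2 h3
  refine codingMap_shift hx hu h1 (mem_cyl_singleton.1 h3) ?_
  by_contra hne
  refine h2 ⟨?_, h3⟩
  rw [mem_ofPred_eq, ← hF σ h1]
  exact M.p_eq_zero e _ hne

/-- The conditional probability of the next word, tested against functions of the past. The
induction splits off the first edge and shifts, which makes this edge a part of the past. -/
theorem setLIntegral_cyl_of_mem_equilibriumStates (hΛ : Λ ∈ M.equilibriumStates x)
    (hx : ∀ j, x j ∈ M.vset j) (hu : M.IsUniformlyContinuous) (l : List E) {h : BiCode E → ℝ≥0∞}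
    (hh : Measurable[past E] h) :
    ∫⁻ σ in cyl 1 (l.map Letter.edge), h σ ∂Λ = ∫⁻ σ, M.pathProb l (M.codingMap x σ) * h σ ∂Λ := by
  have hD := ae_mem_codingDomain_of_mem hΛ
  obtain ⟨F, hFm, hF⟩ := exists_measurable_past_codingMap (M := M) (x := x)
  have hFae : AEMeasurable (M.codingMap x) Λ := aemeasurable_codingMap hD
  induction l generalizing h with
  | nil => simp [cyl_nil, pathProb]
  | cons e l ih =>
    -- the function `h` seen from the shifted sequence, restricted to `σ_0 = e`
    let k : BiCode E → ℝ≥0∞ := fun τ => (cyl 0 [Letter.edge e]).indicator (h ∘ shiftBack) τ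
    have h0m : MeasurableSet[past E] (cyl 0 [Letter.edge e] : Set (BiCode E)) := by
      have : (cyl 0 [Letter.edge e] : Set (BiCode E)) = (fun σ => σ 0) ⁻¹' {Letter.edge e} := by
        ext σ
        exact mem_cyl_singleton
      rw [this]
      exact le_iSup (fun i : {i : ℤ // i ≤ 0} =>
        MeasurableSpace.comap (fun σ : BiCode E => σ i) inferInstance) ⟨0, le_rfl⟩ _
        ⟨_, .of_discrete, rfl⟩
    have hk : Measurable[past E] k := (hh.comp measurable_shiftBack_past).indicator h0m
    have hkm : Measurable k := hk.mono past_le le_rfl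
    have hkσ : ∀ σ, k (shift σ) = (cyl 1 [Letter.edge e]).indicator h σ := by
      intro σ
      have h1 : shift σ ∈ cyl 0 [Letter.edge e] ↔ σ ∈ cyl 1 [Letter.edge e] := by
        rw [mem_cyl_singleton, mem_cyl_singleton]
        rfl
      by_cases h2 : σ ∈ cyl 1 [Letter.edge e]
      · simp only [k, indicator_of_mem h2, indicator_of_mem (h1.2 h2), Function.comp_apply,
          shiftBack_shift]
      · simp only [k, indicator_of_notMem h2, indicator_of_notMem (mt h1.1 h2)]
    have hPF : AEMeasurable (fun τ => M.pathProb l (M.codingMap x τ) * k τ) Λ :=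
      ((M.measurable_pathProb l).comp_aemeasurable hFae).mul hkm.aemeasurable
    calc ∫⁻ σ in cyl 1 ((e :: l).map Letter.edge), h σ ∂Λ
        = ∫⁻ σ, (cyl 1 (l.map Letter.edge)).indicator k (shift σ) ∂Λ := by
          rw [← lintegral_indicator (measurableSet_cyl _ _)]
          refine lintegral_congr fun σ => ?_
          have h1 : σ ∈ cyl 1 ((e :: l).map Letter.edge) ↔
              shift σ ∈ cyl 1 (l.map Letter.edge) ∧ σ ∈ cyl 1 [Letter.edge e] := by
            rw [List.map_cons, mem_cyl_cons, mem_cyl_singleton, ← shift_preimage_cyl, and_comm]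
            rfl
          by_cases h2 : shift σ ∈ cyl 1 (l.map Letter.edge)
          · rw [indicator_of_mem h2, hkσ]
            by_cases h3 : σ ∈ cyl 1 [Letter.edge e]
            · rw [indicator_of_mem h3, indicator_of_mem (h1.2 ⟨h2, h3⟩)]
            · rw [indicator_of_notMem h3, indicator_of_notMem fun h => h3 (h1.1 h).2]
          · rw [indicator_of_notMem h2, indicator_of_notMem fun h => h2 (h1.1 h).1]
      _ = ∫⁻ τ, (cyl 1 (l.map Letter.edge)).indicator k τ ∂Λ := by
          conv_rhs => rw [← hΛ.1.2]
          rw [lintegral_map (hkm.indicator (measurableSet_cyl _ _)) measurable_shift]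
      _ = ∫⁻ τ, M.pathProb l (M.codingMap x τ) * k τ ∂Λ := by
          rw [lintegral_indicator (measurableSet_cyl _ _), ih hk]
      _ = ∫⁻ σ, M.pathProb l (M.codingMap x (shift σ)) * k (shift σ) ∂Λ := by
          conv_lhs => rw [← hΛ.1.2]
          rw [lintegral_map' (by rw [hΛ.1.2]; exact hPF) measurable_shift.aemeasurable]
      _ = ∫⁻ σ in cyl 1 [Letter.edge e], M.pathProb l (M.w e (F σ)) * h σ ∂Λ := by
          simp only [hkσ]
          rw [← lintegral_indicator (measurableSet_cyl _ _)]
          have h2 := (ae_restrict_iff' (measurableSet_cyl _ _)).1 (ae_codingMap_shift hΛ hx hu e)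
          refine lintegral_congr_ae ?_
          filter_upwards [hD, h2] with σ h3 h4
          by_cases h5 : σ ∈ cyl 1 [Letter.edge e]
          · rw [indicator_of_mem h5, indicator_of_mem h5, h4 h5, hF σ h3]
          · rw [indicator_of_notMem h5, indicator_of_notMem h5, mul_zero]
      _ = ∫⁻ σ, ENNReal.ofReal (M.p e (M.codingMap x σ)) *
            (M.pathProb l (M.w e (F σ)) * h σ) ∂Λ :=
          setLIntegral_of_mem_equilibriumStates hΛ e
            ((((M.measurable_pathProb l).comp (M.w_measurable e)).comp hFm).mul hh)
      _ = _ := by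
          refine lintegral_congr_ae ?_
          filter_upwards [hD] with σ hσ
          rw [← hF σ hσ, pathProb, mul_assoc]

/-- The image of an equilibrium state under the coding map is invariant, because the shift acts on
it as a step of the chain. -/
theorem map_codingMap_mem_invariantMeasures (hΛ : Λ ∈ M.equilibriumStates x)
    (hx : ∀ j, x j ∈ M.vset j) (hu : M.IsUniformlyContinuous) :
    Λ.map (M.codingMap x) ∈ M.invariantMeasures := by
  have := hΛ.1.1
  have hD := ae_mem_codingDomain_of_mem hΛ
  obtain ⟨F, hFm, hF⟩ := exists_measurable_past_codingMap (M := M) (x := x)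
  have hFae : AEMeasurable (M.codingMap x) Λ := aemeasurable_codingMap hD
  refine ⟨Measure.isProbabilityMeasure_map hFae, Measure.ext_of_lintegral _ fun f hf => ?_⟩
  have hUf : Measurable (M.markovOp f) := Measurable.tsum fun e =>
    (M.p_measurable e).ennreal_ofReal.mul (hf.comp (M.w_measurable e))
  rw [M.lintegral_adjointOp _ hf, lintegral_map' hUf.aemeasurable hFae,
    lintegral_map' hf.aemeasurable hFae]
  have hfF : AEMeasurable (fun σ => f (M.codingMap x σ)) Λ := hf.comp_aemeasurable hFae
  calc ∫⁻ σ, M.markovOp f (M.codingMap x σ) ∂Λ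
      = ∫⁻ σ, ∑' e, ENNReal.ofReal (M.p e (M.codingMap x σ)) * f (M.w e (F σ)) ∂Λ := by
        refine lintegral_congr_ae ?_
        filter_upwards [hD] with σ hσ
        rw [← hF σ hσ]
        rfl
    _ = ∑' e, ∫⁻ σ, ENNReal.ofReal (M.p e (M.codingMap x σ)) * f (M.w e (F σ)) ∂Λ :=
        lintegral_tsum fun e => (aemeasurable_ofReal_p_codingMap hΛ e).mul
          (((hf.comp (M.w_measurable e)).comp hFm).mono past_le le_rfl).aemeasurable
    _ = ∑' e, ∫⁻ σ in cyl 1 [Letter.edge e], f (M.codingMap x (shift σ)) ∂Λ := by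
        refine tsum_congr fun e => ?_
        refine (setLIntegral_of_mem_equilibriumStates hΛ e
          ((hf.comp (M.w_measurable e)).comp hFm)).symm.trans ?_
        refine lintegral_congr_ae ?_
        filter_upwards [ae_restrict_of_ae hD, ae_codingMap_shift hΛ hx hu e] with σ h1 h2
        rw [h2, hF σ h1]
        rfl
    _ = ∫⁻ σ, f (M.codingMap x (shift σ)) ∂Λ := (edgeValued_of_mem hΛ).tsum_setLIntegral 1 _
    _ = ∫⁻ σ, f (M.codingMap x σ) ∂Λ := by
        conv_rhs => rw [← hΛ.1.2]
        rw [lintegral_map' (by rw [hΛ.1.2]; exact hfF) measurable_shift.aemeasurable]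

/-- Every equilibrium state is the measure `Φ(μ)` of its image `μ` under the coding map. -/
theorem eq_Phi_of_mem_equilibriumStates (hΛ : Λ ∈ M.equilibriumStates x)
    (hx : ∀ j, x j ∈ M.vset j) (hu : M.IsUniformlyContinuous) :
    Λ = M.Phi (Λ.map (M.codingMap x)) := by
  have hFae : AEMeasurable (M.codingMap x) Λ :=
    aemeasurable_codingMap (ae_mem_codingDomain_of_mem hΛ)
  refine IsCodeMeasure.eq_Phi ⟨hΛ.1.1, fun z hz l => ?_⟩
  rcases exists_eq_map_edge_or l with ⟨l, rfl⟩ | hl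
  · simp only [wordProb_map_edge]
    rw [lintegral_map' (M.measurable_pathProb l).aemeasurable hFae]
    have h1 := setLIntegral_cyl_of_mem_equilibriumStates hΛ hx hu l (h := fun _ => 1)
      (@measurable_const _ _ _ (past E) _)
    simp only [mul_one, setLIntegral_one] at h1
    rw [← h1, ← measure_cyl_of_map_shift hΛ.1.2 _ z (1 - z).toNat]
    congr 2
    omega
  · simp [(edgeValued_of_mem hΛ).measure_cyl_eq_zero hl, wordProb_eq_zero hl]

end Equilibrium

end MarkovSystem

/-! ### Hölder continuity of the coding map -/

/-- Markov's inequality in a form which also covers the threshold zero. -/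
theorem measure_lt_le_of_lintegral_le {Ω : Type*} [MeasurableSpace Ω] {μ : Measure Ω}
    {f : Ω → ℝ≥0∞} (hf : Measurable f) {C δ : ℝ≥0∞} (hC : C ≠ ∞) (h : ∫⁻ ω, f ω ∂μ ≤ C * δ) :
    μ {ω | C < f ω} ≤ δ := by
  rcases eq_or_ne C 0 with rfl | h0
  · rw [zero_mul, nonpos_iff_eq_zero, lintegral_eq_zero_iff hf] at h
    refine le_of_eq_of_le (measure_mono_null (fun ω hω => ?_) h) bot_le
    exact (ne_of_gt hω : f ω ≠ 0)
  · calc μ {ω | C < f ω} ≤ μ {ω | C ≤ f ω} := measure_mono fun ω (hω : C < f ω) => hω.le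
      _ ≤ (∫⁻ ω, f ω ∂μ) / C := meas_ge_le_lintegral_div hf.aemeasurable h0 hC
      _ ≤ δ := ENNReal.div_le_of_le_mul' h

theorem exists_codeDist_eq {E : Type*} {σ σ' : BiCode E} (h : σ ≠ σ') :
    ∃ m : ℕ, codeDist σ σ' = (1 / 2 : ℝ) ^ m ∧ ∀ i : ℤ, |i| < (m : ℤ) → σ i = σ' i := by
  refine ⟨_, if_neg h, ?_⟩
  refine Nat.sSup_mem (s := {k : ℕ | ∀ i : ℤ, |i| < (k : ℤ) → σ i = σ' i}) ⟨0, fun i hi => ?_⟩ ?_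
  · exact absurd hi (by simp)
  · obtain ⟨i, hi⟩ := Function.ne_iff.1 h
    refine ⟨i.natAbs, fun k hk => ?_⟩
    by_contra hlt
    exact hi (hk i (by rw [Int.abs_eq_natAbs]; exact_mod_cast not_le.1 hlt))

theorem tsum_ofReal_geometric {s : ℝ} (h0 : 0 ≤ s) (h1 : s < 1) {r : ℝ} (hr : 0 ≤ r) :
    ∑' i : ℕ, ENNReal.ofReal (r * s ^ i) = ENNReal.ofReal (r * (1 - s)⁻¹) := by
  rw [← ENNReal.ofReal_tsum_of_nonneg (fun i => by positivity)
    ((summable_geometric_of_lt_one h0 h1).mul_left r), tsum_mul_left,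
    tsum_geometric_of_lt_one h0 h1]

namespace MarkovSystem

section Regularity

variable {X E V : Type*} [MetricSpace X] [MeasurableSpace X] (M : MarkovSystem X E V) (x : V → X)

/-- The distance from the `m`-th approximation to the coding map, written as a lower limit so that
it is measurable on the whole code space; see `tailDist_eq`. -/
def tailDist (m : ℕ) (σ : BiCode E) : ℝ≥0∞ :=
  liminf (fun n => edist (M.approx x σ (n + m)) (M.approx x σ m)) atTop

/-- The sequences in the domain of the coding map for which the approximations with index at least
`k` converge at the rate `s`. -/
def regularSet (R s : ℝ) (k : ℕ) : Set (BiCode E) :=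
  {σ ∈ M.codingDomain x | ∀ m, k ≤ m → M.tailDist x m σ ≤ ENNReal.ofReal (R * s ^ (m + 1))}

theorem regularSet_mono (R s : ℝ) : Monotone (M.regularSet x R s) :=
  fun _ _ hk _ hσ => ⟨hσ.1, fun m hm => hσ.2 m (hk.trans hm)⟩

variable {M x}

theorem tailDist_eq {σ : BiCode E} (hσ : σ ∈ M.codingDomain x) (m : ℕ) :
    M.tailDist x m σ = edist (M.codingMap x σ) (M.approx x σ m) :=
  Tendsto.liminf_eq (((tendsto_add_atTop_iff_nat m).2 (tendsto_approx_codingMap hσ)).edist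
    tendsto_const_nhds)

/-- If the coordinates with index at most `m` in absolute value agree, the two sequences have the
same `m`-th approximation. -/
theorem dist_codingMap_le {R s : ℝ} (hR : 0 ≤ R) (hs : 0 ≤ s) {k : ℕ} {σ σ' : BiCode E}
    (hσ : σ ∈ M.regularSet x R s k) (hσ' : σ' ∈ M.regularSet x R s k) {m : ℕ} (hm : k ≤ m)
    (h : ∀ i : ℤ, |i| < ((m + 1 : ℕ) : ℤ) → σ i = σ' i) :
    dist (M.codingMap x σ) (M.codingMap x σ') ≤ 2 * R * s ^ (m + 1) := by
  have h1 := hσ.2 m hm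
  have h2 := hσ'.2 m hm
  have h3 : M.approx x σ m = M.approx x σ' m := approx_congr fun i hi => h _ (by
    rw [abs_neg, Nat.abs_cast]
    exact_mod_cast Nat.lt_succ_of_le hi)
  have hpos : 0 ≤ R * s ^ (m + 1) := by positivity
  rw [tailDist_eq hσ.1, edist_dist, ENNReal.ofReal_le_ofReal_iff hpos] at h1
  rw [tailDist_eq hσ'.1, edist_dist, ENNReal.ofReal_le_ofReal_iff hpos, ← h3] at h2
  linarith [dist_triangle_right (M.codingMap x σ) (M.codingMap x σ') (M.approx x σ m)]

variable [Countable E]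

theorem measurable_tailDist (m : ℕ) : Measurable (M.tailDist x m) :=
  Measurable.liminf fun n => measurable_edist_approx (n + m) m

theorem measurableSet_regularSet [CompleteSpace X] (R s : ℝ) (k : ℕ) :
    MeasurableSet (M.regularSet x R s k) := by
  have : M.regularSet x R s k = M.codingDomain x ∩ ⋂ (m : ℕ) (_ : k ≤ m),
      {σ | M.tailDist x m σ ≤ ENNReal.ofReal (R * s ^ (m + 1))} := by
    ext σ
    simp [regularSet]
  rw [this]
  exact measurableSet_codingDomain.inter <| .iInter fun m => .iInter fun _ =>
    measurableSet_le (measurable_tailDist m) measurable_const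

/-- If the mean tail distances are at most `2 s ^ (2 (m + 1)) c`, half of the exponential rate is
spent on the threshold `R s ^ (m + 1)`, and the other half bounds the probability of exceeding it.
The constant `R` is chosen such that the latter probability is at most `(1 - s) s ^ m`. -/
theorem measure_compl_regularSet_le [CompleteSpace X] {Λ : Measure (BiCode E)} {s c : ℝ}
    (hs0 : 0 < s) (hs1 : s < 1) (hc : 0 ≤ c) (hD : ∀ᵐ σ ∂Λ, σ ∈ M.codingDomain x)
    (h : ∀ m, ∫⁻ σ, M.tailDist x m σ ∂Λ ≤ ENNReal.ofReal (2 * (s ^ 2) ^ (m + 1) * c)) (k : ℕ) :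
    Λ (M.regularSet x (2 * c * s / (1 - s)) s k)ᶜ ≤ ENNReal.ofReal (s ^ k) := by
  set R : ℝ := 2 * c * s / (1 - s) with hR
  have hs2 : 0 < 1 - s := by linarith
  have hR0 : 0 ≤ R := by positivity
  have hsub : (M.regularSet x R s k)ᶜ ⊆ (M.codingDomain x)ᶜ ∪
      ⋃ i : ℕ, {σ | ENNReal.ofReal (R * s ^ (k + i + 1)) < M.tailDist x (k + i) σ} := by
    intro σ hσ
    by_cases h1 : σ ∈ M.codingDomain x
    · right
      have h2 : ¬ ∀ m, k ≤ m → M.tailDist x m σ ≤ ENNReal.ofReal (R * s ^ (m + 1)) :=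
        fun h2 => hσ ⟨h1, h2⟩
      push Not at h2
      obtain ⟨m, hm, hlt⟩ := h2
      obtain ⟨i, rfl⟩ := Nat.exists_eq_add_of_le hm
      exact mem_iUnion.2 ⟨i, hlt⟩
    · exact Or.inl h1
  calc Λ (M.regularSet x R s k)ᶜ
      ≤ Λ (M.codingDomain x)ᶜ +
        ∑' i : ℕ, Λ {σ | ENNReal.ofReal (R * s ^ (k + i + 1)) < M.tailDist x (k + i) σ} :=
        (measure_mono hsub).trans ((measure_union_le _ _).trans
          (add_le_add_right (measure_iUnion_le _) _))
    _ = ∑' i : ℕ, Λ {σ | ENNReal.ofReal (R * s ^ (k + i + 1)) < M.tailDist x (k + i) σ} := by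
        rw [show Λ (M.codingDomain x)ᶜ = 0 from hD, zero_add]
    _ ≤ ∑' i : ℕ, ENNReal.ofReal ((1 - s) * s ^ k * s ^ i) := by
        refine ENNReal.tsum_le_tsum fun i => ?_
        refine measure_lt_le_of_lintegral_le (measurable_tailDist _) ENNReal.ofReal_ne_top
          ((h (k + i)).trans (le_of_eq ?_))
        rw [← ENNReal.ofReal_mul (by positivity)]
        congr 1
        rw [hR]
        field_simp
        ring
    _ = ENNReal.ofReal (s ^ k) := by
        rw [tsum_ofReal_geometric hs0.le hs1 (by positivity)]
        congr 1
        field_simp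

end Regularity

end MarkovSystem

/-! ### Occupation averages -/

namespace MarkovSystem

section Occupation

variable {X E V : Type*} [MeasurableSpace X] (M : MarkovSystem X E V)

/-- The average of the distributions of the chain started at `y` at the times `1, …, n`. -/
def averageLaw (y : X) (n : ℕ) : Measure X :=
  (n : ℝ≥0∞)⁻¹ • ∑ k ∈ Finset.Icc 1 n, M.adjointOp^[k] (Measure.dirac y)

theorem averageLaw_vset (y : X) (n : ℕ) (j : V) :
    M.averageLaw y n (M.vset j) = M.occupation y n j := by
  simp [averageLaw, occupation]

theorem lintegral_averageLaw (y : X) (n : ℕ) (f : X → ℝ≥0∞) :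
    ∫⁻ z, f z ∂(M.averageLaw y n)
      = (n : ℝ≥0∞)⁻¹ * ∑ k ∈ Finset.Icc 1 n, ∫⁻ z, f z ∂(M.adjointOp^[k] (Measure.dirac y)) := by
  rw [averageLaw, lintegral_smul_measure, lintegral_finsetSum_measure]
  rfl

variable [Countable E]

theorem isProbabilityMeasure_averageLaw (y : X) {n : ℕ} (hn : n ≠ 0) :
    IsProbabilityMeasure (M.averageLaw y n) := by
  constructor
  rw [← lintegral_one, lintegral_averageLaw, Finset.sum_congr rfl fun k _ => by
    have := M.isProbabilityMeasure_adjointOp_iterate (Measure.dirac y) k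
    rw [lintegral_one, measure_univ]]
  simp only [Finset.sum_const, Nat.card_Icc, add_tsub_cancel_right, nsmul_eq_mul, mul_one]
  exact ENNReal.inv_mul_cancel (by exact_mod_cast hn) (ENNReal.natCast_ne_top n)

/-- One step of the chain changes an average over `n` steps by a telescoping sum only. -/
theorem wordLaw_adjointOp_averageLaw_le (y : X) (n : ℕ) (l : List E) :
    M.wordLaw (M.adjointOp (M.averageLaw y n)) l ≤ M.wordLaw (M.averageLaw y n) l + (n : ℝ≥0∞)⁻¹ ∧
    M.wordLaw (M.averageLaw y n) l
      ≤ M.wordLaw (M.adjointOp (M.averageLaw y n)) l + (n : ℝ≥0∞)⁻¹ := by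
  let t : ℕ → ℝ≥0∞ := fun k => M.wordLaw (M.adjointOp^[k] (Measure.dirac y)) l
  have ht : ∀ k, t k ≤ 1 := fun k => by
    have := M.isProbabilityMeasure_adjointOp_iterate (Measure.dirac y) k
    exact M.wordLaw_le_one _ l
  have h1 : M.wordLaw (M.averageLaw y n) l = (n : ℝ≥0∞)⁻¹ * ∑ k ∈ Finset.Icc 1 n, t k :=
    M.lintegral_averageLaw y n _
  have h2 : M.wordLaw (M.adjointOp (M.averageLaw y n)) l
      = (n : ℝ≥0∞)⁻¹ * ∑ k ∈ Finset.Icc 1 n, t (k + 1) := by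
    rw [wordLaw, M.lintegral_adjointOp _ (M.measurable_pathProb l), lintegral_averageLaw]
    congr 1
    refine Finset.sum_congr rfl fun k _ => ?_
    rw [← M.lintegral_adjointOp _ (M.measurable_pathProb l)]
    simp only [t]
    rw [Function.iterate_succ_apply']
    rfl
  have h3 : ∑ k ∈ Finset.Icc 1 n, t (k + 1) + t 1 = ∑ k ∈ Finset.Icc 1 n, t k + t (n + 1) := by
    have hsum : ∀ f : ℕ → ℝ≥0∞, ∑ k ∈ Finset.Icc 1 n, f k = ∑ k ∈ Finset.range n, f (k + 1) :=
      fun f => by rw [Finset.range_eq_Ico, Finset.sum_Ico_add' f 0 n 1]; rfl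
    rw [hsum, hsum, ← Finset.sum_range_succ (fun k => t (k + 1)), Finset.sum_range_succ']
  rw [h1, h2]
  constructor
  · calc (n : ℝ≥0∞)⁻¹ * ∑ k ∈ Finset.Icc 1 n, t (k + 1)
        ≤ (n : ℝ≥0∞)⁻¹ * (∑ k ∈ Finset.Icc 1 n, t k + 1) := by
          gcongr
          calc _ ≤ ∑ k ∈ Finset.Icc 1 n, t (k + 1) + t 1 := le_self_add
            _ ≤ _ := by rw [h3]; gcongr; exact ht _
      _ = _ := by rw [mul_add, mul_one]
  · calc (n : ℝ≥0∞)⁻¹ * ∑ k ∈ Finset.Icc 1 n, t k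
        ≤ (n : ℝ≥0∞)⁻¹ * (∑ k ∈ Finset.Icc 1 n, t (k + 1) + 1) := by
          gcongr
          calc _ ≤ ∑ k ∈ Finset.Icc 1 n, t k + t (n + 1) := le_self_add
            _ ≤ _ := by rw [← h3]; gcongr; exact ht _
      _ = _ := by rw [mul_add, mul_one]

/-- Tightness of the occupation measures on the vertices, together with the summability of the
suprema of the `p_e` at each vertex, makes the distributions of the next edge tight. -/
theorem exists_finset_one_le_sum_averageLaw [Countable V] (hdom : M.HasDominatingChain) {y : X}
    (htight : M.TightAt y) {ε : ℝ≥0∞} (hε : ε ≠ 0) :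
    ∃ C : Finset E, ∀ n : ℕ, n ≠ 0 → 1 ≤ ∑ e ∈ C, M.wordLaw (M.averageLaw y n) [e] + ε := by
  classical
  -- `C₀` carries all but `ε / 2` of the mass of the vertices, and at each vertex the edges outside
  -- of a finite set `B j` have a total probability of at most `ε / 2`
  have hε2 : ε / 2 ≠ 0 := by simpa using hε
  obtain ⟨C₀, hC₀⟩ := htight (ε / 2) (pos_iff_ne_zero.2 hε2)
  let s : E → ℝ≥0∞ := fun e => ⨆ z ∈ M.vset (M.src e), ENNReal.ofReal (M.p e z)
  have hB : ∀ j : V, ∃ B : Finset {e : E // M.src e = j},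
      ∑' e : {e : {e : E // M.src e = j} // e ∉ B}, s e.1 ≤ ε / 2 := by
    intro j
    have hfin : ∑' e : {e : E // M.src e = j}, s e ≠ ∞ := by
      refine ne_of_lt (lt_of_eq_of_lt (tsum_congr fun e => ?_) (hdom j))
      simp only [s, e.2]
    exact ((ENNReal.tendsto_tsum_compl_atTop_zero hfin).eventually_le_const
      (pos_iff_ne_zero.2 hε2)).exists
  choose B hB using hB
  refine ⟨C₀.biUnion fun j => (B j).map (Function.Embedding.subtype _), fun n hn => ?_⟩
  set C : Finset E := C₀.biUnion fun j => (B j).map (Function.Embedding.subtype _)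
  have hprob := M.isProbabilityMeasure_averageLaw y hn
  set ν := M.averageLaw y n
  have hq : ∀ e, M.wordLaw ν [e] ≤ s e * ν (M.vset (M.src e)) := by
    intro e
    have h1 : ∀ z, M.pathProb [e] z ≤ (M.vset (M.src e)).indicator (fun _ => s e) z := by
      intro z
      simp only [pathProb, mul_one]
      by_cases hz : z ∈ M.vset (M.src e)
      · rw [indicator_of_mem hz]
        exact le_iSup₂_of_le z hz le_rfl
      · rw [indicator_of_notMem hz, M.p_eq_zero e z hz, ENNReal.ofReal_zero]
    refine (lintegral_mono h1).trans_eq ?_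
    rw [lintegral_indicator (M.vset_measurable _), setLIntegral_const]
  have hvert : ∀ j, ∑' e : {e : E // M.src e = j}, M.wordLaw ν [e.1] ≤ ν (M.vset j) := by
    intro j
    simp only [wordLaw, pathProb, mul_one]
    rw [← lintegral_tsum fun e => (M.p_measurable _).ennreal_ofReal.aemeasurable,
      ← lintegral_indicator_one (M.vset_measurable j)]
    refine lintegral_mono fun z => ?_
    by_cases hz : z ∈ M.vset j
    · have := M.tsum_src hz fun _ => 1
      simp only [mul_one, M.tsum_ofReal_p] at this
      rw [indicator_of_mem hz, this, Pi.one_apply]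
    · rw [indicator_of_notMem hz, nonpos_iff_eq_zero, ENNReal.tsum_eq_zero]
      rintro ⟨e, rfl⟩
      rw [M.p_eq_zero e z hz, ENNReal.ofReal_zero]
  have hmass : ∑' j, ν (M.vset j) = 1 := by
    rw [← measure_iUnion M.vset_disjoint M.vset_measurable, M.vset_cover, measure_univ]
  let r : E → ℝ≥0∞ := fun e => if e ∈ C then 0 else M.wordLaw ν [e]
  have hr : ∀ j, ∑' e : {e : E // M.src e = j}, r e
      ≤ (if j ∉ C₀ then ν (M.vset j) else 0) + ε / 2 * ν (M.vset j) := by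
    intro j
    by_cases hj : j ∈ C₀
    · simp only [hj, not_true, if_false, zero_add]
      calc ∑' e : {e : E // M.src e = j}, r e
          ≤ ∑' e : {e : E // M.src e = j}, (if e ∈ B j then 0 else s e) * ν (M.vset j) := by
            refine ENNReal.tsum_le_tsum fun e => ?_
            by_cases he : e ∈ B j
            · have : e.1 ∈ C := Finset.mem_biUnion.2 ⟨j, hj, Finset.mem_map_of_mem _ he⟩
              simp [r, this]
            · rw [if_neg he]
              refine le_trans ?_ (le_of_le_of_eq (hq e) (by rw [e.2]))
              simp only [r]
              split_ifs
              exacts [zero_le, le_rfl]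
        _ ≤ ε / 2 * ν (M.vset j) := by
            rw [ENNReal.tsum_mul_right]
            gcongr
            refine le_trans (le_of_eq ?_) (hB j)
            refine (tsum_subtype_eq_of_support_subset (s := {e | e ∉ B j})
              (f := fun e : {e : E // M.src e = j} => if e ∈ B j then 0 else s e)
              fun e he => ?_).symm.trans (tsum_congr fun e => if_neg e.2)
            exact fun h => he (if_pos h)
    · simp only [hj, not_false_eq_true, if_true]
      refine le_trans (ENNReal.tsum_le_tsum fun e => ?_) (le_add_right (hvert j))
      simp only [r]
      split_ifs
      exacts [zero_le, le_rfl]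
  have hrsum : ∑' e, r e ≤ ε := by
    rw [← (Equiv.sigmaFiberEquiv M.src).tsum_eq r, ENNReal.tsum_sigma']
    refine (ENNReal.tsum_le_tsum fun j => hr j).trans ?_
    rw [ENNReal.tsum_add, ENNReal.tsum_mul_left, hmass, mul_one]
    refine (add_le_add_left ?_ _).trans_eq (ENNReal.add_halves ε)
    refine le_trans (le_of_eq ?_) (hC₀ n (Nat.one_le_iff_ne_zero.2 hn)).le
    simp only [← averageLaw_vset]
    refine (tsum_subtype_eq_of_support_subset (s := {j | j ∉ C₀})
      (f := fun j => if j ∉ C₀ then ν (M.vset j) else 0)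
      fun j hj => ?_).symm.trans (tsum_congr fun j => if_pos j.2)
    by_contra h
    exact hj (if_neg h)
  have h1 : ∑' e, M.wordLaw ν [e] = 1 := by
    simpa [M.wordLaw_nil] using M.tsum_wordLaw_snoc ν []
  rw [← h1, ← ENNReal.sum_add_tsum_compl C]
  gcongr
  refine le_trans (ENNReal.tsum_le_tsum fun e => ?_) ((ENNReal.tsum_comp_le_tsum_of_injective
    Subtype.val_injective r).trans hrsum)
  have : e.1 ∉ C := e.2
  simp [r, this]

end Occupation

section Recurrence

variable {X E V : Type*} [MeasurableSpace X] {M : MarkovSystem X E V}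

theorem isPath_of_pathProb_ne_zero {l : List E} {y : X} (h : M.pathProb l y ≠ 0) : M.IsPath l := by
  induction l generalizing y with
  | nil => exact List.isChain_nil
  | cons e l ih =>
    have h1 : ENNReal.ofReal (M.p e y) ≠ 0 := left_ne_zero_of_mul h
    have h2 : M.pathProb l (M.w e y) ≠ 0 := right_ne_zero_of_mul h
    cases l with
    | nil => exact List.isChain_singleton e
    | cons e' l =>
      refine List.isChain_cons_cons.2 ⟨?_, ih h2⟩
      exact eq_of_mem_vset (mem_vset_src_of_ne_zero (left_ne_zero_of_mul h2))
        (M.w_mapsTo e (mem_vset_src_of_ne_zero h1))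

/-- An edge which is charged by a limit of the occupation averages is reached from the starting
point at arbitrarily late times. -/
theorem exists_pathProb_pos [Countable E] {y : X} {𝒰 : Filter ℕ} [𝒰.NeBot] (h𝒰 : 𝒰 ≤ atTop)
    {r : ℝ≥0∞} (hr : 0 < r) (e : E)
    (h : Tendsto (fun n => M.wordLaw (M.averageLaw y (n + 1)) [e]) 𝒰 (𝓝 r)) (n : ℕ) :
    ∃ l : List E, n ≤ l.length ∧ 0 < M.pathProb (l ++ [e]) y := by
  by_contra! hcon
  have hzero : ∀ k, n ≤ k → M.wordLaw (M.adjointOp^[k] (Measure.dirac y)) [e] = 0 := by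
    intro k hk
    rw [← M.tsum_wordLaw_append, ENNReal.tsum_eq_zero]
    intro u
    rw [wordLaw, lintegral_dirac' _ (M.measurable_pathProb _)]
    exact nonpos_iff_eq_zero.1 (hcon (List.ofFn u) (by simpa using hk))
  have hle : ∀ N : ℕ, M.wordLaw (M.averageLaw y (N + 1)) [e] ≤ ((N + 1 : ℕ) : ℝ≥0∞)⁻¹ * n := by
    intro N
    rw [wordLaw, lintegral_averageLaw]
    gcongr
    calc _ ≤ ∑ k ∈ Finset.Icc 1 (N + 1), if k < n then (1 : ℝ≥0∞) else 0 := by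
          refine Finset.sum_le_sum fun k _ => ?_
          split_ifs with hk
          · have := M.isProbabilityMeasure_adjointOp_iterate (Measure.dirac y) k
            exact M.wordLaw_le_one _ _
          · exact (hzero k (not_lt.1 hk)).le
      _ = (((Finset.Icc 1 (N + 1)).filter (· < n)).card : ℝ≥0∞) := by simp
      _ ≤ n := by
          have : (Finset.Icc 1 (N + 1)).filter (· < n) ⊆ Finset.range n := fun k hk =>
            Finset.mem_range.2 (Finset.mem_filter.1 hk).2
          exact_mod_cast (Finset.card_le_card this).trans_eq (Finset.card_range n)
  have hlim : Tendsto (fun N : ℕ => ((N + 1 : ℕ) : ℝ≥0∞)⁻¹ * n) atTop (𝓝 0) := by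
    have h1 := (ENNReal.tendsto_inv_nat_nhds_zero).comp (tendsto_add_atTop_nat 1)
    simpa using ENNReal.Tendsto.mul_const (b := (n : ℝ≥0∞)) h1 (Or.inr (ENNReal.natCast_ne_top n))
  exact hr.not_ge (le_of_tendsto_of_tendsto' h (hlim.mono_left h𝒰) hle)

end Recurrence

end MarkovSystem

/-! ### Asymptotic states from recurrence, and the sets of Hölder continuity -/

namespace MarkovSystem

variable {X E V : Type*} [MetricSpace X] [MeasurableSpace X] {M : MarkovSystem X E V} {x : V → X}
  {a : ℝ}

/-- The bound `b / (1 - a)` for the mean deviation is reproduced by the estimate for one step of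
the chain. -/
theorem ofReal_mul_add_bConst_le (ha0 : 0 < a) (ha1 : a < 1) (hb : M.bConst x < ∞) {d : ℝ≥0∞} :
    ENNReal.ofReal a * (d + ENNReal.ofReal ((M.bConst x).toReal / (1 - a))) + M.bConst x
      ≤ d + ENNReal.ofReal ((M.bConst x).toReal / (1 - a)) := by
  have h1a : 0 < 1 - a := sub_pos.2 ha1
  have h : ENNReal.ofReal a * ENNReal.ofReal ((M.bConst x).toReal / (1 - a)) + M.bConst x
      = ENNReal.ofReal ((M.bConst x).toReal / (1 - a)) := by
    have hb0 : 0 ≤ (M.bConst x).toReal := ENNReal.toReal_nonneg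
    conv_lhs => rw [← ENNReal.ofReal_toReal hb.ne]
    rw [ENNReal.toReal_ofReal hb0, ← ENNReal.ofReal_mul ha0.le,
      ← ENNReal.ofReal_add (by positivity) hb0]
    congr 1
    field_simp
    ring
  rw [mul_add, add_assoc, h]
  gcongr
  exact mul_le_of_le_one_left zero_le (ENNReal.ofReal_le_one.2 ha1.le)

variable [Countable E] [Countable V]

/-- The asymptotic state is a limit of the states of the chain with initial distributions the
occupation averages, along a non-principal ultrafilter. -/
theorem exists_asymptoticState_of_tightAt [CompleteSpace X] [BorelSpace X]
    (hx : ∀ j, x j ∈ M.vset j) (ha0 : 0 < a) (ha1 : a < 1) (hc : M.IsContractive a)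
    (hu : M.IsUniformlyContinuous) (hb : M.bConst x < ∞) (hdom : M.HasDominatingChain) {y : X}
    (ht : M.TightAt y) :
    ∃ Λ ∈ M.asymptoticStates x, ∀ j : V, 0 < Λ (M.arrival j) → ∀ n : ℕ,
      ∃ (l : List E) (e : E), n ≤ (l ++ [e]).length ∧ M.IsPath (l ++ [e]) ∧ M.tgt e = j ∧
        0 < M.pathMeasure y (posCyl ((l ++ [e]).map Letter.edge)) := by
  let ν : ℕ → Measure X := fun n => M.averageLaw y (n + 1)
  have hν : ∀ n, IsProbabilityMeasure (ν n) := fun n =>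
    M.isProbabilityMeasure_averageLaw y n.succ_ne_zero
  have hle : (hyperfilter ℕ : Filter ℕ) ≤ atTop := Nat.cofinite_eq_atTop ▸ hyperfilter_le_cofinite
  have hinv : ∀ (l : List E) (r : ℝ≥0∞),
      Tendsto (fun n => M.wordLaw (ν n) l) (hyperfilter ℕ) (𝓝 r) →
      Tendsto (fun n => M.wordLaw (M.adjointOp (ν n)) l) (hyperfilter ℕ) (𝓝 r) := by
    intro l r h
    have h0 : Tendsto (fun n : ℕ => ((n + 1 : ℕ) : ℝ≥0∞)⁻¹) (hyperfilter ℕ) (𝓝 0) :=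
      (ENNReal.tendsto_inv_nat_nhds_zero.comp (tendsto_add_atTop_nat 1)).mono_left hle
    refine tendsto_of_tendsto_of_tendsto_of_le_of_le
      (g := fun n => M.wordLaw (ν n) l - ((n + 1 : ℕ) : ℝ≥0∞)⁻¹)
      (h := fun n => M.wordLaw (ν n) l + ((n + 1 : ℕ) : ℝ≥0∞)⁻¹) ?_ ?_ (fun n => ?_) fun n => ?_
    · simpa using ENNReal.Tendsto.sub h h0 (Or.inr ENNReal.zero_ne_top)
    · simpa using h.add h0
    · exact tsub_le_iff_right.2 (M.wordLaw_adjointOp_averageLaw_le y (n + 1) l).2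
    · exact (M.wordLaw_adjointOp_averageLaw_le y (n + 1) l).1
  obtain ⟨Λ, hΛ⟩ := exists_isLimitState (hyperfilter ℕ) hν hinv fun ε hε => by
    obtain ⟨C, hC⟩ := M.exists_finset_one_le_sum_averageLaw hdom ht hε
    exact ⟨C, fun n => hC (n + 1) n.succ_ne_zero⟩
  -- the chain starts at `y`, whose deviation need not be at most `b / (1 - a)`
  let c : ℝ≥0∞ := M.deviation x y + ENNReal.ofReal ((M.bConst x).toReal / (1 - a))
  have hac : ENNReal.ofReal a * c + M.bConst x ≤ c := ofReal_mul_add_bConst_le ha0 ha1 hb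
  have hctop : c ≠ ∞ := ENNReal.add_ne_top.2 ⟨(M.deviation_lt_top x y).ne, ENNReal.ofReal_ne_top⟩
  have hνc : ∀ n, ∫⁻ z, M.deviation x z ∂(ν n) ≤ c := by
    intro n
    have hk : ∀ k, ∫⁻ z, M.deviation x z ∂(M.adjointOp^[k] (Measure.dirac y)) ≤ c := by
      refine hc.lintegral_deviation_iterate_le hx hac _ ?_
      rw [lintegral_dirac' _ (M.measurable_deviation x)]
      exact le_self_add
    rw [M.lintegral_averageLaw]
    calc _ ≤ ((n + 1 : ℕ) : ℝ≥0∞)⁻¹ * ∑ k ∈ Finset.Icc 1 (n + 1), c := by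
          gcongr with k
          exact hk k
      _ = c := by
          rw [Finset.sum_const, Nat.card_Icc, add_tsub_cancel_right, nsmul_eq_mul, ← mul_assoc,
            ENNReal.inv_mul_cancel (by exact_mod_cast n.succ_ne_zero) (ENNReal.natCast_ne_top _),
            one_mul]
  refine ⟨Λ, hΛ.mem_asymptoticStates hν ha1 hc hx hu hac hctop hνc, fun j hj n => ?_⟩
  obtain ⟨e, he, hpos⟩ : ∃ e, M.tgt e = j ∧ 0 < Λ (cyl 0 [Letter.edge e]) := by
    by_contra! hcon
    have hsub : M.arrival j ⊆ ⋃ e : {e : E // M.tgt e = j}, cyl 0 [Letter.edge e.1] := by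
      rintro σ ⟨hσ, hj⟩
      obtain ⟨e, he⟩ := hσ.1 0
      rw [← he] at hj
      exact mem_iUnion.2 ⟨⟨e, hj⟩, mem_cyl_singleton.2 he.symm⟩
    refine hj.ne' (measure_mono_null hsub (measure_iUnion_null fun e => ?_))
    exact nonpos_iff_eq_zero.1 (hcon e.1 e.2)
  obtain ⟨l, hl, hlpos⟩ := M.exists_pathProb_pos hle hpos e (hΛ.tendsto_wordLaw 0 [e]) n
  refine ⟨l, e, hl.trans (by simp), isPath_of_pathProb_ne_zero hlpos.ne', he, ?_⟩
  rwa [pathMeasure_posCyl]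

/-- Outside of small sets the coding map is Hölder continuous, uniformly in the invariant
measure. -/
theorem exists_holder_sets [CompleteSpace X] [BorelSpace X] (hx : ∀ j, x j ∈ M.vset j)
    (ha0 : 0 < a) (ha1 : a < 1) (hc : M.IsContractive a) (hb : M.bConst x < ∞) :
    ∃ Q : ℕ → Set (BiCode E), (∀ k, MeasurableSet (Q k)) ∧ Monotone Q ∧
      (∀ k, Q k ⊆ M.pathSpace) ∧
      (∀ μ ∈ M.invariantMeasures, ∀ n : ℕ, 1 ≤ n →
        ∑' k : ℕ, M.Phi μ (Q (n + k))ᶜ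
          ≤ ENNReal.ofReal (1 / (1 - Real.sqrt a) * a ^ ((n : ℝ) / 2))) ∧
      ∀ k : ℕ, 1 ≤ k → ∀ σ ∈ Q k, ∀ σ' ∈ Q k, codeDist σ σ' ≤ (1 / 2 : ℝ) ^ (k + 1) →
        dist (M.codingMap x σ) (M.codingMap x σ')
          ≤ 8 * (M.bConst x).toReal / ((1 - Real.sqrt a) * (1 - a)) *
            codeDist σ σ' ^ (Real.log (Real.sqrt a) / Real.log (1 / 2)) := by
  set b : ℝ := (M.bConst x).toReal
  set s : ℝ := Real.sqrt a with hs_def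
  have hs0 : 0 < s := Real.sqrt_pos.2 ha0
  have hs1 : s < 1 := by rw [hs_def, Real.sqrt_lt' one_pos]; simpa using ha1
  have hss : s ^ 2 = a := Real.sq_sqrt ha0.le
  have h1s : 0 < 1 - s := sub_pos.2 hs1
  have h1a : 0 < 1 - a := sub_pos.2 ha1
  have hb0 : 0 ≤ b := ENNReal.toReal_nonneg
  set c : ℝ := b / (1 - a) with hc_def
  have hc0 : 0 ≤ c := by positivity
  have hac : ENNReal.ofReal a * ENNReal.ofReal c + M.bConst x ≤ ENNReal.ofReal c := by
    simpa using ofReal_mul_add_bConst_le (d := 0) ha0 ha1 hb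
  set R : ℝ := 2 * c * s / (1 - s) with hR_def
  have hR0 : 0 ≤ R := by positivity
  refine ⟨M.regularSet x R s, fun k => measurableSet_regularSet R s k, M.regularSet_mono x R s,
    fun k σ hσ => hσ.1.1, fun μ hμ n _ => ?_, fun k _ σ hσ σ' hσ' hd => ?_⟩
  · have hΛ := isLimitState_Phi hμ
    have hdev := hc.lintegral_deviation_le_of_invariant ha1 hx hac hμ
    have hmeas : ∀ k, M.Phi μ (M.regularSet x R s k)ᶜ ≤ ENNReal.ofReal (s ^ k) := by
      refine measure_compl_regularSet_le hs0 hs1 hc0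
        (hΛ.ae_mem_codingDomain (fun _ => hμ.1) ha1 hc hx hac ENNReal.ofReal_ne_top fun _ => hdev)
        fun m => ?_
      refine (hΛ.lintegral_liminf_edist_approx_le (fun _ => hμ.1) ha1 hc hx hac
        (fun _ => hdev) m).trans_eq ?_
      rw [hss, ENNReal.ofReal_mul (by positivity), ENNReal.ofReal_mul zero_le_two,
        ENNReal.ofReal_pow ha0.le, ENNReal.ofReal_ofNat]
    have hpow : a ^ ((n : ℝ) / 2) = s ^ n := by
      rw [hs_def, Real.sqrt_eq_rpow, ← Real.rpow_natCast, ← Real.rpow_mul ha0.le]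
      congr 1
      ring
    calc ∑' k : ℕ, M.Phi μ (M.regularSet x R s (n + k))ᶜ
        ≤ ∑' k : ℕ, ENNReal.ofReal (s ^ n * s ^ k) :=
          ENNReal.tsum_le_tsum fun k => by rw [← pow_add]; exact hmeas (n + k)
      _ = ENNReal.ofReal (1 / (1 - s) * a ^ ((n : ℝ) / 2)) := by
          rw [tsum_ofReal_geometric hs0.le hs1 (by positivity), hpow, one_div, mul_comm]
  · rcases eq_or_ne σ σ' with rfl | hne
    · rw [dist_self]
      refine mul_nonneg (by positivity) (Real.rpow_nonneg ?_ _)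
      simp [codeDist]
    · obtain ⟨m, hm, hagree⟩ := exists_codeDist_eq hne
      rw [hm] at hd ⊢
      have hkm : k + 1 ≤ m := (pow_le_pow_iff_right_of_lt_one₀ (by norm_num) (by norm_num)).1 hd
      obtain ⟨m, rfl⟩ : ∃ m', m = m' + 1 := ⟨m - 1, by omega⟩
      have hexp : ((1 / 2 : ℝ) ^ (m + 1)) ^ (Real.log s / Real.log (1 / 2)) = s ^ (m + 1) := by
        have hlog : Real.log (1 / 2) ≠ 0 := (Real.log_neg (by norm_num) (by norm_num)).ne
        have h2 : (1 / 2 : ℝ) ^ (Real.log s / Real.log (1 / 2)) = s := by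
          rw [Real.rpow_def_of_pos (by norm_num), mul_div_cancel₀ _ hlog, Real.exp_log hs0]
        rw [← Real.rpow_natCast, ← Real.rpow_mul (by norm_num), mul_comm,
          Real.rpow_mul (by norm_num), h2, Real.rpow_natCast]
      rw [hexp]
      refine (dist_codingMap_le hR0 hs0.le hσ hσ' (by omega) hagree).trans ?_
      gcongr
      calc 2 * R = 4 * s * (b / ((1 - s) * (1 - a))) := by
            rw [hR_def, hc_def]; field_simp; ring
        _ ≤ 8 * (b / ((1 - s) * (1 - a))) := by
            gcongr
            linarith
        _ = 8 * b / ((1 - s) * (1 - a)) := by rw [mul_div_assoc]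

end MarkovSystem

theorem theorem5 {X E V : Type*} [MetricSpace X] [CompleteSpace X] [MeasurableSpace X]
    [BorelSpace X] [Countable E] [Countable V] (M : MarkovSystem X E V)
    (x : V → X) (hx : ∀ j, x j ∈ M.vset j)
    (a : ℝ) (ha0 : 0 < a) (ha1 : a < 1) (hcontr : M.IsContractive a)
    (hunif : M.IsUniformlyContinuous) (hb : M.bConst x < ∞) :
    (M.HasDominatingChain → ∀ x₀ : X, M.TightAt x₀ →
      ∃ Λ ∈ M.asymptoticStates x, ∀ j : V, 0 < Λ (M.arrival j) → ∀ n : ℕ,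
        ∃ (l : List E) (e : E), n ≤ (l ++ [e]).length ∧ M.IsPath (l ++ [e]) ∧ M.tgt e = j ∧
          0 < M.pathMeasure x₀ (posCyl ((l ++ [e]).map Letter.edge))) ∧
    (M.equilibriumStates x ⊆ M.Phi '' M.invariantMeasures ∧
      M.Phi '' M.invariantMeasures ⊆ M.asymptoticStates x ∧
      ∀ μ ∈ M.invariantMeasures, (M.Phi μ).map (M.codingMap x) = μ) ∧
    (∃ Q : ℕ → Set (BiCode E), (∀ k, MeasurableSet (Q k)) ∧ Monotone Q ∧
      (∀ k, Q k ⊆ M.pathSpace) ∧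
      (∀ μ ∈ M.invariantMeasures, ∀ n : ℕ, 1 ≤ n →
        ∑' k : ℕ, M.Phi μ (Q (n + k))ᶜ
          ≤ ENNReal.ofReal (1 / (1 - Real.sqrt a) * a ^ ((n : ℝ) / 2))) ∧
      ∀ k : ℕ, 1 ≤ k → ∀ σ ∈ Q k, ∀ σ' ∈ Q k, codeDist σ σ' ≤ (1 / 2 : ℝ) ^ (k + 1) →
        dist (M.codingMap x σ) (M.codingMap x σ')
          ≤ 8 * (M.bConst x).toReal / ((1 - Real.sqrt a) * (1 - a)) *
            codeDist σ σ' ^ (Real.log (Real.sqrt a) / Real.log (1 / 2))) := by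
  have hac : ENNReal.ofReal a * ENNReal.ofReal ((M.bConst x).toReal / (1 - a)) + M.bConst x
      ≤ ENNReal.ofReal ((M.bConst x).toReal / (1 - a)) := by
    simpa using M.ofReal_mul_add_bConst_le (d := 0) ha0 ha1 hb
  refine ⟨fun hdom y ht =>
    MarkovSystem.exists_asymptoticState_of_tightAt hx ha0 ha1 hcontr hunif hb hdom ht,
    ⟨fun Λ hΛ => ?_, ?_, fun μ hμ => ?_⟩, MarkovSystem.exists_holder_sets hx ha0 ha1 hcontr hb⟩
  · exact ⟨_, MarkovSystem.map_codingMap_mem_invariantMeasures hΛ hx hunif,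
      (MarkovSystem.eq_Phi_of_mem_equilibriumStates hΛ hx hunif).symm⟩
  · rintro _ ⟨μ, hμ, rfl⟩
    exact (MarkovSystem.isLimitState_Phi hμ).mem_asymptoticStates (fun _ => hμ.1) ha1 hcontr hx
      hunif hac ENNReal.ofReal_ne_top
      fun _ => hcontr.lintegral_deviation_le_of_invariant ha1 hx hac hμ
  · exact MarkovSystem.map_codingMap_Phi ha1 hcontr hx hac ENNReal.ofReal_ne_top hμ

end
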